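/- \textbf{Setting.} Let $h_{ij}$ be an analytic negative definite metric on a ball $\mathcal B_a\subset\mathbb R^3$ about the point at infinity $i=0$, in $h$-normal coordinates $x^i$ with $h_{ij}(0)=-\delta_{ij}$, and in the conformal normal gauge: $\langle b,\dot x\rangle=0$ along every solution $(x(\lambda),b(\lambda))$ of the conformal geodesic equations of $h$ with $x(0)=i$, $h(\dot x,\dot x)(i)=-1$, $b(0)=0$. Let $\mathring U,\mathring W$ be analytic on $\mathcal B_a$ with $\mathring U(i)=1$, such that $\mathring U/|x|$ (off $i$) and $\mathring W$ are annihilated by $\Delta_h-\frac18 r$, $\mathring\vartheta=\mathring U/|x|+\mathring W>0$ off $i$, and $\mathring\vartheta^4h$ is a static vacuum initial metric, i.e. there is a lapse $v>0$ with $v\to1$ at $i$, $\tilde r_{ij}=v^{-1}\tilde D_i\tilde D_jv$, $\tilde\Delta v=0$. Let $p_\bullet\ge 0$. The time symmetric data given by $h$ and $\vartheta=\mathring U/|x|+\mathring W+\breve W>0$ are \emph{static up to order $p_\bullet$} if $\breve W$ is analytic, $(\Delta_h-\frac18r)\breve W=0$, and the Taylor series of $\breve W$ at $i$ starts at order $p_\bullet+1$.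 Write $\Omega=\vartheta^{-2}$, $\mathring\Omega=\mathring\vartheta^{-2}$. \textbf{Transport equations.} For $t\in SU(2)$ let $e_{AB}(\rho,t)$ be the spin frame $E_{CD}t^C{}_At^D{}_B$ at $i$ ($E_{AB}$ fixed, $h(E_{AB},E_{CD})=h_{ABCD}=-\epsilon_{A(C}\epsilon_{D)B}$), parallelly propagated along the radial geodesic $x=\rho\,e_3(t)$, $e_3=\sqrt2e_{01}$, and let $X_\pm$ be the left-invariant complex vector fields on $SU(2)$ with $[X,X_\pm]=\pm2X_\pm$, $[X_+,X_-]=-X$ for which, at $\rho=0$, $e_{00}=X_+/(\sqrt2\rho)$ and $e_{11}=-X_- /(\sqrt2\rho)$. Put $\kappa=\rho$, $\omega=2\Omega/\sqrt{|D_k\Omega D^k\Omega|}$, $\Theta=\kappa^{-1}\Omega(1-\kappa^2\tau^2/\omega^2)$, $d_{AB}=D_{AB}\Omega$. The unknown $\boldsymbol\upsilon$ has the 45 components of $c^\mu_{AB}$ ($\mu=\tau,\rho,+,-$), $\xi_{ABCD}$, $\chi_{ABCD}$, $f_{AB}$ and $\Theta_{ABCD}$ (all symmetric in $AB$; $\xi,\chi$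 also in $CD$), and $\boldsymbol\phi$ the 5 components of $\phi_{ABCD}=\phi_{(ABCD)}$. With $\eta=\frac12(\phi+\phi^+)$ and $\mu=-\frac i2(\phi-\phi^+)$, where $\phi^+$ is the Hermitian conjugate, the evolution equations of the extended conformal field equations in the conformal Gaussian gauge are \begin{align*} \partial_\tau c^\mu_{AB}&=-\chi_{AB}{}^{EF}c^\mu_{EF}-\delta^\mu_\tau f_{AB},\qquad \partial_\tau f_{AB}=-\chi_{AB}{}^{EF}f_{EF}+\tfrac1{\sqrt2}\Theta_{ABQ}{}^Q,\\ \partial_\tau\xi_{ABCD}&=-\chi_{AB}{}^{EF}\xi_{EFCD}+\tfrac1{\sqrt2}(\epsilon_{AC}\chi_{BDEF}+\epsilon_{BD}\chi_{ACEF})f^{EF}-\sqrt2\chi_{AB(C}{}^Ef_{D)E}\\ &\quad-\tfrac12(\epsilon_{AC}\Theta_{BDQ}{}^Q+\epsilon_{BD}\Theta_{ACQ}{}^Q)-i\Theta\mu_{ABCD},\\ \partial_\tau\chi_{ABCD}&=-\chi_{AB}{}^{EF}\chi_{EFCD}-\Theta_{AB(CD)}+\Theta\eta_{ABCD},\\ \partial_\tau\Theta_{AB(CD)}&=-\chi_{AB}{}^{EF}\Theta_{EF(CD)}-\partial_\tau\Theta\,\eta_{ABCD}+i\sqrt2\,d^E{}_{(C}\mu_{D)ABE},\\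 \partial_\tau\Theta_{ABQ}{}^Q&=-\chi_{AB}{}^{EF}\Theta_{EFQ}{}^Q+\sqrt2\,d^{EF}\eta_{ABEF}, \end{align*} together with the five propagation equations $\nabla^A{}_0\phi_{A000}=0$, $\nabla^A{}_0\phi_{A001}+\nabla^A{}_1\phi_{A000}=0$, $\nabla^A{}_0\phi_{A011}+\nabla^A{}_1\phi_{A001}=0$, $\nabla^A{}_0\phi_{A111}+\nabla^A{}_1\phi_{A011}=0$, $\nabla^A{}_1\phi_{A111}=0$ of the Bianchi identity, where $\nabla_{AB}$ has frame part $c^\mu_{AB}\partial_\mu+\frac1{\sqrt2}\epsilon_{AB}\partial_\tau$ (with $\partial_\pm=X_\pm$) and connection coefficients $\Gamma_{ABCD}=\frac1{\sqrt2}(\xi_{ABCD}-\chi_{ABCD})-\frac12\epsilon_{AB}f_{CD}$. The initial data at $\tau=0$ are: $c^\tau_{AB}=0$ and $c^\rho_{AB},c^\pm_{AB}$ the coefficients of $\rho\,e_{AB}$ with respect to $\partial_\rho,X_\pm$; $\xi_{ABCD}=\sqrt2\big(\rho\gamma_{ABCD}-\frac12(\epsilon_{AC}x_{BD}+\epsilon_{BD}x_{AC})\big)$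 with $\gamma_{ABCD}$ the $h$-connection coefficients of $e_{AB}$; $\chi_{ABCD}=0$; $f_{AB}=x_{AB}=\sqrt2\epsilon_{(A}{}^0\epsilon_{B)}{}^1$; and $$\Theta_{ABCD}=-\frac{\kappa^2}{\Omega}D_{(AB}D_{CD)}\Omega+\frac{\kappa^2}{12}r\,h_{ABCD},\qquad \phi_{ABCD}=\frac{\kappa^3}{\Omega^2}\big(D_{(AB}D_{CD)}\Omega+\Omega s_{ABCD}\big),$$ where $s$ is the trace-free Ricci tensor of $h$. The transport equations of order $p$ for $(\boldsymbol\upsilon^{(p)},\boldsymbol\phi^{(p)})$ on $\mathcal I=\{\rho=0,\ |\tau|<1\}\cong(-1,1)\times SU(2)$, and their initial data at $\tau=0$, are obtained from these equations and data by applying $\partial_\rho^p$ and setting $\rho=0$ (so that $\partial_\rho\boldsymbol\phi^{(p)}=\boldsymbol\phi^{(p+1)}$). Let $(\boldsymbol\upsilon^{(p)},\boldsymbol\phi^{(p)})_{p\ge0}$ and $(\mathring{\boldsymbol\upsilon}^{(p)},\mathring{\boldsymbol\phi}^{(p)})_{p\ge0}$ be smooth solutions on $\mathcal I$ of the transport equations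 for all orders, for the conformal factors $\Omega$ and $\mathring\Omega$ respectively, and put $\breve{\boldsymbol\upsilon}^{(p)}=\boldsymbol\upsilon^{(p)}-\mathring{\boldsymbol\upsilon}^{(p)}$, $\breve{\boldsymbol\phi}^{(p)}=\boldsymbol\phi^{(p)}-\mathring{\boldsymbol\phi}^{(p)}$. \textbf{Lemma.} For data which are static up to order $p_\bullet$ one has, on all of $\mathcal I$, $$\breve{\boldsymbol\upsilon}^{(p)}=0\quad(0\le p\le p_\bullet+1),\qquad \breve{\boldsymbol\phi}^{(p)}=0\quad(0\le p\le p_\bullet).$$ The first deviation from the static evolution appears in $\boldsymbol\phi^{(p_\bullet+1)}$: if the order $p_\bullet+1$ part of the Taylor series of $\breve W$ at $i$ does not vanish, then $\breve{\boldsymbol\phi}^{(p_\bullet+1)}\neq0$, already at $\tau=0$. -/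

import Mathlib

open Filter Topology Set
open scoped ContDiff

noncomputable section

namespace SpatialInfinity

/-! ### Tensor calculus in coordinates on a ball of `ℝ³` -/

/-- Coordinate space; the point `i` at infinity is the origin. -/
abbrev E3 := EuclideanSpace ℝ (Fin 3)

/-- Components `h_{ij}` of a (here negative definite) metric. -/
abbrev MetricField := E3 → Matrix (Fin 3) (Fin 3) ℝ

/-- Partial derivative `∂_i f`. -/
def pd (i : Fin 3) (f : E3 → ℝ) (x : E3) : ℝ := fderiv ℝ f x (EuclideanSpace.single i 1)

/-- Christoffel symbol `Γ^i_{jk}`. -/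
def christoffel (h : MetricField) (i j k : Fin 3) (x : E3) : ℝ :=
  (1 / 2) * ∑ l, (h x)⁻¹ i l *
    (pd j (fun y => h y l k) x + pd k (fun y => h y l j) x - pd l (fun y => h y j k) x)

/-- Ricci tensor `r_{ij}` (positive on round spheres). -/
def ricci (h : MetricField) (i j : Fin 3) (x : E3) : ℝ :=
  ∑ k, (pd k (christoffel h k i j) x - pd j (christoffel h k i k) x
    + ∑ l, (christoffel h k k l x * christoffel h l i j x
          - christoffel h k j l x * christoffel h l i k x))

/-- Ricci scalar `r = h^{ij} r_{ij}`. -/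
def scalarCurv (h : MetricField) (x : E3) : ℝ := ∑ i, ∑ j, (h x)⁻¹ i j * ricci h i j x

/-- Trace-free Ricci tensor `s_{ij}`. -/
def tfRicci (h : MetricField) (i j : Fin 3) (x : E3) : ℝ :=
  ricci h i j x - (1 / 3) * scalarCurv h x * h x i j

/-- Three-dimensional Schouten tensor `l_{ij}`. -/
def schouten (h : MetricField) (i j : Fin 3) (x : E3) : ℝ :=
  ricci h i j x - (1 / 4) * scalarCurv h x * h x i j

/-- Covariant Hessian `D_i D_j f`. -/
def hess (h : MetricField) (f : E3 → ℝ) (i j : Fin 3) (x : E3) : ℝ :=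
  pd i (pd j f) x - ∑ k, christoffel h k i j x * pd k f x

/-- `Δ_h f = h^{ij} D_i D_j f`. -/
def laplacian (h : MetricField) (f : E3 → ℝ) (x : E3) : ℝ :=
  ∑ i, ∑ j, (h x)⁻¹ i j * hess h f i j x

/-- The Yamabe operator `Δ_h - r/8`. -/
def yamabe (h : MetricField) (f : E3 → ℝ) (x : E3) : ℝ :=
  laplacian h f x - (1 / 8) * scalarCurv h x * f x

/-- `x ↦ (x^i)` are normal coordinates centred at the origin: the frame `∂_i` is orthonormal
there and the straight lines through the origin are geodesics. -/
def IsNormalCoordinates (a : ℝ) (h : MetricField) : Prop :=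
  h 0 = -1 ∧ ∀ x ∈ Metric.ball (0 : E3) a, ∀ i, ∑ j, ∑ k, christoffel h i j k x * x j * x k = 0

/-- The conformal geodesic equations on `(-ε, ε)`, for a curve `x` with velocity `y` and a
1-form `b` along it. -/
structure IsConformalGeodesic (h : MetricField) (ε : ℝ) (x y b : ℝ → E3) : Prop where
  vel : ∀ l ∈ Ioo (-ε) ε, HasDerivAt x (y l) l
  acc : ∀ l ∈ Ioo (-ε) ε, ∀ m, HasDerivAt (fun l => y l m)
    (-(∑ j, ∑ k, christoffel h m j k (x l) * y l j * y l k)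
      - 2 * (∑ n, b l n * y l n) * y l m
      + (∑ j, ∑ k, h (x l) j k * y l j * y l k) * ∑ n, (h (x l))⁻¹ m n * b l n) l
  form : ∀ l ∈ Ioo (-ε) ε, ∀ m, HasDerivAt (fun l => b l m)
    ((∑ j, ∑ k, christoffel h k j m (x l) * y l j * b l k)
      + (∑ n, b l n * y l n) * b l m
      - (1 / 2) * (∑ j, ∑ k, (h (x l))⁻¹ j k * b l j * b l k) * (∑ n, h (x l) m n * y l n)
      + ∑ n, schouten h n m (x l) * y l n) l

/-- The conformal normal gauge on the ball of radius `a`. -/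
def IsCnGauge (a : ℝ) (h : MetricField) : Prop :=
  ∀ (ε : ℝ) (x y b : ℝ → E3), 0 < ε → (∀ l ∈ Ioo (-ε) ε, x l ∈ Metric.ball (0 : E3) a) →
    IsConformalGeodesic h ε x y b → x 0 = 0 →
    (∑ j, ∑ k, h (x 0) j k * y 0 j * y 0 k = -1) → b 0 = 0 →
    ∀ l ∈ Ioo (-ε) ε, ∑ n, b l n * y l n = 0

/-! ### Static data and data static up to a given order -/

/-- `ϑ = U/|x| + W`. -/
def theta (U W : E3 → ℝ) (x : E3) : ℝ := U x / ‖x‖ + W x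

/-- The conformal factor `Ω = ϑ⁻²`. -/
def conformalFactor (U W : E3 → ℝ) (x : E3) : ℝ := (theta U W x ^ 2)⁻¹

/-- `h̃` is, near infinity, the metric of a static vacuum initial data set: there is a positive
lapse `v`, tending to `1` at infinity, such that `v² dt² + h̃` is Ricci flat. -/
def IsStaticVacuum (a : ℝ) (ht : MetricField) : Prop :=
  ∃ v : E3 → ℝ, ContDiffOn ℝ ∞ v (Metric.ball 0 a \ {0}) ∧ Tendsto v (𝓝[≠] 0) (𝓝 1) ∧
    ∀ x ∈ Metric.ball (0 : E3) a \ {0}, 0 < v x ∧ laplacian ht v x = 0 ∧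
      ∀ i j, ricci ht i j x = (v x)⁻¹ * hess ht v i j x

/-- A static initial data set in the cn-gauge on the ball of radius `a`, in normal coordinates:
conformal metric `h`, massless part `U/|x|` and massive part `W`. For `U` of class `C²`,
`(Δ_h - r/8)(U/|x|) = -4πδ` (with the Laplacian and curvature of the positive definite metric
`-h`) says that the equation holds off the origin and that `U = 1` at the origin. -/
structure IsStaticData (a : ℝ) (h : MetricField) (U W : E3 → ℝ) : Prop where
  a_pos : 0 < a
  h_analytic : ∀ i j, AnalyticOnNhd ℝ (fun x => h x i j) (Metric.ball 0 a)
  h_neg : ∀ x ∈ Metric.ball (0 : E3) a, (-(h x)).PosDef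
  normal : IsNormalCoordinates a h
  cn : IsCnGauge a h
  U_analytic : AnalyticOnNhd ℝ U (Metric.ball 0 a)
  W_analytic : AnalyticOnNhd ℝ W (Metric.ball 0 a)
  U_zero : U 0 = 1
  yamabe_U : ∀ x ∈ Metric.ball (0 : E3) a \ {0}, yamabe h (fun y => U y / ‖y‖) x = 0
  yamabe_W : ∀ x ∈ Metric.ball (0 : E3) a, yamabe h W x = 0
  theta_pos : ∀ x ∈ Metric.ball (0 : E3) a \ {0}, 0 < theta U W x
  static : IsStaticVacuum a (fun x => (theta U W x) ^ 4 • h x)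

/-- The data `ϑ = U/|x| + W + Wb` is static up to order `p₀`: `U/|x|` and `W` come from static
data, and the Taylor expansion of the additional massive part `Wb` starts at order `p₀ + 1`. -/
structure IsStaticUpToOrder (p₀ : ℕ) (a : ℝ) (h : MetricField) (U W Wb : E3 → ℝ) : Prop where
  static : IsStaticData a h U W
  Wb_analytic : AnalyticOnNhd ℝ Wb (Metric.ball 0 a)
  Wb_order : ∀ p ≤ p₀, iteratedFDeriv ℝ p Wb 0 = 0
  yamabe_Wb : ∀ x ∈ Metric.ball (0 : E3) a, yamabe h Wb x = 0
  theta_pos : ∀ x ∈ Metric.ball (0 : E3) a \ {0}, 0 < theta U (W + Wb) x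

/-! ### `SU(2)` and its left-invariant vector fields -/

abbrev SU2 := Matrix.specialUnitaryGroup (Fin 2) ℂ

/-- For `Y = v₁u₁ + v₂u₂ + v₃u₃` in `su(2)`, with
`u₁ = ½(0 i; i 0)`, `u₂ = ½(0 -1; 1 0)`, `u₃ = ½(i 0; 0 -i)`, the matrix `1 + Y`. -/
def onePlus (v : Fin 3 → ℝ) : Matrix (Fin 2) (Fin 2) ℂ :=
  !![1 + Complex.I * v 2 / 2, (Complex.I * v 0 - v 1) / 2;
     (Complex.I * v 0 + v 1) / 2, 1 - Complex.I * v 2 / 2]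

lemma onePlus_mem (v : Fin 3 → ℝ) :
    (((√(1 + (v 0 ^ 2 + v 1 ^ 2 + v 2 ^ 2) / 4))⁻¹ : ℝ) : ℂ) • onePlus v ∈
      Matrix.specialUnitaryGroup (Fin 2) ℂ := by
  set N : ℝ := √(1 + (v 0 ^ 2 + v 1 ^ 2 + v 2 ^ 2) / 4) with hN
  have h1 : N ^ 2 = 1 + (v 0 ^ 2 + v 1 ^ 2 + v 2 ^ 2) / 4 := Real.sq_sqrt (by positivity)
  have h0 : N ≠ 0 := by
    intro h
    rw [h] at h1
    nlinarith [sq_nonneg (v 0), sq_nonneg (v 1), sq_nonneg (v 2)]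
  have h2 : (N : ℂ) ^ 2 = 1 + ((v 0 : ℂ) ^ 2 + (v 1 : ℂ) ^ 2 + (v 2 : ℂ) ^ 2) / 4 := by
    exact_mod_cast h1
  have h3 : (N : ℂ) ≠ 0 := by exact_mod_cast h0
  have hI : Complex.I ^ 2 = -1 := Complex.I_sq
  rw [Matrix.mem_specialUnitaryGroup_iff, Matrix.mem_unitaryGroup_iff]
  have hc : (starRingEnd ℂ) (2 : ℂ) = 2 := Complex.conj_ofNat 2
  constructor
  · ext i j
    fin_cases i <;> fin_cases j <;>
      simp [onePlus, Matrix.mul_apply, Fin.sum_univ_two, Matrix.star_apply, hc] <;>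
      field_simp <;> ring_nf <;> (try simp only [h2, hI]) <;> (try ring)
  · simp [onePlus, Matrix.det_fin_two]
    field_simp
    ring_nf
    simp only [h2, hI]
    ring

/-- The chart `v ↦ (1 + Y)/|1 + Y|` of `SU(2)` at the unit element, whose `k`-th coordinate line
has velocity `u_k` there. -/
def chart (v : Fin 3 → ℝ) : SU2 :=
  ⟨(((√(1 + (v 0 ^ 2 + v 1 ^ 2 + v 2 ^ 2) / 4))⁻¹ : ℝ) : ℂ) • onePlus v, onePlus_mem v⟩

/-- The left-invariant vector field generated by `u_k` (indices shifted to `0, 1, 2`). -/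
def leftInv (k : Fin 3) (F : SU2 → ℂ) (t : SU2) : ℂ :=
  deriv (fun s : ℝ => F (t * chart (Pi.single k s))) 0

/-- `X₊`. Together with `X = -2i u₃` and `X₋` one has
`[X, X₊] = 2X₊`, `[X, X₋] = -2X₋`, `[X₊, X₋] = -X`. -/
def Xplus (F : SU2 → ℂ) (t : SU2) : ℂ := -(leftInv 1 F t + Complex.I * leftInv 0 F t)

/-- `X₋`. -/
def Xminus (F : SU2 → ℂ) (t : SU2) : ℂ := -(leftInv 1 F t - Complex.I * leftInv 0 F t)

/-- Smooth functions on `(-1, 1) × SU(2)`, the cylinder at spatial infinity. -/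
def SmoothOnCylinder (F : ℝ → SU2 → ℂ) : Prop :=
  ∀ t : SU2, ContDiffOn ℝ ∞ (fun q : ℝ × (Fin 3 → ℝ) => F q.1 (t * chart q.2))
    (Ioo (-1) 1 ×ˢ univ)

/-! ### Spinors. Indices are raised and lowered by `ξ^A = ε^{AB} ξ_B`, `ξ_B = ξ^A ε_{AB}`. -/

/-- `ε_{AB}`, numerically the same as `ε^{AB}`, with `ε_{01} = 1`. -/
def eps (A B : Fin 2) : ℂ := !![0, 1; -1, 0] A B

/-- `x_{AB} = √2 ε_{(A}^0 ε_{B)}^1`. -/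
def xsp (A B : Fin 2) : ℂ := if A = B then 0 else (√2 : ℂ)⁻¹

/-- `h_{ABCD} = -ε_{A(C} ε_{D)B}`. -/
def hsp (A B C D : Fin 2) : ℂ := -(1 / 2) * (eps A C * eps D B + eps A D * eps C B)

/-- Position of `(AB)` among the three components of a symmetric spinor: the number of ones. -/
def pr (A B : Fin 2) : Fin 3 := ⟨A.val + B.val, by omega⟩

/-- `(fst j, snd j)` is the pair of spinor indices with `j` ones. -/
def fst (j : Fin 3) : Fin 2 := if j = 2 then 1 else 0

/-- See `fst`. -/
def snd (j : Fin 3) : Fin 2 := if j = 0 then 0 else 1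

/-- Position of `(ABCD)` among the five components of a symmetric spinor. -/
def quad (A B C D : Fin 2) : Fin 5 := ⟨A.val + B.val + C.val + D.val, by omega⟩

/-- `T_{(ABCD)}` for a spinor with `T_{ABCD} = T_{(AB)(CD)} = T_{CDAB}`. -/
def symm4 (T : Fin 2 → Fin 2 → Fin 2 → Fin 2 → ℂ) (A B C D : Fin 2) : ℂ :=
  (1 / 3) * (T A B C D + T A C B D + T A D B C)

/-- Infeld-van der Waerden symbols: the coordinate components of the fixed frame `E_{AB}` at `i`,
with `h(E_{AB}, E_{CD}) = h_{ABCD}`. -/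
def sigma (i : Fin 3) (A B : Fin 2) : ℂ :=
  (√2 : ℂ)⁻¹ * (![!![-1, 0; 0, 1], !![Complex.I, 0; 0, Complex.I], !![0, 1; 1, 0]] i) A B

/-! ### The frame bundle over the blow-up of `i` -/

/-- The frame `e_{AB}(t) = E_{CD} t^C_A t^D_B` at `i`. -/
def frame0 (t : SU2) (A B : Fin 2) (i : Fin 3) : ℂ :=
  ∑ C, ∑ D, sigma i C D * t.1 C A * t.1 D B

/-- The radial unit vector `e₃(t) = √2 e_{01}(t)`, which is real. -/
def radial (t : SU2) : E3 := WithLp.toLp 2 fun i => (√2 * frame0 t 0 1 i).re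

/-- The projection `(ρ, t) ↦ x`. -/
def proj (ρ : ℝ) (t : SU2) : E3 := ρ • radial t

/-- `P x` is the parallel transport for `h`, from the origin to `x` along the radial geodesic. -/
structure IsRadialTransport (a : ℝ) (h : MetricField) (P : E3 → Matrix (Fin 3) (Fin 3) ℝ) :
    Prop where
  smooth : ∀ i j, ContDiffOn ℝ ∞ (fun x => P x i j) (Metric.ball 0 a)
  zero : P 0 = 1
  parallel : ∀ x ∈ Metric.ball (0 : E3) a, ∀ i j,
    fderiv ℝ (fun y => P y i j) x x + ∑ k, ∑ l, christoffel h i k l x * x k * P x l j = 0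

section InitialData

variable (h : MetricField) (P : E3 → Matrix (Fin 3) (Fin 3) ℝ) (Ω : E3 → ℝ)

/-- Coordinate components of the `h`-normalised frame `e_{AB}` at `(ρ, t)`. -/
def frame (ρ : ℝ) (t : SU2) (A B : Fin 2) (i : Fin 3) : ℂ :=
  ∑ j, (P (proj ρ t) i j : ℂ) * frame0 t A B j

/-- Frame components of a 1-form. -/
def comp1 (w : Fin 3 → E3 → ℝ) (ρ : ℝ) (t : SU2) (A B : Fin 2) : ℂ :=
  ∑ i, (w i (proj ρ t) : ℂ) * frame P ρ t A B i

/-- Frame components of a covariant 2-tensor. -/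
def comp2 (T : Fin 3 → Fin 3 → E3 → ℝ) (ρ : ℝ) (t : SU2) (A B C D : Fin 2) : ℂ :=
  ∑ i, ∑ j, (T i j (proj ρ t) : ℂ) * frame P ρ t A B i * frame P ρ t C D j

/-- The coefficient `c⁺_{AB}` of the rescaled frame `ρ e_{AB} = c¹ ∂_ρ + c⁺ X₊ + c⁻ X₋`. As `∂_ρ`,
`X₊` and `X₋` project to `e₃(t)`, `√2 ρ e_{00}(t)` and `-√2 ρ e_{11}(t)` in the coordinates,
the coefficients are read off with the Euclidean product, for which
`e_{00}(t) · e_{11}(t) = -1` and `e_{00}(t) · e_{00}(t) = e_{11}(t) · e_{11}(t) = 0`. -/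
def cPlus (ρ : ℝ) (t : SU2) (A B : Fin 2) : ℂ :=
  -(√2 : ℂ)⁻¹ * ∑ i, frame P ρ t A B i * frame0 t 1 1 i

/-- The coefficient `c⁻_{AB}`; see `cPlus`. -/
def cMinus (ρ : ℝ) (t : SU2) (A B : Fin 2) : ℂ :=
  (√2 : ℂ)⁻¹ * ∑ i, frame P ρ t A B i * frame0 t 0 0 i

/-- The `i`-th component of `ρ D_{AB} e_{CD}`. -/
def covFrame (ρ : ℝ) (t : SU2) (A B C D : Fin 2) (i : Fin 3) : ℂ :=
  ρ * xsp A B * deriv (fun r => frame P r t C D i) ρ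
    + cPlus P ρ t A B * Xplus (fun s => frame P ρ s C D i) t
    + cMinus P ρ t A B * Xminus (fun s => frame P ρ s C D i) t
    + ρ * ∑ j, ∑ k, (christoffel h i j k (proj ρ t) : ℂ) * frame P ρ t A B j * frame P ρ t C D k

/-- `ρ γ_{ABCD}`, with the connection coefficients `γ_{ABCD}` of the frame defined by
`D_{AB} e_{CD} = γ_{AB}{}^E{}_C e_{ED} + γ_{AB}{}^E{}_D e_{CE}`, equivalently
`γ_{ABGC} = ½ ε^{DH} h(D_{AB} e_{CD}, e_{GH})`. -/
def rhoGamma (ρ : ℝ) (t : SU2) (A B G C : Fin 2) : ℂ :=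
  (1 / 2) * ∑ D, ∑ H, eps D H * ∑ i, ∑ j, (h (proj ρ t) i j : ℂ) *
    covFrame h P ρ t A B C D i * frame P ρ t G H j

/-- The 45 independent components of `υ`: for the frame `c^μ_{AB}` with `μ = τ, ρ, +, -`, the
connection `ξ_{ABCD}, χ_{ABCD}, f_{AB}` with
`Γ_{ABCD} = (ξ_{ABCD} - χ_{ABCD})/√2 - ½ ε_{AB} f_{CD}`, and for the Schouten spinor
`Θ_{AB(CD)}` and `Θ_{ABQ}{}^Q`. -/
inductive Idx
  | c (μ : Fin 4) (j : Fin 3)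
  | xi (i j : Fin 3)
  | chi (i j : Fin 3)
  | f (j : Fin 3)
  | Th (i j : Fin 3)
  | trTh (j : Fin 3)

/-- The vector `υ`. -/
abbrev Ups := Idx → ℂ

/-- The vector `φ = (φ₀, …, φ₄)`, `φ_j = φ_{(ABCD)_j}`. -/
abbrev Phi := Fin 5 → ℂ

/-- Initial data for `υ` at `(ρ, t)`, `ρ > 0`, in the gauge `κ = ρ`. -/
def upsData (ρ : ℝ) (t : SU2) : Ups
  | .c 0 _ => 0
  | .c 1 j => ρ * xsp (fst j) (snd j)
  | .c 2 j => cPlus P ρ t (fst j) (snd j)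
  | .c 3 j => cMinus P ρ t (fst j) (snd j)
  | .xi i j => √2 * (rhoGamma h P ρ t (fst i) (snd i) (fst j) (snd j)
      - (1 / 2) * (eps (fst i) (fst j) * xsp (snd i) (snd j)
        + eps (snd i) (snd j) * xsp (fst i) (fst j)))
  | .chi _ _ => 0
  | .f j => xsp (fst j) (snd j)
  | .Th i j =>
      -((ρ : ℂ) ^ 2 / (Ω (proj ρ t) : ℂ)) *
          symm4 (comp2 P (hess h Ω) ρ t) (fst i) (snd i) (fst j) (snd j)
        + (1 / 12) * (ρ : ℂ) ^ 2 * (scalarCurv h (proj ρ t) : ℂ) *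
          hsp (fst i) (snd i) (fst j) (snd j)
  | .trTh _ => 0

/-- Initial data for `φ` at `(ρ, t)`, `ρ > 0`:
`φ_{ABCD} = κ³ Ω⁻² (D_{(AB} D_{CD)} Ω + Ω s_{ABCD})` with `κ = ρ`. -/
def phiData (ρ : ℝ) (t : SU2) : Phi := fun j =>
  let A : Fin 2 := if 4 ≤ j.val then 1 else 0
  let B : Fin 2 := if 3 ≤ j.val then 1 else 0
  let C : Fin 2 := if 2 ≤ j.val then 1 else 0
  let D : Fin 2 := if 1 ≤ j.val then 1 else 0
  (ρ : ℂ) ^ 3 / (Ω (proj ρ t) : ℂ) ^ 2 *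
    (symm4 (comp2 P (hess h Ω) ρ t) A B C D
      + (Ω (proj ρ t) : ℂ) * symm4 (comp2 P (tfRicci h) ρ t) A B C D)

/-- `ω = 2Ω/√|D_kΩ D^kΩ|`. -/
def omega (x : E3) : ℝ :=
  2 * Ω x / √|∑ i, ∑ j, (h x)⁻¹ i j * pd i Ω x * pd j Ω x|

/-- The conformal factor `Θ = κ⁻¹ Ω (1 - κ²τ²/ω²)` with `κ = ρ`. -/
def Theta (τ ρ : ℝ) (t : SU2) : ℝ :=
  ρ⁻¹ * Ω (proj ρ t) * (1 - ρ ^ 2 * τ ^ 2 / omega h Ω (proj ρ t) ^ 2)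

/-- The spatial part `d_{AB} = D_{AB} Ω` of the 1-form attached to the conformal geodesics. -/
def dForm (ρ : ℝ) (t : SU2) (j : Fin 3) : ℂ :=
  comp1 P (fun i => pd i Ω) ρ t (fst j) (snd j)

end InitialData

/-! ### The evolution equations `∂_τ υ = K υ + Q(υ, υ) + L φ` and the Bianchi equations -/

/-- `w_{EF} v^{EF}` for symmetric spinors given by their components. -/
def contract (w v : Fin 3 → ℂ) : ℂ := w 2 * v 0 - 2 * w 1 * v 1 + w 0 * v 2

/-- The linear part `K υ`. -/
def K (u : Ups) : Ups
  | .c 0 j => -u (.f j)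
  | .c _ _ => 0
  | .xi i j => -(1 / 2) * (eps (fst i) (fst j) * u (.trTh (pr (snd i) (snd j)))
      + eps (snd i) (snd j) * u (.trTh (pr (fst i) (fst j))))
  | .chi i j => -u (.Th i j)
  | .f j => (√2 : ℂ)⁻¹ * u (.trTh j)
  | .Th _ _ => 0
  | .trTh _ => 0

/-- `χ_{ABC}{}^E f_{DE}`, with `χ` from `u` and `f` from `v`. -/
def chiF (u v : Ups) (A B C D : Fin 2) : ℂ :=
  ∑ E, ∑ F, eps E F * u (.chi (pr A B) (pr C F)) * v (.f (pr D E))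

/-- The bilinear part `Q(u, v)`; `χ` is taken from `u`, the other factor from `v`:
`-χ_{AB}{}^{EF} c^μ_{EF}`,
`-χ_{AB}{}^{EF} ξ_{EFCD} + (ε_{AC} χ_{BDEF} + ε_{BD} χ_{ACEF}) f^{EF}/√2 - √2 χ_{AB(C}{}^E f_{D)E}`,
`-χ_{AB}{}^{EF} χ_{EFCD}`, `-χ_{AB}{}^{EF} f_{EF}`, `-χ_{AB}{}^{EF} Θ_{EFCD}`. -/
def Q (u v : Ups) : Ups
  | .c μ j => -contract (fun k => u (.chi j k)) (fun k => v (.c μ k))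
  | .xi i j =>
      -contract (fun k => u (.chi i k)) (fun k => v (.xi k j))
      + (√2 : ℂ)⁻¹ * (
          eps (fst i) (fst j) *
            contract (fun k => u (.chi (pr (snd i) (snd j)) k)) (fun k => v (.f k))
        + eps (snd i) (snd j) *
            contract (fun k => u (.chi (pr (fst i) (fst j)) k)) (fun k => v (.f k)))
      - √2 * ((1 / 2) * (chiF u v (fst i) (snd i) (fst j) (snd j)
          + chiF u v (fst i) (snd i) (snd j) (fst j)))
  | .chi i j => -contract (fun k => u (.chi i k)) (fun k => v (.chi k j))
  | .f j => -contract (fun k => u (.chi j k)) (fun k => v (.f k))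
  | .Th i j => -contract (fun k => u (.chi i k)) (fun k => v (.Th k j))
  | .trTh j => -contract (fun k => u (.chi j k)) (fun k => v (.trTh k))

/-- The Hermitian conjugate `φ⁺_{ABCD}`. -/
def dagger (φ : Phi) : Phi := fun j => (-1) ^ j.val * (starRingEnd ℂ) (φ (Fin.rev j))

/-- `η = ½(φ + φ⁺)`. -/
def eta (φ : Phi) : Phi := fun j => (1 / 2) * (φ j + dagger φ j)

/-- `μ = -(i/2)(φ - φ⁺)`. -/
def mu (φ : Phi) : Phi := fun j => -(Complex.I / 2) * (φ j - dagger φ j)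

/-- `d^E{}_A μ_{BCDE}`. -/
def dMu (d : Fin 3 → ℂ) (φ : Phi) (A B C D : Fin 2) : ℂ :=
  ∑ E, ∑ F, eps E F * d (pr F A) * mu φ (quad B C D E)

/-- `L φ`, for given values of `Θ`, `∂_τ Θ` and `d_{AB}`:
`-iΘ μ_{ABCD}` for `ξ_{ABCD}`, `Θ η_{ABCD}` for `χ_{ABCD}`,
`-∂_τΘ η_{ABCD} + i√2 d^E{}_{(C} μ_{D)ABE}` for `Θ_{AB(CD)}`, `√2 d^{EF} η_{ABEF}` for
`Θ_{ABQ}{}^Q`. -/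
def L (Th dTh : ℂ) (d : Fin 3 → ℂ) (φ : Phi) : Ups
  | .c _ _ => 0
  | .xi i j => -Complex.I * Th * mu φ (quad (fst i) (snd i) (fst j) (snd j))
  | .chi i j => Th * eta φ (quad (fst i) (snd i) (fst j) (snd j))
  | .f _ => 0
  | .Th i j => -dTh * eta φ (quad (fst i) (snd i) (fst j) (snd j))
      + Complex.I * √2 * ((1 / 2) * (dMu d φ (fst j) (snd j) (fst i) (snd i)
          + dMu d φ (snd j) (fst j) (fst i) (snd i)))
  | .trTh j => √2 * contract d (fun k => eta φ (quad (fst j) (snd j) (fst k) (snd k)))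

/-- `Γ_{ABCD} = (ξ_{ABCD} - χ_{ABCD})/√2 - ½ ε_{AB} f_{CD}`. -/
def Gam (u : Ups) (A B C D : Fin 2) : ℂ :=
  (√2 : ℂ)⁻¹ * (u (.xi (pr A B) (pr C D)) - u (.chi (pr A B) (pr C D)))
    - (1 / 2) * eps A B * u (.f (pr C D))

/-- `∇^A{}_E φ_{ABCD}` without the term `-∂_τ φ_{EBCD}/√2`, where `dφ μ` stands for the derivatives
`∂_τ φ, ∂_ρ φ, X₊ φ, X₋ φ`; here
`∇_{PE} φ_{ABCD} = c^μ_{PE} ∂_μ φ_{ABCD} + Γ_{PEQA} φ^Q{}_{BCD} + … + Γ_{PEQD} φ_{ABC}{}^Q`. -/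
def divPhi (u : Ups) (dφ : Fin 4 → Phi) (φ : Phi) (E B C D : Fin 2) : ℂ :=
  ∑ A, ∑ P, eps A P *
    ((∑ μ, u (.c μ (pr P E)) * dφ μ (quad A B C D))
      + ∑ q, ∑ R, eps q R * (Gam u P E q A * φ (quad R B C D) + Gam u P E q B * φ (quad A R C D)
          + Gam u P E q C * φ (quad A B R D) + Gam u P E q D * φ (quad A B C R)))

/-- `A^μ(c) ∂_μ φ - F(Γ) φ`. The propagation equations are `√2 ∂_τ φ + A^μ(c) ∂_μ φ = F(Γ) φ`,
that is, the combinations `-2∇^A{}_0 φ_{A000}`, `-∇^A{}_0 φ_{A001} - ∇^A{}_1 φ_{A000}`,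
`-∇^A{}_0 φ_{A011} - ∇^A{}_1 φ_{A001}`, `-∇^A{}_0 φ_{A111} - ∇^A{}_1 φ_{A011}`,
`-2∇^A{}_1 φ_{A111}` of the Bianchi equations. On the cylinder `√2 + A⁰` becomes
`√2 diag(1+τ, 1, 1, 1, 1-τ)`. -/
def bianchi (u : Ups) (dφ : Fin 4 → Phi) (φ : Phi) : Phi :=
  ![-2 * divPhi u dφ φ 0 0 0 0,
    -(divPhi u dφ φ 0 0 0 1 + divPhi u dφ φ 1 0 0 0),
    -(divPhi u dφ φ 0 0 1 1 + divPhi u dφ φ 1 0 0 1),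
    -(divPhi u dφ φ 0 1 1 1 + divPhi u dφ φ 1 0 1 1),
    -2 * divPhi u dφ φ 1 1 1 1]

/-! ### Transport equations on the cylinder -/

/-- `j p` is the value at `ρ = 0` of `∂_ρ^p F`, for `F` given on `ρ > 0`. -/
def HasRhoJet (F : ℝ → ℂ) (j : ℕ → ℂ) : Prop :=
  ∀ p, Tendsto (iteratedDeriv p F) (𝓝[>] 0) (𝓝 (j p))

/-- The derivatives `∂_τ, ∂_ρ, X₊, X₋` of `φ` at order `p` on the cylinder; `∂_ρ` raises the
order. -/
def dPhi (φ : ℕ → ℝ → SU2 → Phi) (p : ℕ) (τ : ℝ) (t : SU2) : Fin 4 → Phi :=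
  ![fun j => deriv (fun s => φ p s t j) τ,
    φ (p + 1) τ t,
    fun j => Xplus (fun s => φ p τ s j) t,
    fun j => Xminus (fun s => φ p τ s j) t]

/-- `(υ^{(p)}, φ^{(p)})`, `p = 0, 1, 2, …`, are solutions on the cylinder `|τ| < 1` of the transport
equations for the time symmetric data with conformal metric `h` and conformal factor `Ω`:
the equations obtained by applying `∂_ρ^p` to the evolution equations and setting `ρ = 0`, with
the initial data at `τ = 0` obtained in the same way. -/
structure IsTransportSolution (h : MetricField) (P : E3 → Matrix (Fin 3) (Fin 3) ℝ) (Ω : E3 → ℝ)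
    (υ : ℕ → ℝ → SU2 → Ups) (φ : ℕ → ℝ → SU2 → Phi) : Prop where
  smooth_ups : ∀ p k, SmoothOnCylinder (fun τ t => υ p τ t k)
  smooth_phi : ∀ p j, SmoothOnCylinder (fun τ t => φ p τ t j)
  init_ups : ∀ t k, HasRhoJet (fun ρ => upsData h P Ω ρ t k) (fun p => υ p 0 t k)
  init_phi : ∀ t j, HasRhoJet (fun ρ => phiData h P Ω ρ t j) (fun p => φ p 0 t j)
  transport_ups : ∃ (Th dTh : ℕ → ℝ → SU2 → ℂ) (d : ℕ → SU2 → Fin 3 → ℂ),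
    (∀ τ ∈ Ioo (-1 : ℝ) 1, ∀ t,
      HasRhoJet (fun ρ => (Theta h Ω τ ρ t : ℂ)) (fun p => Th p τ t) ∧
      HasRhoJet (fun ρ => (deriv (fun s => Theta h Ω s ρ t) τ : ℂ)) (fun p => dTh p τ t)) ∧
    (∀ t j, HasRhoJet (fun ρ => dForm P Ω ρ t j) (fun p => d p t j)) ∧
    ∀ p, ∀ τ ∈ Ioo (-1 : ℝ) 1, ∀ t k, HasDerivAt (fun s => υ p s t k)
      (K (υ p τ t) k + ∑ j ∈ Finset.range (p + 1), (p.choose j : ℂ) *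
        (Q (υ j τ t) (υ (p - j) τ t) k
          + L (Th j τ t) (dTh j τ t) (d j t) (φ (p - j) τ t) k)) τ
  transport_phi : ∀ p, ∀ τ ∈ Ioo (-1 : ℝ) 1, ∀ t k,
    √2 * deriv (fun s => φ p s t k) τ + ∑ j ∈ Finset.range (p + 1), (p.choose j : ℂ) *
      bianchi (υ j τ t) (dPhi φ (p - j) τ t) (φ (p - j) τ t) k = 0

end SpatialInfinity

end

/-! The proof has three ingredients.

Data. Rationalising the denominator in Ω = |x|²/(U + |x|W)² gives Ω = |x|²A + |x|³B with A, B
analytic at the origin. Hence along a ray x = ρe the factor, its gradient and its Hessian are smooth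
in ρ up to ρ = 0, although Ω itself need not be smooth at the origin. Passing from W to W + Wb
changes Ω by -2|x|³Wb plus higher order (`exists_conformalFactor_add`). Two derivatives cost two
powers of ρ, so the Hessian, and with it the data for Θ_{ABCD}, changes only from order p₀ + 2 on;
Θ, ∂_τΘ and dΩ agree at least as far. In the data for φ the weight κ³/Ω², which behaves like 1/ρ,
costs one more power, and the change starts at order p₀ + 1 (`exists_rayFactors`, `phi_jet_sub`).

Evolution. At ρ = 0 the coefficients Θ, ∂_τΘ and d_{AB} vanish, so the equation for υ of order p
contains φ only in orders below p. Once the lower orders agree, the difference of the υ of order p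
solves a linear homogeneous ODE in τ with zero data, and Gronwall's inequality applies
(`ups_eq_of_lower`). The coefficient of ∂_ρ also vanishes at ρ = 0, so the Bianchi equations of
order p form a closed system for φ of order p on the cylinder. Its principal part is symmetric
hyperbolic for |τ| < 1, and integrating an energy density over SU(2) against a right-invariant
measure removes the X₊, X₋ terms; Gronwall's inequality again yields zero (`eq_zero_of_bianchi`,
`phi_eq_of_lower`). The induction treats υ before φ in each order, which is why υ agrees one order
further.

Sharpness. The component φ₂ of the data reads off the trace-free radial second derivative. The
leading part of Wb is harmonic by the Yamabe equation, and Euler's relation for homogeneous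
functions turns this component of the difference into -(p₀ + 2)(p₀ + 3) Wb to leading order. A
nonzero symmetric form is nonzero on some unit vector, and every unit vector is e₃(t) for some t
(`exists_init_phi_ne`). -/

noncomputable section

namespace SpatialInfinity

/-! ### Jets of functions of one variable -/

section Jets

variable {𝔸 : Type*} [NormedCommRing 𝔸] [NormedAlgebra ℝ 𝔸]

/-- `G` is smooth at `0` and its derivatives of order less than `k` vanish there. -/
def VanishesTo (k : ℕ) (G : ℝ → 𝔸) : Prop :=
  ContDiffAt ℝ ∞ G 0 ∧ ∀ j < k, iteratedDeriv j G 0 = 0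

namespace VanishesTo

variable {k m : ℕ} {F G : ℝ → 𝔸}

lemma smooth (h : VanishesTo k G) : ContDiffAt ℝ ∞ G 0 := h.1

lemma mono (h : VanishesTo k G) (hm : m ≤ k) : VanishesTo m G :=
  ⟨h.1, fun j hj => h.2 j (hj.trans_le hm)⟩

lemma congr (h : VanishesTo k G) (hFG : F =ᶠ[𝓝 0] G) : VanishesTo k F :=
  ⟨h.1.congr_of_eventuallyEq hFG, fun j hj => by rw [hFG.iteratedDeriv_eq, h.2 j hj]⟩

lemma of_smooth (h : ContDiffAt ℝ ∞ G 0) : VanishesTo 0 G := ⟨h, fun j hj => by omega⟩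

lemma of_apply_zero (h : ContDiffAt ℝ ∞ G 0) (h0 : G 0 = 0) : VanishesTo 1 G :=
  ⟨h, fun j hj => by obtain rfl : j = 0 := by omega
                     simpa using h0⟩

lemma add (hF : VanishesTo k F) (hG : VanishesTo k G) : VanishesTo k (fun ρ => F ρ + G ρ) := by
  refine ⟨hF.1.add hG.1, fun j hj => ?_⟩
  have := iteratedDeriv_fun_add (n := j) (x := (0 : ℝ)) (f := F) (g := G)
    (hF.1.of_le (by exact_mod_cast le_top)) (hG.1.of_le (by exact_mod_cast le_top))
  rw [this, hF.2 j hj, hG.2 j hj, add_zero]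

/-- In the Leibniz formula of order j < k + m, every term has i < k or j - i < m. -/
lemma mul (hF : VanishesTo k F) (hG : VanishesTo m G) :
    VanishesTo (k + m) (fun ρ => F ρ * G ρ) := by
  refine ⟨hF.1.mul hG.1, fun j hj => ?_⟩
  have := iteratedDeriv_fun_mul (n := j) (x := (0 : ℝ)) (f := F) (g := G)
    (hF.1.of_le (by exact_mod_cast le_top)) (hG.1.of_le (by exact_mod_cast le_top))
  rw [this]
  refine Finset.sum_eq_zero fun i hi => ?_
  rw [Finset.mem_range] at hi
  by_cases h : i < k
  · rw [hF.2 i h]; simp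
  · rw [hG.2 (j - i) (by omega)]; simp

lemma smooth_mul (hF : ContDiffAt ℝ ∞ F 0) (hG : VanishesTo k G) :
    VanishesTo k (fun ρ => F ρ * G ρ) := by
  simpa using (of_smooth hF).mul hG

lemma mul_smooth (hF : VanishesTo k F) (hG : ContDiffAt ℝ ∞ G 0) :
    VanishesTo k (fun ρ => F ρ * G ρ) := hF.mul (of_smooth hG)

lemma const_mul (c : 𝔸) (hG : VanishesTo k G) : VanishesTo k (fun ρ => c * G ρ) :=
  smooth_mul contDiffAt_const hG

lemma neg (hG : VanishesTo k G) : VanishesTo k (fun ρ => -G ρ) :=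
  (hG.const_mul (-1)).congr (Eventually.of_forall fun ρ => by simp)

lemma sub (hF : VanishesTo k F) (hG : VanishesTo k G) : VanishesTo k (fun ρ => F ρ - G ρ) :=
  (hF.add hG.neg).congr (Eventually.of_forall fun ρ => by simp [sub_eq_add_neg])

lemma zero : VanishesTo k (fun _ : ℝ => (0 : 𝔸)) :=
  ⟨contDiffAt_const, fun j _ => by simp⟩

lemma sum {ι : Type*} (s : Finset ι) {f : ι → ℝ → 𝔸} (h : ∀ i ∈ s, VanishesTo k (f i)) :
    VanishesTo k (fun ρ => ∑ i ∈ s, f i ρ) := by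
  classical
  induction s using Finset.induction_on with
  | empty => simpa using zero
  | insert i s hi ih =>
    refine ((h i (by simp)).add (ih fun j hj => h j (by simp [hj]))).congr
      (Eventually.of_forall fun ρ => ?_)
    simp [Finset.sum_insert hi]

lemma rho : VanishesTo 1 (fun ρ : ℝ => ρ) := of_apply_zero contDiffAt_id rfl

lemma ofReal {G : ℝ → ℝ} (h : VanishesTo k G) : VanishesTo k (fun ρ => (G ρ : ℂ)) := by
  refine ⟨Complex.ofRealCLM.contDiff.contDiffAt.comp 0 h.1, fun j hj => ?_⟩
  have := Complex.ofRealCLM.iteratedFDeriv_comp_left (f := G) (x := (0 : ℝ)) (i := j) h.1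
    (by exact_mod_cast le_top)
  have h2 : iteratedDeriv j (fun ρ => (G ρ : ℂ)) 0 = ((iteratedDeriv j G 0 : ℝ) : ℂ) := by
    simp only [iteratedDeriv]
    change iteratedFDeriv ℝ j (Complex.ofRealCLM ∘ G) 0 _ = _
    rw [this]; rfl
  rw [h2, h.2 j hj]; simp

end VanishesTo

lemma contDiffAt_deriv {G : ℝ → 𝔸} (h : ContDiffAt ℝ ∞ G 0) : ContDiffAt ℝ ∞ (deriv G) 0 := by
  have := h.fderiv_right (m := ∞) (by simp)
  exact this.clm_apply contDiffAt_const

/-- Of the derivatives of ρ only the first is nonzero at 0, so one term of the Leibniz formula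
survives. The multiplier is given up to a pointwise equation so that it may be written as ρ itself.
-/
lemma iteratedDeriv_rho_mul_deriv (n : ℕ) {w : ℝ → 𝔸} (c : ℝ → 𝔸) (hc : ∀ ρ, c ρ = ρ • (1 : 𝔸))
    (hw : ContDiffAt ℝ ∞ w 0) :
    iteratedDeriv n (fun ρ => c ρ * deriv w ρ) 0 = n * iteratedDeriv n w 0 := by
  obtain rfl : c = fun ρ => ρ • (1 : 𝔸) := funext hc
  have hc' : ContDiffAt ℝ ∞ (fun ρ : ℝ => ρ • (1 : 𝔸)) 0 := by fun_prop
  have hd : ∀ i, iteratedDeriv i (fun ρ : ℝ => ρ • (1 : 𝔸)) 0 = if i = 1 then 1 else 0 := by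
    have h1 : deriv (fun ρ : ℝ => ρ • (1 : 𝔸)) = fun _ => 1 := by
      funext x
      have := ((hasDerivAt_id x).smul_const (1 : 𝔸)).deriv
      simpa using this
    rintro (_ | _ | i)
    · simp
    · simp [iteratedDeriv_one, h1]
    · rw [iteratedDeriv_succ', h1, iteratedDeriv_const]; simp
  rw [iteratedDeriv_fun_mul (hc'.of_le (by exact_mod_cast le_top))
    ((contDiffAt_deriv hw).of_le (by exact_mod_cast le_top))]
  rcases n with _ | n
  · simp
  · rw [Finset.sum_eq_single 1]
    · rw [hd, iteratedDeriv_succ' (n := n)]; simp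
    · intro b _ hb; rw [hd, if_neg hb]; simp
    · intro h; simp at h

/-- Modulo higher order, `ρ ∂_ρ` acts as multiplication by `n` on functions vanishing to order
`n`. -/
lemma VanishesTo.rho_mul_deriv_sub {n : ℕ} {w : ℝ → ℝ} (hw : VanishesTo n w) :
    VanishesTo (n + 1) (fun ρ => ρ * deriv w ρ - n * w ρ) := by
  have h1 := VanishesTo.rho.smooth.mul (contDiffAt_deriv hw.1)
  have h2 : ContDiffAt ℝ ∞ (fun ρ => (n : ℝ) * w ρ) 0 := contDiffAt_const.mul hw.1
  refine ⟨h1.sub h2, fun j hj => ?_⟩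
  rw [iteratedDeriv_fun_sub (h1.of_le (by exact_mod_cast le_top))
    (h2.of_le (by exact_mod_cast le_top)),
    iteratedDeriv_rho_mul_deriv j (fun ρ => ρ) (by simp) hw.1]
  have : iteratedDeriv j (fun ρ => (n : ℝ) * w ρ) 0 = n * iteratedDeriv j w 0 := by
    simp
  rw [this]
  rcases Nat.lt_succ_iff_lt_or_eq.mp hj with h | rfl
  · rw [hw.2 j h]; simp
  · simp

/-- Smoothness, to any finite order, on some interval `(0, ε)`. -/
def SmoothPos (F : ℝ → ℂ) : Prop := ∀ p : ℕ, ∀ᶠ ρ in 𝓝[>] 0, ContDiffAt ℝ p F ρ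

/-- Being of class C^p near a point is an open condition for each finite p, but the interval may
shrink as p grows. This is why `SmoothPos` fixes the order before the interval. -/
lemma SmoothPos.of_contDiffAt {G : ℝ → ℂ} (h : ContDiffAt ℝ ∞ G 0) : SmoothPos G := fun p =>
  (((h.of_le (by exact_mod_cast le_top) : ContDiffAt ℝ p G 0).eventually
    (by simp))).filter_mono nhdsWithin_le_nhds

lemma SmoothPos.mul {F G : ℝ → ℂ} (hF : SmoothPos F) (hG : SmoothPos G) :
    SmoothPos (fun ρ => F ρ * G ρ) := fun p => by
  filter_upwards [hF p, hG p] with ρ h1 h2 using h1.mul h2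

lemma SmoothPos.inv_rho : SmoothPos (fun ρ => ((ρ⁻¹ : ℝ) : ℂ)) := fun p => by
  filter_upwards [self_mem_nhdsWithin] with ρ hρ
  exact Complex.ofRealCLM.contDiff.contDiffAt.comp ρ
    (contDiffAt_inv ℝ (ne_of_gt hρ))

lemma SmoothPos.congr {F G : ℝ → ℂ} (hG : SmoothPos G) (h : ∀ᶠ ρ in 𝓝[>] 0, F ρ = G ρ) :
    SmoothPos F := fun p => by
  have h' := eventually_eventually_nhdsWithin.2 h
  filter_upwards [hG p, h', self_mem_nhdsWithin] with ρ h1 h2 hρ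
  rw [isOpen_Ioi.nhdsWithin_eq hρ] at h2
  exact h1.congr_of_eventuallyEq h2

lemma continuousAt_iteratedDeriv {D : ℝ → ℂ} (hD : ContDiffAt ℝ ∞ D 0) (p : ℕ) :
    ContinuousAt (iteratedDeriv p D) 0 := by
  have : ContDiffAt ℝ 0 (iteratedFDeriv ℝ p D) 0 :=
    hD.iteratedFDeriv_right (i := p) (by rw [zero_add]; exact_mod_cast le_top)
  have h2 := this.continuousAt
  exact (ContinuousMultilinearMap.apply ℝ (fun _ : Fin p => ℝ) ℂ
    (fun _ => 1)).continuous.continuousAt.comp h2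

/-- The data are given for ρ > 0 only and may carry a factor 1/ρ; it is their difference that is
known to extend smoothly through 0. Uniqueness of limits identifies the difference of the jets with
derivatives of the extension. Smoothness of each function is needed for the derivative of the
difference to split. -/
lemma HasRhoJet.sub_eq {F₁ F₂ D : ℝ → ℂ} {j₁ j₂ : ℕ → ℂ} (h₁ : HasRhoJet F₁ j₁)
    (h₂ : HasRhoJet F₂ j₂) (s₁ : SmoothPos F₁) (s₂ : SmoothPos F₂) (hD : ContDiffAt ℝ ∞ D 0)
    (h : ∀ᶠ ρ in 𝓝[>] 0, F₁ ρ - F₂ ρ = D ρ) (p : ℕ) :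
    j₁ p - j₂ p = iteratedDeriv p D 0 := by
  have h3 := (h₁ p).sub (h₂ p)
  have h4 : Tendsto (iteratedDeriv p D) (𝓝[>] 0) (𝓝 (iteratedDeriv p D 0)) :=
    (continuousAt_iteratedDeriv hD p).tendsto.mono_left nhdsWithin_le_nhds
  refine tendsto_nhds_unique h3 (h4.congr' ?_)
  filter_upwards [s₁ p, s₂ p, eventually_eventually_nhdsWithin.2 h, self_mem_nhdsWithin]
    with ρ c1 c2 h2 hρ
  rw [isOpen_Ioi.nhdsWithin_eq hρ] at h2
  have h2' : (fun ρ => F₁ ρ - F₂ ρ) =ᶠ[𝓝 ρ] D := h2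
  rw [← h2'.iteratedDeriv_eq p, iteratedDeriv_fun_sub c1 c2]

lemma HasRhoJet.eq_of_vanishesTo {F₁ F₂ D : ℝ → ℂ} {j₁ j₂ : ℕ → ℂ} (h₁ : HasRhoJet F₁ j₁)
    (h₂ : HasRhoJet F₂ j₂) (s₁ : SmoothPos F₁) (s₂ : SmoothPos F₂) {k : ℕ} (hD : VanishesTo k D)
    (h : ∀ᶠ ρ in 𝓝[>] 0, F₁ ρ - F₂ ρ = D ρ) {p : ℕ} (hp : p < k) : j₁ p = j₂ p := by
  rw [← sub_eq_zero, h₁.sub_eq h₂ s₁ s₂ hD.1 h p, hD.2 p hp]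

lemma HasRhoJet.zero_eq {F G : ℝ → ℂ} {j : ℕ → ℂ} (hF : HasRhoJet F j)
    (hG : ContDiffAt ℝ ∞ G 0) (h : ∀ᶠ ρ in 𝓝[>] 0, F ρ = G ρ) : j 0 = G 0 := by
  have h1 := hF 0
  simp only [iteratedDeriv_zero] at h1
  exact tendsto_nhds_unique h1 ((hG.continuousAt.tendsto.mono_left nhdsWithin_le_nhds).congr'
    (h.mono fun _ h => h.symm))

lemma HasRhoJet.unique {F : ℝ → ℂ} {j₁ j₂ : ℕ → ℂ} (h₁ : HasRhoJet F j₁) (h₂ : HasRhoJet F j₂)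
    (p : ℕ) : j₁ p = j₂ p := tendsto_nhds_unique (h₁ p) (h₂ p)

end Jets

/-! ### Analytic germs at the origin of `ℝ³` -/

lemma pd_congr {i : Fin 3} {f g : E3 → ℝ} {x : E3} (h : f =ᶠ[𝓝 x] g) : pd i f x = pd i g x := by
  rw [pd, pd, h.fderiv_eq]

lemma pd_eventuallyEq {i : Fin 3} {f g : E3 → ℝ} {x : E3} (h : f =ᶠ[𝓝 x] g) :
    pd i f =ᶠ[𝓝 x] pd i g := h.fderiv.mono fun y hy => by rw [pd, pd, hy]

lemma pd_add {i : Fin 3} {f g : E3 → ℝ} {x : E3} (hf : DifferentiableAt ℝ f x)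
    (hg : DifferentiableAt ℝ g x) : pd i (fun y => f y + g y) x = pd i f x + pd i g x := by
  rw [pd, fderiv_fun_add hf hg]; rfl

lemma pd_mul {i : Fin 3} {f g : E3 → ℝ} {x : E3} (hf : DifferentiableAt ℝ f x)
    (hg : DifferentiableAt ℝ g x) :
    pd i (fun y => f y * g y) x = pd i f x * g x + f x * pd i g x := by
  rw [pd, fderiv_fun_mul hf hg]
  simp [pd]; ring

lemma pd_const_mul {i : Fin 3} (c : ℝ) {f : E3 → ℝ} {x : E3} (hf : DifferentiableAt ℝ f x) :
    pd i (fun y => c * f y) x = c * pd i f x := by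
  rw [pd, fderiv_const_mul hf]; rfl

lemma pd_coord (i j : Fin 3) (x : E3) : pd i (fun y => y j) x = if i = j then 1 else 0 := by
  have : (fun y : E3 => y j) = (EuclideanSpace.proj j : E3 →L[ℝ] ℝ) := rfl
  rw [pd, this, ContinuousLinearMap.fderiv]
  simp [eq_comm]

lemma analyticAt_pd {i : Fin 3} {f : E3 → ℝ} {x : E3} (hf : AnalyticAt ℝ f x) :
    AnalyticAt ℝ (pd i f) x :=
  ((ContinuousLinearMap.apply ℝ ℝ (EuclideanSpace.single i 1 : E3)).analyticAt _).comp hf.fderiv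

lemma analyticAt_coord (j : Fin 3) (x : E3) : AnalyticAt ℝ (fun y : E3 => y j) x :=
  (EuclideanSpace.proj j : E3 →L[ℝ] ℝ).analyticAt x

lemma analyticAt_norm_sq (x : E3) : AnalyticAt ℝ (fun y : E3 => ‖y‖ ^ 2) x := by
  have : (fun y : E3 => ‖y‖ ^ 2) = fun y => ∑ i, y i ^ 2 := by
    funext y; simp [EuclideanSpace.norm_sq_eq]
  rw [this]
  exact Finset.univ.analyticAt_fun_sum fun i _ => (analyticAt_coord i x).pow 2

lemma fderiv_apply_eq_sum (f : E3 → ℝ) (x e : E3) : fderiv ℝ f x e = ∑ i, e i * pd i f x := by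
  have : e = ∑ i, e i • (EuclideanSpace.single i 1 : E3) := by
    ext j; simp [Finset.sum_apply, Pi.single_apply]
  conv_lhs => rw [this]
  simp [pd]

/-- `f` is analytic at the origin and its Taylor series starts at order `k` or later. -/
def OrdGE (k : ℕ) (f : E3 → ℝ) : Prop :=
  AnalyticAt ℝ f 0 ∧ ∀ j < k, iteratedFDeriv ℝ j f 0 = 0

namespace OrdGE

variable {k m : ℕ} {f g : E3 → ℝ}

lemma mono (h : OrdGE k f) (hm : m ≤ k) : OrdGE m f := ⟨h.1, fun j hj => h.2 j (hj.trans_le hm)⟩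

lemma congr (h : OrdGE k f) (hfg : g =ᶠ[𝓝 0] f) : OrdGE k g :=
  ⟨h.1.congr hfg.symm, fun j hj => by rw [(hfg.iteratedFDeriv ℝ j).eq_of_nhds, h.2 j hj]⟩

lemma of_analytic (h : AnalyticAt ℝ f 0) : OrdGE 0 f := ⟨h, fun j hj => by omega⟩

lemma of_apply_zero (h : AnalyticAt ℝ f 0) (h0 : f 0 = 0) : OrdGE 1 f :=
  ⟨h, fun j hj => by
    obtain rfl : j = 0 := by omega
    ext; simpa using h0⟩

lemma add (hf : OrdGE k f) (hg : OrdGE k g) : OrdGE k (fun x => f x + g x) := by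
  refine ⟨hf.1.add hg.1, fun j hj => ?_⟩
  have := iteratedFDeriv_add_apply (i := j) (x := (0 : E3)) (f := f) (g := g)
    hf.1.contDiffAt hg.1.contDiffAt
  change iteratedFDeriv ℝ j (f + g) 0 = 0
  rw [this, hf.2 j hj, hg.2 j hj, add_zero]

/-- As in one variable, with the norm estimate for derivatives of a product in place of the Leibniz
formula: each summand on the right contains a vanishing factor. The estimate is stated on a set,
hence the open neighbourhood on which both factors are analytic. -/
lemma mul (hf : OrdGE k f) (hg : OrdGE m g) : OrdGE (k + m) (fun x => f x * g x) := by
  refine ⟨hf.1.mul hg.1, fun j hj => ?_⟩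
  obtain ⟨s, hs, hso, h0⟩ := eventually_nhds_iff.1
    (hf.1.eventually_analyticAt.and hg.1.eventually_analyticAt)
  have := norm_iteratedFDerivWithin_mul_le (𝕜 := ℝ) (s := s) (f := f) (g := g) (N := ω) (n := j)
    (fun x hx => (hs x hx).1.contDiffAt.contDiffWithinAt)
    (fun x hx => (hs x hx).2.contDiffAt.contDiffWithinAt) hso.uniqueDiffOn h0 le_top
  rw [iteratedFDerivWithin_of_isOpen j hso h0] at this
  rw [← norm_le_zero_iff]
  refine this.trans (Finset.sum_nonpos fun i hi => ?_)
  rw [Finset.mem_range] at hi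
  rw [iteratedFDerivWithin_of_isOpen _ hso h0, iteratedFDerivWithin_of_isOpen _ hso h0]
  by_cases h : i < k
  · rw [hf.2 i h]; simp
  · rw [hg.2 (j - i) (by omega)]; simp

lemma mul_analytic (hf : OrdGE k f) (hg : AnalyticAt ℝ g 0) : OrdGE k (fun x => f x * g x) :=
  hf.mul (of_analytic hg)

lemma analytic_mul (hf : AnalyticAt ℝ f 0) (hg : OrdGE k g) : OrdGE k (fun x => f x * g x) := by
  simpa using (of_analytic hf).mul hg

lemma zero : OrdGE k (fun _ => 0) := ⟨analyticAt_const, fun j _ => by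
  rcases j with _ | j
  · ext; simp
  · simp⟩

lemma sum {ι : Type*} (s : Finset ι) {f : ι → E3 → ℝ} (h : ∀ i ∈ s, OrdGE k (f i)) :
    OrdGE k (fun x => ∑ i ∈ s, f i x) := by
  classical
  induction s using Finset.induction_on with
  | empty => simpa using zero
  | insert i s hi ih =>
    refine ((h i (by simp)).add (ih fun j hj => h j (by simp [hj]))).congr
      (Eventually.of_forall fun ρ => ?_)
    simp [Finset.sum_insert hi]

/-- The subtraction is truncated; for k = 0 only analyticity is asserted. -/
lemma pd (hf : OrdGE k f) (i : Fin 3) : OrdGE (k - 1) (pd i f) := by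
  refine ⟨analyticAt_pd hf.1, fun j hj => ?_⟩
  have h1 : iteratedFDeriv ℝ j (fderiv ℝ f) 0 = 0 := by
    rw [← norm_eq_zero, norm_iteratedFDeriv_fderiv, hf.2 (j + 1) (by omega), norm_zero]
  have := (ContinuousLinearMap.apply ℝ ℝ
    (EuclideanSpace.single i 1 : E3)).iteratedFDeriv_comp_left (f := fderiv ℝ f) (x := (0 : E3))
    (i := j) (n := ω) hf.1.fderiv.contDiffAt le_top
  change iteratedFDeriv ℝ j ((ContinuousLinearMap.apply ℝ ℝ
    (EuclideanSpace.single i 1 : E3)) ∘ fderiv ℝ f) 0 = 0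
  rw [this, h1]; ext; simp

end OrdGE

/-- The embedding of the line through `e`. -/
def lineCLM (e : E3) : ℝ →L[ℝ] E3 := (ContinuousLinearMap.id ℝ ℝ).smulRight e

lemma contDiffAt_line {f : E3 → ℝ} (hf : AnalyticAt ℝ f 0) (e : E3) :
    ContDiffAt ℝ ∞ (fun ρ : ℝ => f (ρ • e)) 0 := by
  have h : AnalyticAt ℝ f (lineCLM e 0) := by simpa using hf
  exact (h.contDiffAt.comp (0 : ℝ) (lineCLM e).contDiff.contDiffAt)

/-- The line is a linear map, so the chain rule has no further terms and the n-th derivative is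
pulled back to the diagonal. -/
lemma iteratedDeriv_line {f : E3 → ℝ} (hf : AnalyticAt ℝ f 0) (e : E3) (n : ℕ) :
    iteratedDeriv n (fun ρ : ℝ => f (ρ • e)) 0 = iteratedFDeriv ℝ n f 0 (fun _ => e) := by
  obtain ⟨s, hs, hso, h0⟩ := eventually_nhds_iff.1 hf.eventually_analyticAt
  have hpo : IsOpen (lineCLM e ⁻¹' s) := hso.preimage (lineCLM e).continuous
  have h0' : (0 : ℝ) ∈ lineCLM e ⁻¹' s := by simpa using h0
  have := (lineCLM e).iteratedFDerivWithin_comp_right (f := f) (s := s) (n := ω) (x := 0) (i := n)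
    (fun x hx => (hs x hx).contDiffAt.contDiffWithinAt) hso.uniqueDiffOn hpo.uniqueDiffOn
    h0' le_top
  rw [iteratedFDerivWithin_of_isOpen _ hpo h0',
    iteratedFDerivWithin_of_isOpen _ hso (by simpa using h0)] at this
  simp only [iteratedDeriv]
  change iteratedFDeriv ℝ n (f ∘ lineCLM e) 0 _ = _
  rw [this]
  simp [lineCLM]

lemma OrdGE.line {k : ℕ} {f : E3 → ℝ} (hf : OrdGE k f) (e : E3) :
    VanishesTo k (fun ρ : ℝ => f (ρ • e)) :=
  ⟨contDiffAt_line hf.1 e, fun j hj => by rw [iteratedDeriv_line hf.1, hf.2 j hj]; simp⟩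

lemma hasDerivAt_line {f : E3 → ℝ} {e : E3} {ρ : ℝ} (hf : DifferentiableAt ℝ f (ρ • e)) :
    HasDerivAt (fun r : ℝ => f (r • e)) (∑ i, e i * pd i f (ρ • e)) ρ := by
  rw [← fderiv_apply_eq_sum]
  have h2 : HasDerivAt (fun r : ℝ => r • e) e ρ := by
    simpa using (hasDerivAt_id ρ).smul_const e
  exact hf.hasFDerivAt.comp_hasDerivAt ρ h2

/-- A nonvanishing derivative at the origin is seen along some line. -/
lemma exists_iteratedFDeriv_diag_ne_zero {f : E3 → ℝ} (hf : AnalyticAt ℝ f 0) {n : ℕ}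
    (hn : 0 < n) (h : iteratedFDeriv ℝ n f 0 ≠ 0) :
    ∃ e : E3, ‖e‖ = 1 ∧ iteratedFDeriv ℝ n f 0 (fun _ => e) ≠ 0 := by
  by_contra! hcon
  apply h
  set M := iteratedFDeriv ℝ n f 0 with hM
  have hdiag : ∀ v : E3, M (fun _ => v) = 0 := by
    intro v
    by_cases hv : v = 0
    · subst hv
      exact M.map_coord_zero (⟨0, hn⟩ : Fin n) rfl
    · have h1 := hcon (‖v‖⁻¹ • v) (by rw [norm_smul, norm_inv, norm_norm,
        inv_mul_cancel₀ (norm_ne_zero_iff.2 hv)])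
      have h2 := M.map_smul_univ (fun _ => ‖v‖⁻¹) (fun _ => v)
      rw [h1] at h2
      simpa [norm_ne_zero_iff.2 hv] using h2.symm
  ext v
  -- Polarisation: the n-th derivative of x ↦ M(x, …, x) is the sum of M over all permutations of
  -- its arguments, which is n! M(v) by symmetry of the derivative. It vanishes if M vanishes on the
  -- diagonal.
  have h3 := M.iteratedFDeriv_comp_diagonal 0 v
  have h4 : (fun x : E3 => M (fun _ => x)) = fun _ => 0 := funext hdiag
  have h5 : ∀ σ : Equiv.Perm (Fin n), M (fun i => v (σ i)) = M v := fun σ =>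
    hf.contDiffAt.iteratedFDeriv_comp_perm v σ
  rw [h4] at h3
  simp only [h5, Finset.sum_const] at h3
  have h6 : iteratedFDeriv ℝ n (fun _ : E3 => (0 : ℝ)) 0 v = 0 := by
    obtain ⟨n, rfl⟩ : ∃ m, n = m + 1 := ⟨n - 1, by omega⟩
    simp
  rw [h6] at h3
  simpa [Finset.card_univ, Fintype.card_perm, Nat.factorial_ne_zero] using h3.symm

/-! ### Derivatives of `|x|ᵐ A(x)` along a ray -/

lemma differentiableAt_pd {i : Fin 3} {f : E3 → ℝ} {x : E3} (hf : ContDiffAt ℝ ∞ f x) :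
    DifferentiableAt ℝ (pd i f) x := by
  have h := (hf.fderiv_right (m := ∞) (by simp)).differentiableAt (by simp)
  exact h.clm_apply (differentiableAt_const _)

lemma differentiableAt_of_smooth {f : E3 → ℝ} {x : E3} (hf : ContDiffAt ℝ ∞ f x) :
    DifferentiableAt ℝ f x := hf.differentiableAt (by simp)

/-- Follows by differentiating |y|² = Σ y_j², which avoids a formula for the derivative of the
square root. -/
lemma pd_norm {x : E3} (hx : x ≠ 0) (i : Fin 3) : pd i (fun y => ‖y‖) x = x i / ‖x‖ := by
  have hd : DifferentiableAt ℝ (fun y : E3 => ‖y‖) x :=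
    (contDiffAt_norm ℝ (n := 1) hx).differentiableAt one_ne_zero
  have h1 := pd_mul (i := i) hd hd
  have h2 : (fun y : E3 => ‖y‖ * ‖y‖) = fun y => ∑ j, y j * y j := by
    funext y
    rw [← sq, EuclideanSpace.norm_sq_eq]
    simp [sq]
  have hc : ∀ j, DifferentiableAt ℝ (fun y : E3 => y j) x := fun j =>
    (analyticAt_coord j x).differentiableAt
  have h3 : pd i (fun y : E3 => ∑ j, y j * y j) x = 2 * x i := by
    rw [pd, fderiv_fun_sum (A := fun j (y : E3) => y j * y j) (fun j _ => (hc j).fun_mul (hc j))]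
    have : ∀ j, (fderiv ℝ (fun y : E3 => y j * y j) x) (EuclideanSpace.single i 1)
        = if i = j then 2 * x j else 0 := by
      intro j
      have := pd_mul (i := i) (hc j) (hc j)
      rw [pd_coord] at this
      change pd i _ x = _
      rw [this]
      split_ifs <;> ring
    simp [this]
  rw [h2, h3] at h1
  have h0 : ‖x‖ ≠ 0 := norm_ne_zero_iff.2 hx
  field_simp
  linarith

lemma pd_norm_pow {x : E3} (hx : x ≠ 0) (i : Fin 3) (k : ℕ) :
    pd i (fun y => ‖y‖ ^ k) x = k * ‖x‖ ^ (k - 1) * (x i / ‖x‖) := by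
  have hd : DifferentiableAt ℝ (fun y : E3 => ‖y‖) x :=
    (contDiffAt_norm ℝ (n := 1) hx).differentiableAt one_ne_zero
  rw [← pd_norm hx i, pd, fderiv_fun_pow k hd]
  simp [pd]

lemma contDiffAt_norm_pow {x : E3} (hx : x ≠ 0) (k : ℕ) :
    ContDiffAt ℝ ∞ (fun y : E3 => ‖y‖ ^ k) x := (contDiffAt_norm ℝ hx).pow k

/-- `|x|ᵐ A(x)`. -/
def radPow (m : ℕ) (A : E3 → ℝ) (x : E3) : ℝ := ‖x‖ ^ m * A x

lemma contDiffAt_radPow {m : ℕ} {A : E3 → ℝ} {x : E3} (hx : x ≠ 0) (hA : AnalyticAt ℝ A x) :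
    ContDiffAt ℝ ∞ (radPow m A) x := (contDiffAt_norm_pow hx m).mul hA.contDiffAt

lemma pd_radPow {m : ℕ} {A : E3 → ℝ} {x : E3} (hx : x ≠ 0) (hA : AnalyticAt ℝ A x) (i : Fin 3) :
    pd i (radPow m A) x = m * ‖x‖ ^ (m - 1) * (x i / ‖x‖) * A x + ‖x‖ ^ m * pd i A x := by
  rw [← pd_norm_pow hx i m]
  exact pd_mul (differentiableAt_of_smooth (contDiffAt_norm_pow hx m)) hA.differentiableAt

/-- With exponent k + 2, the derivative of the norm power is (k + 2)|x|^k x_i, so the result stays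
in the class of |x|^m times analytic functions. For this reason the expansions below are indexed by
k with the power k + 2. -/
lemma pd_radPow_add_two {k : ℕ} {A : E3 → ℝ} {x : E3} (hx : x ≠ 0) (hA : AnalyticAt ℝ A x)
    (i : Fin 3) :
    pd i (radPow (k + 2) A) x
      = (k + 2) * radPow k (fun y => y i * A y) x + radPow (k + 2) (pd i A) x := by
  have h0 : ‖x‖ ≠ 0 := norm_ne_zero_iff.2 hx
  rw [pd_radPow hx hA, radPow, radPow, show k + 2 - 1 = k + 1 from rfl]
  push_cast
  field_simp
  ring

/-- `|x|^{-(k+1)} ∂_i (|x|^{k+2} A)` on the ray in the direction `e`. -/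
def rayGrad (e : E3) (k : ℕ) (A : E3 → ℝ) (i : Fin 3) (ρ : ℝ) : ℝ :=
  (k + 2) * e i * A (ρ • e) + ρ * pd i A (ρ • e)

/-- `|x|^{-k} ∂_i ∂_j (|x|^{k+2} A)` on the ray in the direction `e`. -/
def rayHess (e : E3) (k : ℕ) (A : E3 → ℝ) (i j : Fin 3) (ρ : ℝ) : ℝ :=
  (k + 2) * k * e i * e j * A (ρ • e) + (k + 2) * (if i = j then 1 else 0) * A (ρ • e)
    + (k + 2) * ρ * (e j * pd i A (ρ • e) + e i * pd j A (ρ • e)) + ρ ^ 2 * pd i (pd j A) (ρ • e)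

/-- `|x|^{-k} D_i D_j (|x|^{k+2} A)` on the ray in the direction `e`. -/
def rayCovHess (h : MetricField) (e : E3) (k : ℕ) (A : E3 → ℝ) (i j : Fin 3) (ρ : ℝ) : ℝ :=
  rayHess e k A i j ρ - ρ * ∑ l, christoffel h l i j (ρ • e) * rayGrad e k A l ρ

lemma pd_radPow_ray {k : ℕ} {A : E3 → ℝ} {e : E3} (he : ‖e‖ = 1) {ρ : ℝ} (hρ : 0 < ρ)
    (hA : AnalyticAt ℝ A (ρ • e)) (i : Fin 3) :
    pd i (radPow (k + 2) A) (ρ • e) = ρ ^ (k + 1) * rayGrad e k A i ρ := by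
  have hn : ‖ρ • e‖ = ρ := by rw [norm_smul, he, mul_one, Real.norm_of_nonneg hρ.le]
  have hx : ρ • e ≠ 0 := by rw [← norm_ne_zero_iff, hn]; exact hρ.ne'
  rw [pd_radPow_add_two hx hA, radPow, radPow, rayGrad, hn]
  simp only [PiLp.smul_apply, smul_eq_mul]
  ring

lemma pd_pd_radPow_ray {k : ℕ} {A : E3 → ℝ} {e : E3} (he : ‖e‖ = 1) {ρ : ℝ} (hρ : 0 < ρ)
    (hA : AnalyticAt ℝ A (ρ • e)) (i j : Fin 3) :
    pd i (pd j (radPow (k + 2) A)) (ρ • e) = ρ ^ k * rayHess e k A i j ρ := by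
  have hn : ‖ρ • e‖ = ρ := by rw [norm_smul, he, mul_one, Real.norm_of_nonneg hρ.le]
  have hx : ρ • e ≠ 0 := by rw [← norm_ne_zero_iff, hn]; exact hρ.ne'
  have hev : pd j (radPow (k + 2) A) =ᶠ[𝓝 (ρ • e)]
      fun x => (k + 2) * radPow k (fun y => y j * A y) x + radPow (k + 2) (pd j A) x := by
    filter_upwards [hA.eventually_analyticAt, isOpen_ne.mem_nhds hx] with x h1 h2
    exact pd_radPow_add_two h2 h1 j
  have hc : AnalyticAt ℝ (fun y : E3 => y j * A y) (ρ • e) := (analyticAt_coord j _).mul hA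
  have hp : AnalyticAt ℝ (pd j A) (ρ • e) := analyticAt_pd hA
  rw [pd_congr hev, pd_add ((differentiableAt_of_smooth (contDiffAt_radPow hx hc)).const_mul _)
    (differentiableAt_of_smooth (contDiffAt_radPow hx hp)),
    pd_const_mul _ (differentiableAt_of_smooth (contDiffAt_radPow hx hc)),
    pd_radPow hx hc, pd_radPow_add_two hx hp,
    pd_mul (analyticAt_coord j _).differentiableAt hA.differentiableAt, pd_coord]
  simp only [radPow, rayHess, hn, PiLp.smul_apply, smul_eq_mul]
  -- The outer derivative now falls on |x|^k, where the exponent k - 1 is truncated at k = 0; there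
  -- the factor k removes the term.
  rcases k with _ | k
  · split_ifs <;> simp <;> ring
  · rw [show k + 1 - 1 = k from rfl]
    push_cast
    field_simp
    ring

/-- Off the origin `f` is smooth, and its gradient and covariant Hessian on the ray in the direction
`e` are `ρ g` and `M`. -/
structure HasRayExpansion (h : MetricField) (e : E3) (f : E3 → ℝ) (g : Fin 3 → ℝ → ℝ)
    (M : Fin 3 → Fin 3 → ℝ → ℝ) : Prop where
  smooth : ∀ᶠ x in 𝓝[≠] (0 : E3), ContDiffAt ℝ ∞ f x
  grad : ∀ᶠ ρ in 𝓝[>] (0 : ℝ), ∀ i, pd i f (ρ • e) = ρ * g i ρ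
  hess : ∀ᶠ ρ in 𝓝[>] (0 : ℝ), ∀ i j, hess h f i j (ρ • e) = M i j ρ

lemma tendsto_ray {e : E3} (he : ‖e‖ = 1) :
    Tendsto (fun ρ : ℝ => ρ • e) (𝓝[>] 0) (𝓝[≠] (0 : E3)) := by
  refine tendsto_nhdsWithin_iff.2 ⟨?_, ?_⟩
  · have : Continuous fun ρ : ℝ => ρ • e := by fun_prop
    simpa using (this.tendsto 0).mono_left nhdsWithin_le_nhds
  · filter_upwards [self_mem_nhdsWithin] with ρ hρ
    have : e ≠ 0 := by rw [← norm_ne_zero_iff, he]; exact one_ne_zero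
    exact smul_ne_zero (ne_of_gt hρ) this

lemma tendsto_ray_nhds (e : E3) : Tendsto (fun ρ : ℝ => ρ • e) (𝓝[>] 0) (𝓝 (0 : E3)) := by
  have : Continuous fun ρ : ℝ => ρ • e := by fun_prop
  simpa using (this.tendsto 0).mono_left nhdsWithin_le_nhds

namespace HasRayExpansion

variable {h : MetricField} {e : E3} {f₁ f₂ : E3 → ℝ} {g₁ g₂ : Fin 3 → ℝ → ℝ}
  {M₁ M₂ : Fin 3 → Fin 3 → ℝ → ℝ}

lemma radPow (he : ‖e‖ = 1) (k : ℕ) {A : E3 → ℝ} (hA : AnalyticAt ℝ A 0) :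
    HasRayExpansion h e (radPow (k + 2) A) (fun i ρ => ρ ^ k * rayGrad e k A i ρ)
      (fun i j ρ => ρ ^ k * rayCovHess h e k A i j ρ) where
  smooth := by
    filter_upwards [hA.eventually_analyticAt.filter_mono nhdsWithin_le_nhds, self_mem_nhdsWithin]
      with x h1 h2 using contDiffAt_radPow h2 h1
  grad := by
    filter_upwards [(tendsto_ray_nhds e).eventually hA.eventually_analyticAt,
      self_mem_nhdsWithin] with ρ h1 h2 i
    rw [pd_radPow_ray he h2 h1]; ring
  hess := by
    filter_upwards [(tendsto_ray_nhds e).eventually hA.eventually_analyticAt,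
      self_mem_nhdsWithin] with ρ h1 h2 i j
    rw [SpatialInfinity.hess, pd_pd_radPow_ray he h2 h1, rayCovHess, mul_sub, ← mul_assoc,
      Finset.mul_sum]
    congr 1
    refine Finset.sum_congr rfl fun l _ => ?_
    rw [pd_radPow_ray he h2 h1]; ring

lemma add (he : ‖e‖ = 1) (h₁ : HasRayExpansion h e f₁ g₁ M₁) (h₂ : HasRayExpansion h e f₂ g₂ M₂) :
    HasRayExpansion h e (fun x => f₁ x + f₂ x) (fun i ρ => g₁ i ρ + g₂ i ρ)
      (fun i j ρ => M₁ i j ρ + M₂ i j ρ) where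
  smooth := by filter_upwards [h₁.smooth, h₂.smooth] with x a b using a.add b
  grad := by
    filter_upwards [h₁.grad, h₂.grad, (tendsto_ray he).eventually (h₁.smooth.and h₂.smooth)]
      with ρ a b c i
    rw [pd_add (differentiableAt_of_smooth c.1) (differentiableAt_of_smooth c.2), a, b]; ring
  hess := by
    have hev : ∀ᶠ x in 𝓝[≠] (0 : E3), ∀ᶠ y in 𝓝 x, ContDiffAt ℝ ∞ f₁ y ∧ ContDiffAt ℝ ∞ f₂ y := by
      filter_upwards [eventually_eventually_nhdsWithin.2 (h₁.smooth.and h₂.smooth),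
        self_mem_nhdsWithin] with x hx hx0
      rwa [isOpen_compl_singleton.nhdsWithin_eq hx0] at hx
    filter_upwards [h₁.hess, h₂.hess, (tendsto_ray he).eventually hev] with ρ a b c i j
    have hc := c.self_of_nhds
    rw [← a, ← b, SpatialInfinity.hess, SpatialInfinity.hess, SpatialInfinity.hess]
    have h1 : pd j (fun x => f₁ x + f₂ x) =ᶠ[𝓝 (ρ • e)] fun x => pd j f₁ x + pd j f₂ x := by
      filter_upwards [c] with y hy
      exact pd_add (differentiableAt_of_smooth hy.1) (differentiableAt_of_smooth hy.2)
    rw [pd_congr h1, pd_add (differentiableAt_pd hc.1) (differentiableAt_pd hc.2)]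
    have h2 : ∀ k, pd k (fun x => f₁ x + f₂ x) (ρ • e) = pd k f₁ (ρ • e) + pd k f₂ (ρ • e) :=
      fun k => pd_add (differentiableAt_of_smooth hc.1) (differentiableAt_of_smooth hc.2)
    simp only [h2, mul_add, Finset.sum_add_distrib]
    ring

lemma congr (he : ‖e‖ = 1) (h₁ : HasRayExpansion h e f₁ g₁ M₁)
    (hf : ∀ᶠ x in 𝓝[≠] (0 : E3), f₂ x = f₁ x) : HasRayExpansion h e f₂ g₁ M₁ := by
  have hev : ∀ᶠ x in 𝓝[≠] (0 : E3), f₂ =ᶠ[𝓝 x] f₁ := by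
    filter_upwards [eventually_eventually_nhdsWithin.2 hf, self_mem_nhdsWithin] with x hx hx0
    rwa [isOpen_compl_singleton.nhdsWithin_eq hx0] at hx
  refine ⟨?_, ?_, ?_⟩
  · filter_upwards [h₁.smooth, hev] with x a b using a.congr_of_eventuallyEq b
  · filter_upwards [h₁.grad, (tendsto_ray he).eventually hev] with ρ a b i
    rw [pd_congr b, a]
  · filter_upwards [h₁.hess, (tendsto_ray he).eventually hev] with ρ a b i j
    rw [← a, SpatialInfinity.hess, SpatialInfinity.hess, pd_congr (pd_eventuallyEq b)]
    simp only [pd_congr b]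

end HasRayExpansion

/-! ### Orders of vanishing of the expansions -/

/-- A derivative of A costs one order of vanishing but comes with a factor ρ that restores it. The
same count applies to the Hessians below. -/
lemma rayGrad_vanishesTo (e : E3) (k : ℕ) {n : ℕ} {A : E3 → ℝ} (hA : OrdGE n A) (i : Fin 3) :
    VanishesTo n (rayGrad e k A i) :=
  ((hA.line e).const_mul ((k + 2) * e i)).add
    ((VanishesTo.rho.mul ((hA.pd i).line e)).mono (by omega))

lemma rayHess_vanishesTo (e : E3) (k : ℕ) {n : ℕ} {A : E3 → ℝ} (hA : OrdGE n A) (i j : Fin 3) :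
    VanishesTo n (rayHess e k A i j) := by
  have h1 := hA.line e
  have h2 := fun i => (VanishesTo.rho.mul ((hA.pd i).line e)).mono (show n ≤ _ by omega)
  have h3 := ((VanishesTo.rho.mul VanishesTo.rho).mul (((hA.pd j).pd i).line e)).mono
    (show n ≤ _ by omega)
  refine ((((h1.const_mul ((k + 2) * k * e i * e j)).add
    (h1.const_mul ((k + 2 : ℝ) * (if i = j then 1 else 0)))).add
    ((((h2 i).const_mul (e j)).add ((h2 j).const_mul (e i))).const_mul ((k : ℝ) + 2))).add
    h3).congr (Eventually.of_forall fun ρ => ?_)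
  simp only [rayHess]
  ring

lemma rayCovHess_vanishesTo {h : MetricField} (hΓ : ∀ i j k, AnalyticAt ℝ (christoffel h i j k) 0)
    (e : E3) (k : ℕ) {n : ℕ} {A : E3 → ℝ} (hA : OrdGE n A) (i j : Fin 3) :
    VanishesTo n (rayCovHess h e k A i j) :=
  (rayHess_vanishesTo e k hA i j).sub (VanishesTo.smooth_mul contDiffAt_id
    (VanishesTo.sum _ fun l _ => VanishesTo.smooth_mul (contDiffAt_line (hΓ l i j) e)
      (rayGrad_vanishesTo e k hA l)))

/-! ### Analyticity of the curvature quantities -/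

/-- Cramer's rule, with determinant -1 at the origin. -/
lemma analyticAt_matrix_inv {h : MetricField} (hh : ∀ i j, AnalyticAt ℝ (fun x => h x i j) 0)
    (h0 : h 0 = -1) (i j : Fin 3) : AnalyticAt ℝ (fun x => (h x)⁻¹ i j) 0 := by
  have hdet : AnalyticAt ℝ (fun x => (h x).det) 0 := by
    simp only [Matrix.det_fin_three]
    fun_prop
  have hadj : AnalyticAt ℝ (fun x => (h x).adjugate i j) 0 := by
    simp only [Matrix.adjugate_fin_three]
    fin_cases i <;> fin_cases j <;> simp <;> fun_prop
  have hne : (h 0).det ≠ 0 := by rw [h0]; simp [Matrix.det_neg]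
  simp only [Matrix.inv_def, Ring.inverse_eq_inv', Matrix.smul_apply, smul_eq_mul]
  exact (hdet.inv hne).mul hadj

lemma analyticAt_christoffel {h : MetricField} (hh : ∀ i j, AnalyticAt ℝ (fun x => h x i j) 0)
    (h0 : h 0 = -1) (i j k : Fin 3) : AnalyticAt ℝ (christoffel h i j k) 0 := by
  unfold christoffel
  refine analyticAt_const.mul (Finset.univ.analyticAt_fun_sum fun l _ => ?_)
  exact (analyticAt_matrix_inv hh h0 i l).mul
    (((analyticAt_pd (hh l k)).add (analyticAt_pd (hh l j))).sub (analyticAt_pd (hh j k)))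

lemma analyticAt_ricci {h : MetricField} (hΓ : ∀ i j k, AnalyticAt ℝ (christoffel h i j k) 0)
    (i j : Fin 3) : AnalyticAt ℝ (ricci h i j) 0 := by
  unfold ricci
  refine Finset.univ.analyticAt_fun_sum fun k _ => ?_
  exact ((analyticAt_pd (hΓ k i j)).sub (analyticAt_pd (hΓ k i k))).add
    (Finset.univ.analyticAt_fun_sum fun l _ =>
      ((hΓ k k l).mul (hΓ l i j)).sub ((hΓ k j l).mul (hΓ l i k)))

lemma analyticAt_scalarCurv {h : MetricField} (hh : ∀ i j, AnalyticAt ℝ (fun x => h x i j) 0)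
    (h0 : h 0 = -1) : AnalyticAt ℝ (scalarCurv h) 0 := by
  unfold scalarCurv
  exact Finset.univ.analyticAt_fun_sum fun i _ => Finset.univ.analyticAt_fun_sum fun j _ =>
    (analyticAt_matrix_inv hh h0 i j).mul (analyticAt_ricci (analyticAt_christoffel hh h0) i j)

lemma analyticAt_tfRicci {h : MetricField} (hh : ∀ i j, AnalyticAt ℝ (fun x => h x i j) 0)
    (h0 : h 0 = -1) (i j : Fin 3) : AnalyticAt ℝ (tfRicci h i j) 0 := by
  unfold tfRicci
  exact (analyticAt_ricci (analyticAt_christoffel hh h0) i j).sub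
    ((analyticAt_const.mul (analyticAt_scalarCurv hh h0)).mul (hh i j))

/-! ### The frame at the origin -/

lemma SU2.det_eq (t : SU2) : t.1 0 0 * t.1 1 1 - t.1 0 1 * t.1 1 0 = 1 := by
  rw [← Matrix.det_fin_two]
  exact (Matrix.mem_specialUnitaryGroup_iff.1 t.2).2

/-- Both matrices are inverse to t. Comparing entries gives the rules for conjugation used below. -/
lemma SU2.star_eq_adjugate (t : SU2) : star t.1 = t.1.adjugate := by
  have h1 := Matrix.mem_unitaryGroup_iff'.1 (Matrix.mem_specialUnitaryGroup_iff.1 t.2).1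
  have h2 := (Matrix.mem_specialUnitaryGroup_iff.1 t.2).2
  have h3 : t.1 * t.1.adjugate = 1 := by rw [Matrix.mul_adjugate, h2, one_smul]
  calc star t.1 = star t.1 * (t.1 * t.1.adjugate) := by rw [h3, mul_one]
    _ = t.1.adjugate := by rw [← mul_assoc, h1, one_mul]

lemma SU2.conj_00 (t : SU2) : (starRingEnd ℂ) (t.1 0 0) = t.1 1 1 := by
  have := congrFun (congrFun (SU2.star_eq_adjugate t) 0) 0
  simpa [Matrix.adjugate_fin_two, Matrix.star_apply] using this

lemma SU2.conj_01 (t : SU2) : (starRingEnd ℂ) (t.1 0 1) = -t.1 1 0 := by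
  have := congrFun (congrFun (SU2.star_eq_adjugate t) 1) 0
  simpa [Matrix.adjugate_fin_two, Matrix.star_apply] using this

lemma SU2.conj_11 (t : SU2) : (starRingEnd ℂ) (t.1 1 1) = t.1 0 0 := by
  rw [← (SU2.conj_00 t), Complex.conj_conj]

lemma SU2.conj_10 (t : SU2) : (starRingEnd ℂ) (t.1 1 0) = -t.1 0 1 := by
  have := congrArg (starRingEnd ℂ) (SU2.conj_01 t)
  rw [Complex.conj_conj, map_neg] at this
  rw [this, neg_neg]

lemma sqrt_two_sq : (√2 : ℂ) ^ 2 = 2 := by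
  rw [← Complex.ofReal_pow, Real.sq_sqrt (by norm_num)]; simp

lemma sqrt_two_ne : (√2 : ℂ) ≠ 0 := by
  intro h; have := sqrt_two_sq; rw [h] at this; norm_num at this

/-- At the origin h is minus the Euclidean metric, hence the sign. The symbols σ contract to
products of ε, and ε is preserved by t because its determinant is 1. -/
lemma frame0_dot (t : SU2) (A B C D : Fin 2) :
    ∑ i, frame0 t A B i * frame0 t C D i = -hsp A B C D := by
  have hd := (SU2.det_eq t)
  have hs := sqrt_two_sq
  have hI := Complex.I_sq
  have hs' : ((√2 : ℂ)⁻¹) ^ 2 = 1 / 2 := by rw [inv_pow, hs]; norm_num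
  simp only [frame0, sigma, Fin.sum_univ_two, Fin.sum_univ_three]
  have key : ∀ a b c d a' b' c' d' : ℂ,
      -- the contraction of two Infeld-van der Waerden symbols
      (√2 : ℂ)⁻¹ * (-a + d) * ((√2 : ℂ)⁻¹ * (-a' + d'))
      + (√2 : ℂ)⁻¹ * (Complex.I * (a + d)) * ((√2 : ℂ)⁻¹ * (Complex.I * (a' + d')))
      + (√2 : ℂ)⁻¹ * (b + c) * ((√2 : ℂ)⁻¹ * (b' + c'))
      = (1 / 2) * (-2 * a * d' - 2 * d * a' + (b + c) * (b' + c')) := by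
    intro a b c d a' b' c' d'
    linear_combination (-2 * a * d' - 2 * d * a' + (b + c) * (b' + c')) * hs' +
      ((√2 : ℂ)⁻¹) ^ 2 * (a + d) * (a' + d') * hI
  have := key (t.1 0 A * t.1 0 B) (t.1 0 A * t.1 1 B) (t.1 1 A * t.1 0 B) (t.1 1 A * t.1 1 B)
    (t.1 0 C * t.1 0 D) (t.1 0 C * t.1 1 D) (t.1 1 C * t.1 0 D) (t.1 1 C * t.1 1 D)
  have e1 : -hsp A B C D = (1 / 2) * (-2 * (t.1 0 A * t.1 0 B) * (t.1 1 C * t.1 1 D)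
      - 2 * (t.1 1 A * t.1 1 B) * (t.1 0 C * t.1 0 D)
      + (t.1 0 A * t.1 1 B + t.1 1 A * t.1 0 B) * (t.1 0 C * t.1 1 D + t.1 1 C * t.1 0 D)) := by
    have hdA : ∀ A C, t.1 0 A * t.1 1 C - t.1 1 A * t.1 0 C = eps A C := by
      intro A C
      fin_cases A <;> fin_cases C <;> simp [eps]
      · ring
      · linear_combination hd
      · linear_combination -hd
      · ring
    simp only [hsp, ← hdA]
    ring
  rw [e1, ← this]
  simp
  ring

/-- Conjugation acts on the entries of t by `SU2.conj_00` and its companions, and these leave √2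
e_{01} fixed; so taking the real part in `radial` loses nothing. -/
lemma sqrt_two_mul_frame0 (t : SU2) (i : Fin 3) : √2 * frame0 t 0 1 i = (radial t i : ℂ) := by
  have hs := sqrt_two_ne
  have h : (starRingEnd ℂ) (√2 * frame0 t 0 1 i) = √2 * frame0 t 0 1 i := by
    simp only [frame0, sigma, Fin.sum_univ_two, map_mul, map_add, Complex.conj_ofReal, map_inv₀,
      (SU2.conj_00 t), (SU2.conj_01 t), (SU2.conj_10 t), (SU2.conj_11 t)]
    fin_cases i <;> simp <;> field_simp <;> ring
  rw [← Complex.conj_eq_iff_re.1 h]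
  simp [radial]

lemma sum_radial_sq (t : SU2) : ∑ i, radial t i * radial t i = 1 := by
  have h := frame0_dot t 0 1 0 1
  have h2 : ∑ i, ((radial t i : ℂ) * (radial t i : ℂ)) = 1 := by
    simp only [← sqrt_two_mul_frame0]
    have : ∀ i, (√2 * frame0 t 0 1 i) * (√2 * frame0 t 0 1 i)
        = 2 * (frame0 t 0 1 i * frame0 t 0 1 i) := fun i => by
      rw [← sqrt_two_sq]; ring
    simp only [this, ← Finset.mul_sum, h, hsp, eps]
    simp
  exact_mod_cast h2

lemma norm_radial (t : SU2) : ‖radial t‖ = 1 := by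
  rw [← sq_eq_sq₀ (norm_nonneg _) zero_le_one, EuclideanSpace.norm_sq_eq, one_pow,
    ← sum_radial_sq t]
  simp [sq]

/-- The dual form of `frame0_dot`: the Euclidean metric is e₃e₃ - e₀₀e₁₁ - e₁₁e₀₀. -/
lemma frame0_completeness (t : SU2) (i j : Fin 3) :
    frame0 t 0 0 i * frame0 t 1 1 j + frame0 t 0 0 j * frame0 t 1 1 i
      = (radial t i : ℂ) * (radial t j : ℂ) - (if i = j then 1 else 0) := by
  have hd := (SU2.det_eq t)
  have hs' : ((√2 : ℂ)⁻¹) ^ 2 = 1 / 2 := by rw [inv_pow, sqrt_two_sq]; norm_num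
  have hs := sqrt_two_sq
  have hne := sqrt_two_ne
  have hI := Complex.I_sq
  simp only [← sqrt_two_mul_frame0, frame0, sigma, Fin.sum_univ_two]
  -- The entries that are not polynomial identities differ by a multiple of (det t)² - 1 = (det t +
  -- 1)(det t - 1).
  fin_cases i <;> fin_cases j <;> simp <;> field_simp <;> simp only [hs, hI] <;> ring_nf <;>
    linear_combination 2 * (-1 - (t.1 0 0 * t.1 1 1 - t.1 0 1 * t.1 1 0)) * hd

lemma mem_specialUnitaryGroup_of_norm {a b : ℂ}
    (h : a * (starRingEnd ℂ) a + b * (starRingEnd ℂ) b = 1) :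
    !![a, b; -(starRingEnd ℂ) b, (starRingEnd ℂ) a] ∈ Matrix.specialUnitaryGroup (Fin 2) ℂ := by
  rw [Matrix.mem_specialUnitaryGroup_iff, Matrix.mem_unitaryGroup_iff]
  constructor
  · ext i j
    fin_cases i <;> fin_cases j <;>
      simp [Matrix.mul_apply, Fin.sum_univ_two, Matrix.star_apply]
    · exact h
    · ring
    · ring
    · linear_combination h
  · rw [Matrix.det_fin_two]; simp; linear_combination h

/-- This is the Hopf map: if (a, b) is the first row of t, then e₃(t) has third coordinate |a|² -
|b|², and its first two coordinates are encoded in -2ab. -/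
lemma radial_surjective {e : E3} (he : ‖e‖ = 1) : ∃ t : SU2, radial t = e := by
  have hsq : e 0 ^ 2 + e 1 ^ 2 + e 2 ^ 2 = 1 := by
    have := EuclideanSpace.norm_sq_eq e
    rw [he] at this
    simpa [Fin.sum_univ_three] using this.symm
  suffices h : ∃ a b : ℂ, a * (starRingEnd ℂ) a + b * (starRingEnd ℂ) b = 1 ∧
      a * b = -(e 0 + Complex.I * e 1) / 2 ∧
      a * (starRingEnd ℂ) a - b * (starRingEnd ℂ) b = e 2 by
    obtain ⟨a, b, h1, h2, h3⟩ := h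
    have h2' : (starRingEnd ℂ) a * (starRingEnd ℂ) b = -(e 0 - Complex.I * e 1) / 2 := by
      rw [← map_mul, h2]; simp [Complex.conj_ofNat]; ring
    refine ⟨⟨_, mem_specialUnitaryGroup_of_norm h1⟩, ?_⟩
    ext i
    have hne := sqrt_two_ne
    have hI := Complex.I_sq
    have : ((radial ⟨_, mem_specialUnitaryGroup_of_norm h1⟩ i : ℝ) : ℂ) = (e i : ℂ) := by
      rw [← sqrt_two_mul_frame0]
      simp only [frame0, sigma, Fin.sum_univ_two]
      fin_cases i <;> simp <;> field_simp
      · linear_combination -h2 - h2'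
      · linear_combination Complex.I * h2 - Complex.I * h2' - (e 1 : ℂ) * hI
      · linear_combination h3
    exact_mod_cast this
  -- Away from the south pole a can be chosen real and positive, which determines b; at the pole a =
  -- 0.
  by_cases hz : e 2 = -1
  · have h01 : e 0 = 0 ∧ e 1 = 0 := by
      rw [hz] at hsq
      constructor <;> nlinarith [sq_nonneg (e 0), sq_nonneg (e 1)]
    refine ⟨0, 1, by simp, by simp [h01.1, h01.2], by simp [hz]⟩
  · have hz' : 0 < (1 + e 2) / 2 := by
      have : -1 ≤ e 2 := by nlinarith [sq_nonneg (e 0), sq_nonneg (e 1)]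
      have := lt_of_le_of_ne this (Ne.symm hz)
      linarith
    set α := √((1 + e 2) / 2) with hα
    have hα2 : α ^ 2 = (1 + e 2) / 2 := Real.sq_sqrt hz'.le
    have hα0 : α ≠ 0 := (Real.sqrt_pos.2 hz').ne'
    have hαsq : (α : ℂ) ^ 2 = (1 + e 2) / 2 := by
      rw [← Complex.ofReal_pow, hα2]; simp
    have hα0' : (α : ℂ) ≠ 0 := by exact_mod_cast hα0
    have hsq' : (e 0 : ℂ) ^ 2 + (e 1 : ℂ) ^ 2 + (e 2 : ℂ) ^ 2 = 1 := by
      rw [← Complex.ofReal_one, ← hsq]; simp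
    have hI := Complex.I_sq
    set b : ℂ := -(e 0 + Complex.I * e 1) / (2 * α) with hb
    have hbb : b * (starRingEnd ℂ) b = (1 - e 2) / 2 := by
      have h4 : ((1 : ℂ) + e 2) ≠ 0 := by
        intro h; apply hα0'; rw [h] at hαsq; simpa using hαsq
      have : b * (starRingEnd ℂ) b = ((e 0 : ℂ) ^ 2 + (e 1 : ℂ) ^ 2) / (4 * α ^ 2) := by
        rw [hb]; simp [Complex.conj_ofNat]; field_simp; linear_combination -4 * (e 1 : ℂ) ^ 2 * hI
      rw [this, hαsq]
      field_simp
      linear_combination 4 * hsq'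
    refine ⟨α, b, ?_, ?_, ?_⟩
    · rw [hbb, Complex.conj_ofReal]; linear_combination hαsq
    · rw [hb]; field_simp
    · rw [hbb, Complex.conj_ofReal]; linear_combination hαsq

/-! ### Expansion of the conformal factor at the origin -/

section ConformalFactor

variable (U W Wb : E3 → ℝ)

/-- `U² - |x|² W²`. -/
def conjProd (x : E3) : ℝ := U x ^ 2 - ‖x‖ ^ 2 * W x ^ 2

/-- The analytic function `A` in `Ω = |x|² A + |x|³ B`. -/
def evenCoeff (x : E3) : ℝ := (U x ^ 2 + ‖x‖ ^ 2 * W x ^ 2) * (conjProd U W x ^ 2)⁻¹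

/-- The analytic function `B` in `Ω = |x|² A + |x|³ B`. -/
def oddCoeff (x : E3) : ℝ := -2 * U x * W x * (conjProd U W x ^ 2)⁻¹

variable {U W Wb}

lemma analyticAt_conjProd (hU : AnalyticAt ℝ U 0) (hW : AnalyticAt ℝ W 0) :
    AnalyticAt ℝ (conjProd U W) 0 :=
  (hU.pow 2).sub ((analyticAt_norm_sq 0).mul (hW.pow 2))

lemma conjProd_zero (hU0 : U 0 = 1) : conjProd U W 0 = 1 := by simp [conjProd, hU0]

lemma eventually_conjProd_ne (hU : AnalyticAt ℝ U 0) (hW : AnalyticAt ℝ W 0) (hU0 : U 0 = 1) :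
    ∀ᶠ x in 𝓝 (0 : E3), conjProd U W x ≠ 0 :=
  (analyticAt_conjProd hU hW).continuousAt.eventually_ne (by rw [conjProd_zero hU0]; norm_num)

lemma analyticAt_conjProd_inv (hU : AnalyticAt ℝ U 0) (hW : AnalyticAt ℝ W 0) (hU0 : U 0 = 1) :
    AnalyticAt ℝ (fun x => (conjProd U W x)⁻¹) 0 :=
  (analyticAt_conjProd hU hW).inv (by rw [conjProd_zero hU0]; norm_num)

lemma analyticAt_conjProd_sq_inv (hU : AnalyticAt ℝ U 0) (hW : AnalyticAt ℝ W 0) (hU0 : U 0 = 1) :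
    AnalyticAt ℝ (fun x => (conjProd U W x ^ 2)⁻¹) 0 :=
  ((analyticAt_conjProd hU hW).pow 2).inv (by simp [conjProd_zero hU0])

lemma analyticAt_evenCoeff (hU : AnalyticAt ℝ U 0) (hW : AnalyticAt ℝ W 0) (hU0 : U 0 = 1) :
    AnalyticAt ℝ (evenCoeff U W) 0 :=
  ((hU.pow 2).add ((analyticAt_norm_sq 0).mul (hW.pow 2))).mul
    (analyticAt_conjProd_sq_inv hU hW hU0)

lemma analyticAt_oddCoeff (hU : AnalyticAt ℝ U 0) (hW : AnalyticAt ℝ W 0) (hU0 : U 0 = 1) :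
    AnalyticAt ℝ (oddCoeff U W) 0 :=
  ((analyticAt_const.mul hU).mul hW).mul (analyticAt_conjProd_sq_inv hU hW hU0)

/-- Numerator and denominator of |x|²/(U + |x|W)² are multiplied by (U - |x|W)²; the new denominator
involves |x| only through |x|². -/
lemma conformalFactor_eq_of_conjProd_ne {x : E3} (hx : x ≠ 0) (h : conjProd U W x ≠ 0) :
    conformalFactor U W x = radPow 2 (evenCoeff U W) x + radPow 3 (oddCoeff U W) x := by
  have h0 : ‖x‖ ≠ 0 := norm_ne_zero_iff.2 hx
  have hf : conjProd U W x = (U x + ‖x‖ * W x) * (U x - ‖x‖ * W x) := by rw [conjProd]; ring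
  have h1 : U x + ‖x‖ * W x ≠ 0 := fun h' => h (by rw [hf, h', zero_mul])
  have h2 : U x - ‖x‖ * W x ≠ 0 := fun h' => h (by rw [hf, h', mul_zero])
  have h3 : theta U W x = (U x + ‖x‖ * W x) / ‖x‖ := by rw [theta]; field_simp
  rw [conformalFactor, h3, radPow, radPow, evenCoeff, oddCoeff, hf]
  field_simp
  ring

/-- The change of the conformal factor under `W ↦ W + Wb` is `-2 |x|³ Wb` to leading order. -/
lemma exists_conformalFactor_add (hU : AnalyticAt ℝ U 0) (hW : AnalyticAt ℝ W 0)
    (hWb : AnalyticAt ℝ Wb 0) (hU0 : U 0 = 1) :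
    ∃ R₁ R₂ : E3 → ℝ, AnalyticAt ℝ R₁ 0 ∧ AnalyticAt ℝ R₂ 0 ∧ R₁ 0 = 0 ∧
      ∀ᶠ x in 𝓝[≠] (0 : E3), conformalFactor U (W + Wb) x = conformalFactor U W x
        + (radPow 3 (fun y => -2 * Wb y) x + (radPow 3 (fun y => Wb y * R₁ y) x
          + radPow 4 (fun y => Wb y * R₂ y) x)) := by
  have hW' : AnalyticAt ℝ (W + Wb) 0 := hW.add hWb
  have hD := analyticAt_conjProd hU hW
  have hD' := analyticAt_conjProd hU hW'
  have hi := analyticAt_conjProd_inv hU hW hU0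
  have hi' := analyticAt_conjProd_inv hU hW' hU0
  have hn := analyticAt_norm_sq 0
  -- Let D and D' denote `conjProd` for W and W + Wb, so that D - D' = |x|²Wb(2W + Wb). Writing the
  -- even coefficient as 2U²/D² - 1/D, its change is |x|²Wb R₂, which gives the |x|⁴ term. The
  -- change of the odd coefficient is Wb times a function equal to -2 at the origin; R₁ is that
  -- function plus 2.
  refine ⟨fun x => 2 + -2 * U x * ((conjProd U (W + Wb) x)⁻¹ ^ 2 + W x * ‖x‖ ^ 2 *
      (2 * W x + Wb x) * (conjProd U W x + conjProd U (W + Wb) x) *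
      ((conjProd U W x)⁻¹ ^ 2 * (conjProd U (W + Wb) x)⁻¹ ^ 2)),
    fun x => (2 * W x + Wb x) * (2 * U x ^ 2 * (conjProd U W x + conjProd U (W + Wb) x) *
      ((conjProd U W x)⁻¹ ^ 2 * (conjProd U (W + Wb) x)⁻¹ ^ 2)
      - (conjProd U W x)⁻¹ * (conjProd U (W + Wb) x)⁻¹), by fun_prop, by fun_prop,
      by simp [conjProd_zero hU0, hU0], ?_⟩
  filter_upwards [(eventually_conjProd_ne hU hW hU0).filter_mono nhdsWithin_le_nhds,
    (eventually_conjProd_ne hU hW' hU0).filter_mono nhdsWithin_le_nhds, self_mem_nhdsWithin]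
    with x h1 h2 h3
  rw [conformalFactor_eq_of_conjProd_ne h3 h1, conformalFactor_eq_of_conjProd_ne h3 h2]
  simp only [radPow, evenCoeff, oddCoeff, Pi.add_apply]
  field_simp
  simp only [conjProd, Pi.add_apply]
  ring

end ConformalFactor

/-! ### Frame components on a ray -/

section Ray

variable {a : ℝ} {h : MetricField} {P : E3 → Matrix (Fin 3) (Fin 3) ℝ}

lemma contDiffAt_frame (ha : 0 < a) (hP : IsRadialTransport a h P) (t : SU2) (A B : Fin 2)
    (i : Fin 3) : ContDiffAt ℝ ∞ (fun ρ => frame P ρ t A B i) 0 := by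
  unfold frame
  refine ContDiffAt.sum fun j _ => ContDiffAt.mul ?_ contDiffAt_const
  have h0 : (0 : ℝ) • radial t = 0 := zero_smul _ _
  have h1 : ContDiffAt ℝ ∞ (fun x => P x i j) ((0 : ℝ) • radial t) := by
    rw [h0]
    exact (hP.smooth i j).contDiffAt (Metric.ball_mem_nhds _ ha)
  have h2 : ContDiffAt ℝ ∞ (fun ρ : ℝ => ρ • radial t) 0 := by fun_prop
  exact Complex.ofRealCLM.contDiff.contDiffAt.comp 0
    (h1.comp (f := fun ρ : ℝ => ρ • radial t) 0 h2)

lemma frame_zero (hP : IsRadialTransport a h P) (t : SU2) (A B : Fin 2) (i : Fin 3) :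
    frame P 0 t A B i = frame0 t A B i := by
  simp [frame, proj, hP.zero, Matrix.one_apply, apply_ite Complex.ofReal]

/-- The symmetrised frame components of a 2-tensor given on the ray. -/
def raySpin (c : Fin 2 → Fin 2 → Fin 3 → ℝ → ℂ) (M : Fin 3 → Fin 3 → ℝ → ℝ) (ρ : ℝ) :
    Fin 2 → Fin 2 → Fin 2 → Fin 2 → ℂ :=
  symm4 fun A B C D => ∑ i, ∑ j, (M i j ρ : ℂ) * c A B i ρ * c C D j ρ

variable {c : Fin 2 → Fin 2 → Fin 3 → ℝ → ℂ}

/-- The scalar s is kept separate from the parameter ρ, so that the lemma serves both for the factor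
ρ (after freezing it) and for the constant 2. -/
lemma raySpin_add_mul (M E : Fin 3 → Fin 3 → ℝ → ℝ) (ρ s : ℝ) (A B C D : Fin 2) :
    raySpin c (fun i j ρ => M i j ρ + s * E i j ρ) ρ A B C D
      = raySpin c M ρ A B C D + s * raySpin c E ρ A B C D := by
  simp only [raySpin, symm4, Complex.ofReal_add, Complex.ofReal_mul, add_mul,
    Finset.sum_add_distrib, mul_add, Finset.mul_sum]
  simp only [mul_assoc, mul_left_comm (s : ℂ)]
  ring

lemma raySpin_congr {M M' : Fin 3 → Fin 3 → ℝ → ℝ} {ρ : ℝ} (hM : ∀ i j, M i j ρ = M' i j ρ) :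
    raySpin c M ρ = raySpin c M' ρ := by
  simp only [raySpin, hM]

lemma raySpin_vanishesTo (hc : ∀ A B i, ContDiffAt ℝ ∞ (c A B i) 0) {M : Fin 3 → Fin 3 → ℝ → ℝ}
    {k : ℕ} (hM : ∀ i j, VanishesTo k (M i j)) (A B C D : Fin 2) :
    VanishesTo k (fun ρ => raySpin c M ρ A B C D) := by
  have h1 : ∀ A B C D, VanishesTo k
      (fun ρ => ∑ i, ∑ j, (M i j ρ : ℂ) * c A B i ρ * c C D j ρ) := fun A B C D =>
    VanishesTo.sum _ fun i _ => VanishesTo.sum _ fun j _ =>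
      ((hM i j).ofReal.mul_smooth (hc A B i)).mul_smooth (hc C D j)
  exact (((h1 A B C D).add (h1 A C B D)).add (h1 A D B C)).const_mul (1 / 3)

/-- Replacing the frame by its value at the origin does not change the leading order. -/
lemma raySpin_sub_frozen_vanishesTo (hc : ∀ A B i, ContDiffAt ℝ ∞ (c A B i) 0)
    {M : Fin 3 → Fin 3 → ℝ → ℝ} {k : ℕ} (hM : ∀ i j, VanishesTo k (M i j)) (A B C D : Fin 2) :
    VanishesTo (k + 1) (fun ρ => raySpin c M ρ A B C D
      - raySpin (fun A B i _ => c A B i 0) M ρ A B C D) := by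
  have h1 : ∀ A B C D, VanishesTo (k + 1)
      (fun ρ => ∑ i, ∑ j, (M i j ρ : ℂ) * (c A B i ρ * c C D j ρ - c A B i 0 * c C D j 0)) :=
    fun A B C D => VanishesTo.sum _ fun i _ => VanishesTo.sum _ fun j _ =>
      (hM i j).ofReal.mul (VanishesTo.of_apply_zero
        (((hc A B i).mul (hc C D j)).sub contDiffAt_const) (by simp))
  refine ((((h1 A B C D).add (h1 A C B D)).add (h1 A D B C)).const_mul (1 / 3)).congr
    (Eventually.of_forall fun ρ => ?_)
  simp only [raySpin, symm4, mul_sub, Finset.sum_sub_distrib, ← mul_assoc]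
  ring

/-- A multiple of the metric becomes a multiple of h_{ABCD}, which is built from ε and so has
vanishing total symmetrisation. -/
lemma raySpin_frame0_delta (t : SU2) {M : Fin 3 → Fin 3 → ℝ → ℝ} {ρ m : ℝ}
    (hM : ∀ i j, M i j ρ = if i = j then m else 0) (A B C D : Fin 2) :
    raySpin (fun A B i _ => frame0 t A B i) M ρ A B C D = 0 := by
  have h1 : ∀ A B C D, ∑ i, ∑ j, (M i j ρ : ℂ) * frame0 t A B i * frame0 t C D j
      = m * -hsp A B C D := by
    intro A B C D
    rw [← frame0_dot t, Finset.mul_sum]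
    refine Finset.sum_congr rfl fun i _ => ?_
    simp [hM, apply_ite Complex.ofReal, mul_assoc]
  simp only [raySpin, symm4, h1, hsp]
  fin_cases A <;> fin_cases B <;> fin_cases C <;> fin_cases D <;> simp [eps] <;> ring

/-- The radial component of a symmetric tensor. -/
lemma raySpin_frame0_radial (t : SU2) {M : Fin 3 → Fin 3 → ℝ → ℝ} {ρ : ℝ}
    (hM : ∀ i j, M i j ρ = M j i ρ) :
    raySpin (fun A B i _ => frame0 t A B i) M ρ 0 0 1 1
      = (((1 / 2) * ∑ i, ∑ j, M i j ρ * radial t i * radial t j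
        - (1 / 6) * ∑ i, M i i ρ : ℝ) : ℂ) := by
  have h01 : ∀ i j, frame0 t 0 1 i * frame0 t 0 1 j = (1 / 2) * (radial t i * radial t j) := by
    intro i j
    rw [← sqrt_two_mul_frame0, ← sqrt_two_mul_frame0]
    linear_combination -(1 / 2) * frame0 t 0 1 i * frame0 t 0 1 j * sqrt_two_sq
  have h00 := frame0_completeness t
  -- The symmetrisation is (M(e₀₀, e₁₁) + 2M(e₀₁, e₀₁))/3. By completeness M(e₀₀, e₁₁) = (M(e₃, e₃)
  -- - tr M)/2, while M(e₀₁, e₀₁) = M(e₃, e₃)/2.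
  simp only [raySpin, symm4, Fin.sum_univ_three]
  have e1 := hM 0 1
  have e2 := hM 0 2
  have e3 := hM 1 2
  simp only [← e1, ← e2, ← e3, mul_assoc, h01]
  push_cast
  have f00 := h00 0 0
  have f01 := h00 0 1
  have f02 := h00 0 2
  have f11 := h00 1 1
  have f12 := h00 1 2
  have f22 := h00 2 2
  simp only [if_true] at f00 f11 f22
  rw [if_neg (by decide)] at f01 f02 f12
  linear_combination (1 / 6) * (M 0 0 ρ : ℂ) * f00 + (1 / 6) * (M 1 1 ρ : ℂ) * f11
    + (1 / 6) * (M 2 2 ρ : ℂ) * f22 + (1 / 3) * (M 0 1 ρ : ℂ) * f01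
    + (1 / 3) * (M 0 2 ρ : ℂ) * f02 + (1 / 3) * (M 1 2 ρ : ℂ) * f12

end Ray

/-! ### The data on a ray -/

section Data

variable {h : MetricField} {P : E3 → Matrix (Fin 3) (Fin 3) ℝ} {Ω : E3 → ℝ} {t : SU2}
  {V : ℝ → ℝ} {g : Fin 3 → ℝ → ℝ} {M : Fin 3 → Fin 3 → ℝ → ℝ}

/-- The frame on the ray `t`. -/
def rayFrame (P : E3 → Matrix (Fin 3) (Fin 3) ℝ) (t : SU2) (A B : Fin 2) (i : Fin 3) (ρ : ℝ) : ℂ :=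
  frame P ρ t A B i

/-- `h^{ij} g_i g_j` on the ray in the direction `e`. -/
def rayNormSq (h : MetricField) (e : E3) (g : Fin 3 → ℝ → ℝ) (ρ : ℝ) : ℝ :=
  ∑ i, ∑ j, (h (ρ • e))⁻¹ i j * g i ρ * g j ρ

/-- The spinor indices of the `j`-th component of a symmetric spinor. -/
def quadIdx (j : Fin 5) : Fin 2 × Fin 2 × Fin 2 × Fin 2 :=
  (if 4 ≤ j.val then 1 else 0, if 3 ≤ j.val then 1 else 0,
    if 2 ≤ j.val then 1 else 0, if 1 ≤ j.val then 1 else 0)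

/-- `Ω = ρ² V⁻²` on the ray `t`, with gradient `ρ g` and covariant Hessian `M`. -/
structure IsRayFactor (h : MetricField) (t : SU2) (Ω : E3 → ℝ) (V : ℝ → ℝ) (g : Fin 3 → ℝ → ℝ)
    (M : Fin 3 → Fin 3 → ℝ → ℝ) : Prop where
  eq : ∀ᶠ ρ in 𝓝[>] (0 : ℝ), Ω (ρ • radial t) = ρ ^ 2 / V ρ ^ 2
  V_smooth : ContDiffAt ℝ ∞ V 0
  V_zero : V 0 = 1
  g_smooth : ∀ i, ContDiffAt ℝ ∞ (g i) 0
  g_zero : ∀ i, g i 0 = 2 * radial t i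
  M_smooth : ∀ i j, ContDiffAt ℝ ∞ (M i j) 0
  exp : HasRayExpansion h (radial t) Ω g M

namespace IsRayFactor

lemma V_ne (hΩ : IsRayFactor h t Ω V g M) : ∀ᶠ ρ in 𝓝[>] (0 : ℝ), V ρ ≠ 0 :=
  (hΩ.V_smooth.continuousAt.eventually_ne (by rw [hΩ.V_zero]; norm_num)).filter_mono
    nhdsWithin_le_nhds

lemma comp2_hess (hΩ : IsRayFactor h t Ω V g M) : ∀ᶠ ρ in 𝓝[>] (0 : ℝ),
    symm4 (comp2 P (hess h Ω) ρ t) = raySpin (rayFrame P t) M ρ := by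
  filter_upwards [hΩ.exp.hess] with ρ hρ
  simp only [raySpin, ← hρ]
  rfl

/-- Since Ω = ρ²/V², the weight ρ³/Ω² equals V⁴/ρ. The factor 1/ρ is displayed in front of a smooth
profile; it is what makes φ lose one order against Θ_{ABCD}. -/
lemma phiData_eq (hΩ : IsRayFactor h t Ω V g M) (j : Fin 5) : ∀ᶠ ρ in 𝓝[>] (0 : ℝ),
    phiData h P Ω ρ t j = ((ρ⁻¹ : ℝ) : ℂ) * ((V ρ : ℂ) ^ 4 *
        raySpin (rayFrame P t) M ρ (quadIdx j).1 (quadIdx j).2.1 (quadIdx j).2.2.1 (quadIdx j).2.2.2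
      + (ρ : ℂ) ^ 2 * (V ρ : ℂ) ^ 2 * raySpin (rayFrame P t)
        (fun i j ρ => tfRicci h i j (ρ • radial t)) ρ
        (quadIdx j).1 (quadIdx j).2.1 (quadIdx j).2.2.1 (quadIdx j).2.2.2) := by
  filter_upwards [hΩ.comp2_hess (P := P), hΩ.eq, hΩ.V_ne, self_mem_nhdsWithin] with ρ h1 h2 h3 h4
  have h5 : (ρ : ℂ) ≠ 0 := by exact_mod_cast (ne_of_gt h4)
  have h6 : (V ρ : ℂ) ≠ 0 := by exact_mod_cast h3
  have h7 : symm4 (comp2 P (tfRicci h) ρ t) = raySpin (rayFrame P t)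
    (fun i j ρ => tfRicci h i j (ρ • radial t)) ρ := rfl
  simp only [phiData, h1, h7, proj, h2, quadIdx]
  push_cast
  field_simp

lemma thData_eq (hΩ : IsRayFactor h t Ω V g M) (i j : Fin 3) : ∀ᶠ ρ in 𝓝[>] (0 : ℝ),
    upsData h P Ω ρ t (.Th i j) = -((V ρ : ℂ) ^ 2 *
        raySpin (rayFrame P t) M ρ (fst i) (snd i) (fst j) (snd j))
      + (1 / 12) * (ρ : ℂ) ^ 2 * (scalarCurv h (ρ • radial t) : ℂ) *
          hsp (fst i) (snd i) (fst j) (snd j) := by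
  filter_upwards [hΩ.comp2_hess (P := P), hΩ.eq, hΩ.V_ne, self_mem_nhdsWithin] with ρ h1 h2 h3 h4
  have h5 : (ρ : ℂ) ≠ 0 := by exact_mod_cast (ne_of_gt h4)
  have h6 : (V ρ : ℂ) ≠ 0 := by exact_mod_cast h3
  simp only [upsData, h1, proj, h2]
  push_cast
  field_simp

lemma dForm_eq (hΩ : IsRayFactor h t Ω V g M) (j : Fin 3) : ∀ᶠ ρ in 𝓝[>] (0 : ℝ),
    dForm P Ω ρ t j = (ρ : ℂ) * ∑ i, (g i ρ : ℂ) * rayFrame P t (fst j) (snd j) i ρ := by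
  filter_upwards [hΩ.exp.grad] with ρ h1
  simp only [dForm, comp1, proj, h1, Finset.mul_sum, rayFrame]
  refine Finset.sum_congr rfl fun i _ => ?_
  push_cast
  ring

lemma rayNormSq_smooth (hΩ : IsRayFactor h t Ω V g M)
    (hh : ∀ i j, AnalyticAt ℝ (fun x => h x i j) 0) (h0 : h 0 = -1) :
    ContDiffAt ℝ ∞ (rayNormSq h (radial t) g) 0 := by
  unfold rayNormSq
  exact ContDiffAt.sum fun i _ => ContDiffAt.sum fun j _ =>
    ((contDiffAt_line (analyticAt_matrix_inv hh h0 i j) _).mul (hΩ.g_smooth i)).mul (hΩ.g_smooth j)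

lemma rayNormSq_zero (hΩ : IsRayFactor h t Ω V g M) (h0 : h 0 = -1) :
    rayNormSq h (radial t) g 0 = -4 := by
  have h1 : (-1 : Matrix (Fin 3) (Fin 3) ℝ)⁻¹ = -1 := Matrix.inv_eq_left_inv (by simp)
  have h2 : ∀ i j : Fin 3, (-1 : Matrix (Fin 3) (Fin 3) ℝ) i j = if i = j then -1 else 0 := by
    intro i j; simp only [Matrix.neg_apply, Matrix.one_apply]; split_ifs <;> simp
  have h3 := sum_radial_sq t
  simp only [rayNormSq, zero_smul, h0, h1, hΩ.g_zero, h2, ite_mul, zero_mul,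
    Finset.sum_ite_eq, Finset.mem_univ, if_true]
  rw [show (-4 : ℝ) = -4 * ∑ i, radial t i * radial t i by rw [h3]; ring, Finset.mul_sum]
  exact Finset.sum_congr rfl fun i _ => by ring

/-- The square root in ω enters only squared, and the absolute value resolves because h^{ij}g_i g_j
equals -4 at ρ = 0, hence is negative nearby. So Θ is a quadratic polynomial in τ with coefficients
smooth in ρ, on an interval of ρ that does not depend on τ; hence ∂_τ can be computed from the same
formula. -/
lemma Theta_eq (hΩ : IsRayFactor h t Ω V g M)
    (hh : ∀ i j, AnalyticAt ℝ (fun x => h x i j) 0) (h0 : h 0 = -1) :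
    ∀ᶠ ρ in 𝓝[>] (0 : ℝ), ∀ τ, Theta h Ω τ ρ t
      = ρ * (V ρ ^ 2)⁻¹ + ρ * (V ρ ^ 2 * rayNormSq h (radial t) g ρ / 4) * τ ^ 2 := by
  have hneg : ∀ᶠ ρ in 𝓝[>] (0 : ℝ), rayNormSq h (radial t) g ρ < 0 :=
    ((hΩ.rayNormSq_smooth hh h0).continuousAt.eventually_lt continuousAt_const
      (by rw [hΩ.rayNormSq_zero h0]; norm_num)).filter_mono nhdsWithin_le_nhds
  filter_upwards [hΩ.exp.grad, hΩ.eq, hΩ.V_ne, self_mem_nhdsWithin, hneg] with ρ h1 h2 h3 h4 h5 τ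
  have hρ : ρ ≠ 0 := ne_of_gt h4
  have hq : ∑ i, ∑ j, (h (ρ • radial t))⁻¹ i j * pd i Ω (ρ • radial t) * pd j Ω (ρ • radial t)
      = ρ ^ 2 * rayNormSq h (radial t) g ρ := by
    simp only [h1, rayNormSq, Finset.mul_sum]
    exact Finset.sum_congr rfl fun i _ => Finset.sum_congr rfl fun j _ => by ring
  have habs : |ρ ^ 2 * rayNormSq h (radial t) g ρ| = -(ρ ^ 2 * rayNormSq h (radial t) g ρ) :=
    abs_of_neg (mul_neg_of_pos_of_neg (by positivity) h5)
  have hsq : √(-(ρ ^ 2 * rayNormSq h (radial t) g ρ)) ^ 2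
      = -(ρ ^ 2 * rayNormSq h (radial t) g ρ) := Real.sq_sqrt (by
        have := mul_neg_of_pos_of_neg (show 0 < ρ ^ 2 by positivity) h5
        linarith)
  have hs0 : rayNormSq h (radial t) g ρ ≠ 0 := h5.ne
  rw [Theta, omega, proj, hq, habs, div_pow, hsq, h2]
  field_simp
  ring

lemma deriv_Theta_eq (hΩ : IsRayFactor h t Ω V g M)
    (hh : ∀ i j, AnalyticAt ℝ (fun x => h x i j) 0) (h0 : h 0 = -1) :
    ∀ᶠ ρ in 𝓝[>] (0 : ℝ), ∀ τ, deriv (fun s => (Theta h Ω s ρ t : ℂ)) τ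
      = ((ρ * (V ρ ^ 2 * rayNormSq h (radial t) g ρ / 4) * (2 * τ) : ℝ) : ℂ) := by
  filter_upwards [hΩ.Theta_eq hh h0] with ρ hρ τ
  simp only [hρ]
  have h1 : HasDerivAt (fun s : ℝ => ρ * (V ρ ^ 2)⁻¹ +
      ρ * (V ρ ^ 2 * rayNormSq h (radial t) g ρ / 4) * s ^ 2)
      (ρ * (V ρ ^ 2 * rayNormSq h (radial t) g ρ / 4) * (2 * τ)) τ := by
    have := ((hasDerivAt_pow 2 τ).const_mul
      (ρ * (V ρ ^ 2 * rayNormSq h (radial t) g ρ / 4))).const_add (ρ * (V ρ ^ 2)⁻¹)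
    simpa using this
  exact h1.ofReal_comp.deriv

end IsRayFactor

end Data

/-! ### Comparison of the data on a ray -/

section Compare

variable {p₀ : ℕ} {a : ℝ} {h : MetricField} {U W Wb : E3 → ℝ}

lemma IsStaticData.metric_analytic (hd : IsStaticData a h U W) (i j : Fin 3) :
    AnalyticAt ℝ (fun x => h x i j) 0 := hd.h_analytic i j 0 (Metric.mem_ball_self hd.a_pos)

lemma IsStaticData.metric_zero (hd : IsStaticData a h U W) : h 0 = -1 := hd.normal.1

lemma IsStaticData.christoffel_analytic (hd : IsStaticData a h U W) (i j k : Fin 3) :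
    AnalyticAt ℝ (christoffel h i j k) 0 :=
  analyticAt_christoffel hd.metric_analytic hd.metric_zero i j k

lemma IsStaticData.analyticAt_U (hd : IsStaticData a h U W) : AnalyticAt ℝ U 0 :=
  hd.U_analytic 0 (Metric.mem_ball_self hd.a_pos)

lemma IsStaticData.analyticAt_W (hd : IsStaticData a h U W) : AnalyticAt ℝ W 0 :=
  hd.W_analytic 0 (Metric.mem_ball_self hd.a_pos)

lemma IsStaticUpToOrder.ordGE (hd : IsStaticUpToOrder p₀ a h U W Wb) : OrdGE (p₀ + 1) Wb :=
  ⟨hd.Wb_analytic 0 (Metric.mem_ball_self hd.static.a_pos), fun j hj =>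
    hd.Wb_order j (Nat.lt_succ_iff.1 hj)⟩

lemma conformalFactor_ray (U W : E3 → ℝ) {e : E3} (he : ‖e‖ = 1) {ρ : ℝ} (hρ : 0 < ρ) :
    conformalFactor U W (ρ • e) = ρ ^ 2 / (U (ρ • e) + ρ * W (ρ • e)) ^ 2 := by
  have hn : ‖ρ • e‖ = ρ := by rw [norm_smul, he, mul_one, Real.norm_of_nonneg hρ.le]
  have h3 : theta U W (ρ • e) = (U (ρ • e) + ρ * W (ρ • e)) / ρ := by
    rw [theta, hn]; field_simp
  rw [conformalFactor, h3, div_pow, inv_div]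

lemma rayHess_const_mul (e : E3) (k : ℕ) (c : ℝ) {A : E3 → ℝ} (hA : AnalyticAt ℝ A 0)
    (i j : Fin 3) : ∀ᶠ ρ in 𝓝 (0 : ℝ),
      rayHess e k (fun y => c * A y) i j ρ = c * rayHess e k A i j ρ := by
  have hc : Tendsto (fun ρ : ℝ => ρ • e) (𝓝 0) (𝓝 (0 : E3)) := by
    have : Continuous fun ρ : ℝ => ρ • e := by fun_prop
    simpa using this.tendsto 0
  filter_upwards [hc.eventually hA.eventually_analyticAt] with ρ hρ
  have h1 : ∀ l, pd l (fun y => c * A y) (ρ • e) = c * pd l A (ρ • e) := fun l =>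
    pd_const_mul c hρ.differentiableAt
  have h2 : pd j (fun y => c * A y) =ᶠ[𝓝 (ρ • e)] fun y => c * pd j A y := by
    filter_upwards [hρ.eventually_analyticAt] with y hy using pd_const_mul c hy.differentiableAt
  rw [rayHess, rayHess, h1, h1, pd_congr h2,
    pd_const_mul c (analyticAt_pd hρ).differentiableAt]
  ring

/-- In the perturbation of Ω, the term |x|³(-2Wb) contributes rays of order p₀ + 1 after the factor
ρ is split off. The term |x|³Wb R₁ is one order higher because R₁(0) = 0, and |x|⁴Wb R₂ because of
its additional power of |x|. Christoffel terms also carry an additional ρ. Hence to leading order E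
is -2 times the flat Hessian profile of |x|³Wb. The value of M at 0 is that of the Hessian of |x|².
-/
lemma exists_rayFactors (hd : IsStaticUpToOrder p₀ a h U W Wb) (t : SU2) :
    ∃ (V : ℝ → ℝ) (g ε : Fin 3 → ℝ → ℝ) (M E : Fin 3 → Fin 3 → ℝ → ℝ),
      IsRayFactor h t (conformalFactor U W) V g M ∧
      IsRayFactor h t (conformalFactor U (W + Wb)) (fun ρ => V ρ + ρ * Wb (ρ • radial t))
        (fun i ρ => g i ρ + ρ * ε i ρ) (fun i j ρ => M i j ρ + ρ * E i j ρ) ∧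
      (∀ i, VanishesTo (p₀ + 1) (ε i)) ∧ (∀ i j, VanishesTo (p₀ + 1) (E i j)) ∧
      (∀ i j, VanishesTo (p₀ + 2) (fun ρ => E i j ρ + 2 * rayHess (radial t) 1 Wb i j ρ)) ∧
      ∀ i j, M i j 0 = if i = j then 2 else 0 := by
  have he := norm_radial t
  set e := radial t with hedef
  have hU := hd.static.analyticAt_U
  have hW := hd.static.analyticAt_W
  have hU0 := hd.static.U_zero
  have hΓ := hd.static.christoffel_analytic
  have hWb := hd.ordGE
  have hA := analyticAt_evenCoeff hU hW hU0
  have hB := analyticAt_oddCoeff hU hW hU0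
  have hA0 : evenCoeff U W 0 = 1 := by simp [evenCoeff, conjProd_zero hU0, hU0]
  obtain ⟨R₁, R₂, hR₁, hR₂, hR0, hR⟩ := exists_conformalFactor_add hU hW hWb.1 hU0
  have o1 : OrdGE (p₀ + 1) (fun y => -2 * Wb y) := OrdGE.analytic_mul analyticAt_const hWb
  have o2 : OrdGE (p₀ + 2) (fun y => Wb y * R₁ y) := hWb.mul (OrdGE.of_apply_zero hR₁ hR0)
  have o3 : OrdGE (p₀ + 1) (fun y => Wb y * R₂ y) := hWb.mul_analytic hR₂
  have x1 := (HasRayExpansion.radPow (h := h) he 0 hA).add he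
    (HasRayExpansion.radPow (h := h) he 1 hB)
  have x2 : HasRayExpansion h e (conformalFactor U W) _ _ := x1.congr he (by
    filter_upwards [(eventually_conjProd_ne hU hW hU0).filter_mono nhdsWithin_le_nhds,
      self_mem_nhdsWithin] with x h1 h2 using conformalFactor_eq_of_conjProd_ne h2 h1)
  have x3 := (HasRayExpansion.radPow (h := h) he 1 o1.1).add he
    ((HasRayExpansion.radPow (h := h) he 1 o2.1).add he
      (HasRayExpansion.radPow (h := h) he 2 o3.1))
  have x4 : HasRayExpansion h e (conformalFactor U (W + Wb)) _ _ := (x2.add he x3).congr he hR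
  have sG : ∀ k {A : E3 → ℝ}, AnalyticAt ℝ A 0 → ∀ i, ContDiffAt ℝ ∞ (rayGrad e k A i) 0 :=
    fun k A hA i => (rayGrad_vanishesTo e k (OrdGE.of_analytic hA) i).1
  have sH : ∀ k {A : E3 → ℝ}, AnalyticAt ℝ A 0 → ∀ i j, ContDiffAt ℝ ∞ (rayCovHess h e k A i j) 0 :=
    fun k A hA i j => (rayCovHess_vanishesTo hΓ e k (OrdGE.of_analytic hA) i j).1
  have vε : ∀ i, VanishesTo (p₀ + 1) (fun ρ => rayGrad e 1 (fun y => -2 * Wb y) i ρ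
      + (rayGrad e 1 (fun y => Wb y * R₁ y) i ρ + ρ * rayGrad e 2 (fun y => Wb y * R₂ y) i ρ)) :=
    fun i => (rayGrad_vanishesTo e 1 o1 i).add (((rayGrad_vanishesTo e 1 o2 i).mono (by omega)).add
      (VanishesTo.smooth_mul contDiffAt_id (rayGrad_vanishesTo e 2 o3 i)))
  have v2 : ∀ i j, VanishesTo (p₀ + 2) (fun ρ => rayCovHess h e 1 (fun y => Wb y * R₁ y) i j ρ
      + ρ * rayCovHess h e 2 (fun y => Wb y * R₂ y) i j ρ) := fun i j =>
    (rayCovHess_vanishesTo hΓ e 1 o2 i j).add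
      ((VanishesTo.rho.mul (rayCovHess_vanishesTo hΓ e 2 o3 i j)).mono (by omega))
  have v3 : ∀ i j, VanishesTo (p₀ + 2)
      (fun ρ => ρ * ∑ l, christoffel h l i j (ρ • e) * rayGrad e 1 (fun y => -2 * Wb y) l ρ) :=
    fun i j => (VanishesTo.rho.mul (VanishesTo.sum _ fun l _ =>
      VanishesTo.smooth_mul (contDiffAt_line (hΓ l i j) e)
        (rayGrad_vanishesTo e 1 o1 l))).mono (by omega)
  have vE : ∀ i j, VanishesTo (p₀ + 1) (fun ρ => rayCovHess h e 1 (fun y => -2 * Wb y) i j ρ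
      + (rayCovHess h e 1 (fun y => Wb y * R₁ y) i j ρ
        + ρ * rayCovHess h e 2 (fun y => Wb y * R₂ y) i j ρ)) := fun i j =>
    (rayCovHess_vanishesTo hΓ e 1 o1 i j).add ((v2 i j).mono (by omega))
  have sV : ContDiffAt ℝ ∞ (fun ρ : ℝ => U (ρ • e) + ρ * W (ρ • e)) 0 :=
    (contDiffAt_line hU e).add (contDiffAt_id.mul (contDiffAt_line hW e))
  -- The profiles g, M and ε, E are fixed by unification with `x2`, `vε` and `vE`.
  refine ⟨fun ρ => U (ρ • e) + ρ * W (ρ • e), _, _, _, _, ⟨?_, sV, ?_, ?_, ?_, ?_, x2⟩,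
    ⟨?_, ?_, ?_, ?_, ?_, ?_, ?_⟩, vε, vE, ?_, ?_⟩
  · filter_upwards [self_mem_nhdsWithin] with ρ hρ using conformalFactor_ray U W he hρ
  · simp [hU0]
  · exact fun i => ((contDiffAt_id.pow 0).mul (sG 0 hA i)).add ((contDiffAt_id.pow 1).mul (sG 1 hB i))
  · intro i; simp [rayGrad, hA0, ← hedef]
  · exact fun i j => ((contDiffAt_id.pow 0).mul (sH 0 hA i j)).add
      ((contDiffAt_id.pow 1).mul (sH 1 hB i j))
  · filter_upwards [self_mem_nhdsWithin] with ρ hρ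
    rw [conformalFactor_ray U (W + Wb) he hρ]
    simp only [Pi.add_apply]
    ring
  · exact sV.add (contDiffAt_id.mul (contDiffAt_line hWb.1 e))
  · simp [hU0]
  · exact fun i => (((contDiffAt_id.pow 0).mul (sG 0 hA i)).add
      ((contDiffAt_id.pow 1).mul (sG 1 hB i))).add (contDiffAt_id.mul (vε i).1)
  · intro i; simp [rayGrad, hA0, ← hedef]
  · exact fun i j => (((contDiffAt_id.pow 0).mul (sH 0 hA i j)).add
      ((contDiffAt_id.pow 1).mul (sH 1 hB i j))).add (contDiffAt_id.mul (vE i j).1)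
  · convert x4 using 1
    · funext i ρ; ring
    · funext i j ρ; ring
  · intro i j
    refine ((v2 i j).sub (v3 i j)).congr ?_
    filter_upwards [rayHess_const_mul e 1 (-2) hWb.1 i j] with ρ hρ
    rw [rayCovHess, hρ]
    ring
  · intro i j
    simp [rayCovHess, rayHess, hA0]

end Compare

namespace VanishesTo

variable {𝔸 : Type*} [NormedCommRing 𝔸] [NormedAlgebra ℝ 𝔸] {k : ℕ} {f f' g g' : ℝ → 𝔸}

lemma mul_sub_mul (hf : VanishesTo k (fun ρ => f' ρ - f ρ)) (hg : VanishesTo k (fun ρ => g' ρ - g ρ))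
    (sf : ContDiffAt ℝ ∞ f 0) (sg : ContDiffAt ℝ ∞ g' 0) :
    VanishesTo k (fun ρ => f' ρ * g' ρ - f ρ * g ρ) :=
  ((hf.mul_smooth sg).add (smooth_mul sf hg)).congr (Eventually.of_forall fun ρ => by ring)

lemma inv_sub_inv {f f' : ℝ → ℝ} (hf : VanishesTo k (fun ρ => f' ρ - f ρ))
    (sf : ContDiffAt ℝ ∞ f 0) (sf' : ContDiffAt ℝ ∞ f' 0) (h0 : f 0 ≠ 0) (h0' : f' 0 ≠ 0) :
    VanishesTo k (fun ρ => (f' ρ)⁻¹ - (f ρ)⁻¹) := by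
  refine (smooth_mul ((sf.inv h0).mul (sf'.inv h0')) hf.neg).congr ?_
  filter_upwards [sf.continuousAt.eventually_ne h0, sf'.continuousAt.eventually_ne h0']
    with ρ h1 h2
  simp only [Pi.inv_apply]
  field_simp
  ring

end VanishesTo

lemma contDiffAt_ofReal {f : ℝ → ℝ} (hf : ContDiffAt ℝ ∞ f 0) :
    ContDiffAt ℝ ∞ (fun ρ => (f ρ : ℂ)) 0 := Complex.ofRealCLM.contDiff.contDiffAt.comp 0 hf

/-! ### The leading part of Wb: harmonicity and its radial second derivative. -/

section Flat

variable {p₀ : ℕ} {a : ℝ} {h : MetricField} {U W Wb : E3 → ℝ}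

/-- The leading part of a solution of the Yamabe equation is harmonic. -/
lemma IsStaticUpToOrder.flatLaplacian_ordGE (hd : IsStaticUpToOrder p₀ a h U W Wb) :
    OrdGE p₀ (fun x => ∑ i, pd i (pd i Wb) x) := by
  have hinv := analyticAt_matrix_inv hd.static.metric_analytic hd.static.metric_zero
  have hΓ := hd.static.christoffel_analytic
  have hr := analyticAt_scalarCurv hd.static.metric_analytic hd.static.metric_zero
  have hW := hd.ordGE
  have h1 : (-1 : Matrix (Fin 3) (Fin 3) ℝ)⁻¹ = -1 := Matrix.inv_eq_left_inv (by simp)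
  -- The Yamabe equation is solved for the flat Laplacian. In the second-order remainder the
  -- coefficient h^{ij} + δ^{ij} vanishes at the origin and returns one of the two lost orders; the
  -- other terms lose at most one.
  have o1 : ∀ i j, OrdGE p₀ (fun x => ((h x)⁻¹ i j + if i = j then 1 else 0) * pd i (pd j Wb) x) := by
    intro i j
    refine (OrdGE.mul (OrdGE.of_apply_zero ((hinv i j).add analyticAt_const) ?_)
      ((hW.pd j).pd i)).mono (by omega)
    change (h 0)⁻¹ i j + (if i = j then 1 else 0) = 0
    rw [hd.static.metric_zero, h1, Matrix.neg_apply, Matrix.one_apply]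
    simp
  have o2 : ∀ i j, OrdGE p₀ (fun x => -(h x)⁻¹ i j * ∑ k, christoffel h k i j x * pd k Wb x) :=
    fun i j => OrdGE.analytic_mul (hinv i j).neg (OrdGE.sum _ fun k _ =>
      OrdGE.analytic_mul (hΓ k i j) ((hW.pd k).mono (by omega)))
  have o3 : OrdGE p₀ (fun x => -(1 / 8) * scalarCurv h x * Wb x) :=
    OrdGE.analytic_mul (analyticAt_const.mul hr) (hW.mono (by omega))
  refine (((OrdGE.sum Finset.univ fun i _ => OrdGE.sum Finset.univ fun j _ =>
    (o1 i j).add (o2 i j))).add o3).congr ?_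
  filter_upwards [Metric.ball_mem_nhds (0 : E3) hd.static.a_pos] with x hx
  have hy := hd.yamabe_Wb x hx
  simp only [yamabe, laplacian, hess] at hy
  have h2 : ∀ i j, ((h x)⁻¹ i j + if i = j then 1 else 0) * pd i (pd j Wb) x
      + -(h x)⁻¹ i j * ∑ k, christoffel h k i j x * pd k Wb x
      = (h x)⁻¹ i j * (pd i (pd j Wb) x - ∑ k, christoffel h k i j x * pd k Wb x)
        + if i = j then pd i (pd j Wb) x else 0 := by
    intro i j; split_ifs <;> ring
  simp only [h2, Finset.sum_add_distrib, Finset.sum_ite_eq, Finset.mem_univ, if_true]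
  linarith

lemma pd_pd_comm {f : E3 → ℝ} {x : E3} (hf : AnalyticAt ℝ f x) (i j : Fin 3) :
    pd i (pd j f) x = pd j (pd i f) x := by
  have hs : IsSymmSndFDerivAt ℝ f x := (hf.contDiffAt (n := ω)).isSymmSndFDerivAt (by simp)
  have hd : DifferentiableAt ℝ (fderiv ℝ f) x := hf.fderiv.differentiableAt
  have h1 : ∀ i j, pd i (pd j f) x
      = fderiv ℝ (fderiv ℝ f) x (EuclideanSpace.single i 1) (EuclideanSpace.single j 1) := by
    intro i j
    rw [pd]
    have : pd j f = fun y => fderiv ℝ f y (EuclideanSpace.single j 1) := rfl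
    rw [this, fderiv_clm_apply hd (differentiableAt_const _)]
    simp
  rw [h1, h1, hs]

/-- The trace-free radial second derivative of `|x|³ Wb`, to leading order. -/
lemma IsStaticUpToOrder.rayHess_radial (hd : IsStaticUpToOrder p₀ a h U W Wb) (t : SU2) :
    VanishesTo (p₀ + 2) (fun ρ =>
      ((1 / 2) * ∑ i, ∑ j, rayHess (radial t) 1 Wb i j ρ * radial t i * radial t j
        - (1 / 6) * ∑ i, rayHess (radial t) 1 Wb i i ρ)
      - (1 / 2) * ((p₀ + 2) * (p₀ + 3)) * Wb (ρ • radial t)) := by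
  have hsq := sum_radial_sq t
  set e := radial t
  have hW := hd.ordGE
  set w : ℝ → ℝ := fun ρ => Wb (ρ • e) with hw
  have vw : VanishesTo (p₀ + 1) w := hW.line e
  have hc : Tendsto (fun ρ : ℝ => ρ • e) (𝓝 0) (𝓝 (0 : E3)) := by
    have : Continuous fun ρ : ℝ => ρ • e := by fun_prop
    simpa using this.tendsto 0
  have hev := hc.eventually hW.1.eventually_analyticAt
  have e1 : deriv w =ᶠ[𝓝 0] fun ρ => ∑ i, e i * pd i Wb (ρ • e) := by
    filter_upwards [hev] with ρ hρ using (hasDerivAt_line hρ.differentiableAt).deriv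
  have e2 : deriv (deriv w) =ᶠ[𝓝 0] fun ρ => ∑ i, ∑ j, e i * e j * pd j (pd i Wb) (ρ • e) := by
    filter_upwards [e1.eventuallyEq_nhds, hev] with ρ h1 hρ
    rw [h1.deriv_eq]
    have : HasDerivAt (fun ρ : ℝ => ∑ i, e i * pd i Wb (ρ • e))
        (∑ i, e i * ∑ j, e j * pd j (pd i Wb) (ρ • e)) ρ :=
      HasDerivAt.fun_sum fun i _ =>
        (hasDerivAt_line (analyticAt_pd hρ).differentiableAt).const_mul (e i)
    rw [this.deriv]
    simp only [Finset.mul_sum, mul_assoc]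
  have d1 := vw.rho_mul_deriv_sub
  set w1 : ℝ → ℝ := fun ρ => ρ * deriv w ρ with hw1
  have vw1 : VanishesTo (p₀ + 1) w1 :=
    (d1.mono (Nat.le_succ _) |>.add (vw.const_mul ((p₀ + 1 : ℕ) : ℝ))).congr
      (Eventually.of_forall fun ρ => by simp [hw1])
  have d2 := vw1.rho_mul_deriv_sub
  have e3 : deriv w1 =ᶠ[𝓝 0] fun ρ => deriv w ρ + ρ * deriv (deriv w) ρ := by
    have hs : ContDiffAt ℝ 1 (deriv w) 0 := (contDiffAt_deriv vw.1).of_le (by simp)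
    filter_upwards [hs.eventually (by simp)] with ρ hρ
    have := (hasDerivAt_id' ρ).fun_mul (hρ.differentiableAt one_ne_zero).hasDerivAt
    simpa using this.deriv
  have vl : VanishesTo (p₀ + 2) (fun ρ : ℝ => ρ * ρ * ∑ i, pd i (pd i Wb) (ρ • e)) :=
    ((VanishesTo.rho.mul VanishesTo.rho).mul (hd.flatLaplacian_ordGE.line e)).mono (by omega)
  -- With w₁ = ρw', the radial second derivative is 6w + 5w₁ + ρw₁' and the trace is 12w + 6w₁ plus
  -- ρ² times the flat Laplacian. The combination is therefore w + (3/2)w₁ + (1/2)ρw₁' up to that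
  -- last term. Replacing ρ∂_ρ by p₀ + 1 twice produces (p₀ + 2)(p₀ + 3)/2; the coefficient p₀ + 4
  -- is (p₀ + 1) + 3.
  refine (((d2.const_mul (1 / 2)).add (d1.const_mul ((1 / 2 : ℝ) * (p₀ + 4)))).sub
    (vl.const_mul (1 / 6))).congr ?_
  filter_upwards [e1, e2, e3] with ρ h1 h2 h3
  have k1 : ∑ i, ∑ j, rayHess e 1 Wb i j ρ * e i * e j
      = 6 * w ρ + 6 * ρ * deriv w ρ + ρ ^ 2 * deriv (deriv w) ρ := by
    rw [h1, h2]
    have : ∀ i j, rayHess e 1 Wb i j ρ * e i * e j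
        = 3 * w ρ * ((e i * e i) * (e j * e j)) + (if i = j then 3 * w ρ * (e i * e j) else 0)
        + 3 * ρ * ((e i * pd i Wb (ρ • e)) * (e j * e j) + (e j * pd j Wb (ρ • e)) * (e i * e i))
        + ρ ^ 2 * (e j * e i * pd i (pd j Wb) (ρ • e)) := by
      intro i j
      simp only [rayHess, hw]
      split_ifs <;> push_cast <;> ring
    simp only [this, Finset.sum_add_distrib, ← Finset.mul_sum, ← Finset.sum_mul,
      Finset.sum_ite_eq, Finset.mem_univ, if_true, hsq]
    rw [Finset.sum_comm (f := fun i j => e j * e i * pd i (pd j Wb) (ρ • e))]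
    ring
  have k2 : ∑ i, rayHess e 1 Wb i i ρ
      = 12 * w ρ + 6 * ρ * deriv w ρ + ρ ^ 2 * ∑ i, pd i (pd i Wb) (ρ • e) := by
    rw [h1]
    have : ∀ i, rayHess e 1 Wb i i ρ = 3 * w ρ * (e i * e i) + 3 * w ρ
        + 6 * ρ * (e i * pd i Wb (ρ • e)) + ρ ^ 2 * pd i (pd i Wb) (ρ • e) := by
      intro i
      simp only [rayHess, hw, if_true]
      push_cast
      ring
    simp only [this, Finset.sum_add_distrib, ← Finset.mul_sum, hsq, Finset.sum_const,
      Finset.card_univ, Fintype.card_fin, nsmul_eq_mul]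
    push_cast
    ring
  rw [k1, k2, h3]
  simp only [hw1, hw]
  push_cast
  ring

end Flat

/-! ### Comparison of the jets of the data -/

lemma contDiffAt_raySpin {c : Fin 2 → Fin 2 → Fin 3 → ℝ → ℂ} {M : Fin 3 → Fin 3 → ℝ → ℝ}
    (hc : ∀ A B i, ContDiffAt ℝ ∞ (c A B i) 0) (hM : ∀ i j, ContDiffAt ℝ ∞ (M i j) 0)
    (A B C D : Fin 2) : ContDiffAt ℝ ∞ (fun ρ => raySpin c M ρ A B C D) 0 :=
  (raySpin_vanishesTo hc (fun i j => VanishesTo.of_smooth (hM i j)) A B C D).1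

/-! ### Smoothness in ρ of the profiles of the data. -/

section Smooth

variable {a : ℝ} {h : MetricField} {U W : E3 → ℝ} {P : E3 → Matrix (Fin 3) (Fin 3) ℝ} {Ω : E3 → ℝ}
  {t : SU2} {V : ℝ → ℝ} {g : Fin 3 → ℝ → ℝ} {M : Fin 3 → Fin 3 → ℝ → ℝ}

lemma smooth_phiProfile (hc : ∀ A B i, ContDiffAt ℝ ∞ (rayFrame P t A B i) 0)
    (hd : IsStaticData a h U W) (hΩ : IsRayFactor h t Ω V g M) (A B C D : Fin 2) :
    ContDiffAt ℝ ∞ (fun ρ : ℝ => (V ρ : ℂ) ^ 4 * raySpin (rayFrame P t) M ρ A B C D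
      + (ρ : ℂ) ^ 2 * (V ρ : ℂ) ^ 2 * raySpin (rayFrame P t)
        (fun i j ρ => tfRicci h i j (ρ • radial t)) ρ A B C D) 0 := by
  have hV := contDiffAt_ofReal hΩ.V_smooth
  have hr : ContDiffAt ℝ ∞ (fun ρ : ℝ => (ρ : ℂ)) 0 := contDiffAt_ofReal contDiffAt_id
  have h1 := contDiffAt_raySpin hc hΩ.M_smooth A B C D
  have h2 := contDiffAt_raySpin hc (M := fun i j ρ => tfRicci h i j (ρ • radial t))
    (fun i j => contDiffAt_line
      (analyticAt_tfRicci hd.metric_analytic hd.metric_zero i j) _) A B C D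
  exact ((hV.pow 4).mul h1).add (((hr.pow 2).mul (hV.pow 2)).mul h2)

lemma smooth_thProfile (hc : ∀ A B i, ContDiffAt ℝ ∞ (rayFrame P t A B i) 0)
    (hd : IsStaticData a h U W) (hΩ : IsRayFactor h t Ω V g M) (A B C D : Fin 2) (k : ℂ) :
    ContDiffAt ℝ ∞ (fun ρ : ℝ => -((V ρ : ℂ) ^ 2 * raySpin (rayFrame P t) M ρ A B C D)
      + (1 / 12) * (ρ : ℂ) ^ 2 * (scalarCurv h (ρ • radial t) : ℂ) * k) 0 := by
  have hV := contDiffAt_ofReal hΩ.V_smooth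
  have hr : ContDiffAt ℝ ∞ (fun ρ : ℝ => (ρ : ℂ)) 0 := contDiffAt_ofReal contDiffAt_id
  have h1 := contDiffAt_raySpin hc hΩ.M_smooth A B C D
  have h2 := contDiffAt_ofReal (contDiffAt_line
    (analyticAt_scalarCurv hd.metric_analytic hd.metric_zero) (radial t))
  exact ((hV.pow 2).mul h1).neg.add
    (((contDiffAt_const.mul (hr.pow 2)).mul h2).mul contDiffAt_const)

/-- The coefficient of `τ²` in `Θ` on a ray. -/
def rayThetaCoeff (h : MetricField) (t : SU2) (V : ℝ → ℝ) (g : Fin 3 → ℝ → ℝ) (ρ : ℝ) : ℝ :=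
  ρ * (V ρ ^ 2 * rayNormSq h (radial t) g ρ / 4)

lemma smooth_rayThetaCoeff (hd : IsStaticData a h U W) (hΩ : IsRayFactor h t Ω V g M) :
    ContDiffAt ℝ ∞ (rayThetaCoeff h t V g) 0 :=
  contDiffAt_id.mul (((hΩ.V_smooth.pow 2).mul
    (hΩ.rayNormSq_smooth hd.metric_analytic hd.metric_zero)).div_const 4)

lemma smooth_invSq (hΩ : IsRayFactor h t Ω V g M) :
    ContDiffAt ℝ ∞ (fun ρ : ℝ => ρ * (V ρ ^ 2)⁻¹) 0 :=
  contDiffAt_id.mul ((hΩ.V_smooth.pow 2).inv (by simp [hΩ.V_zero]))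

lemma smooth_dProfile (hc : ∀ A B i, ContDiffAt ℝ ∞ (rayFrame P t A B i) 0)
    (hΩ : IsRayFactor h t Ω V g M) (A B : Fin 2) : ContDiffAt ℝ ∞
      (fun ρ : ℝ => (ρ : ℂ) * ∑ i, (g i ρ : ℂ) * rayFrame P t A B i ρ) 0 :=
  (contDiffAt_ofReal contDiffAt_id).mul (ContDiffAt.sum fun i _ =>
    (contDiffAt_ofReal (hΩ.g_smooth i)).mul (hc A B i))

end Smooth

/-! ### Orders to which the perturbed and the static data agree. -/

section Compare

variable {p₀ : ℕ} {a : ℝ} {h : MetricField} {U W Wb : E3 → ℝ}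
  {P : E3 → Matrix (Fin 3) (Fin 3) ℝ}

lemma contDiffAt_rayFrame (hd : IsStaticUpToOrder p₀ a h U W Wb) (hP : IsRadialTransport a h P)
    (t : SU2) (A B : Fin 2) (i : Fin 3) : ContDiffAt ℝ ∞ (rayFrame P t A B i) 0 :=
  contDiffAt_frame hd.static.a_pos hP t A B i

/-- The prefactor 1/ρ cancels in the difference: the Hessian changes by ρE, and V⁴ and V² change by
multiples of ρWb. Of the three resulting terms only V⁴E has order p₀ + 1. The second carries the
spinor of M, which vanishes at 0 because M(0) is pure trace, and the third carries ρ². For φ₂ the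
leading term is evaluated by `raySpin_frame0_radial` and `IsStaticUpToOrder.rayHess_radial`. -/
lemma phi_jet_sub (hd : IsStaticUpToOrder p₀ a h U W Wb) (hP : IsRadialTransport a h P) (t : SU2)
    (j : Fin 5) {j₁ j₂ : ℕ → ℂ}
    (h₁ : HasRhoJet (fun ρ => phiData h P (conformalFactor U (W + Wb)) ρ t j) j₁)
    (h₂ : HasRhoJet (fun ρ => phiData h P (conformalFactor U W) ρ t j) j₂) :
    ∃ D : ℝ → ℂ, (∀ p, j₁ p - j₂ p = iteratedDeriv p D 0) ∧ VanishesTo (p₀ + 1) D ∧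
      (j = 2 → VanishesTo (p₀ + 2) (fun ρ =>
        D ρ + (((p₀ + 2) * (p₀ + 3) * Wb (ρ • radial t) : ℝ) : ℂ))) := by
  obtain ⟨V, g, ε, M, E, f₁, f₂, vε, vE, vL, hM0⟩ := exists_rayFactors hd t
  have hc := contDiffAt_rayFrame hd hP t
  set Aj := (quadIdx j).1
  set Bj := (quadIdx j).2.1
  set Cj := (quadIdx j).2.2.1
  set Dj := (quadIdx j).2.2.2
  set c := rayFrame P t
  set w : ℝ → ℝ := fun ρ => Wb (ρ • radial t) with hw
  have vw : VanishesTo (p₀ + 1) w := hd.ordGE.line _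
  set s : Fin 3 → Fin 3 → ℝ → ℝ := fun i j ρ => tfRicci h i j (ρ • radial t)
  have sV := contDiffAt_ofReal f₁.V_smooth
  have sV' := contDiffAt_ofReal f₂.V_smooth
  have hr : ContDiffAt ℝ ∞ (fun ρ : ℝ => (ρ : ℂ)) 0 := contDiffAt_ofReal contDiffAt_id
  have hs : ∀ i j, ContDiffAt ℝ ∞ (s i j) 0 := fun i j => contDiffAt_line
    (analyticAt_tfRicci hd.static.metric_analytic hd.static.metric_zero i j) _
  have sS := contDiffAt_raySpin hc hs Aj Bj Cj Dj
  have sM := contDiffAt_raySpin hc f₁.M_smooth Aj Bj Cj Dj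
  have vS := raySpin_vanishesTo hc vE Aj Bj Cj Dj
  have sM0 : raySpin c M 0 Aj Bj Cj Dj = 0 := by
    have h1 := raySpin_frame0_delta t hM0 Aj Bj Cj Dj
    have h2 : raySpin c M 0 = raySpin (fun A B i _ => frame0 t A B i) M 0 := by
      simp only [raySpin, c, rayFrame, frame_zero hP]
    rw [h2, h1]
  have vM := VanishesTo.of_apply_zero sM sM0
  have t1 := VanishesTo.smooth_mul (sV'.pow 4) vS
  have t2 := vw.ofReal.mul (VanishesTo.smooth_mul
    ((sV'.add sV).mul ((sV'.pow 2).add (sV.pow 2))) vM)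
  have t3 := ((VanishesTo.rho.ofReal.mul VanishesTo.rho.ofReal).mul vw.ofReal).mul_smooth
    ((sV'.add sV).mul sS)
  have hev : ∀ᶠ ρ in 𝓝[>] (0 : ℝ), phiData h P (conformalFactor U (W + Wb)) ρ t j
      - phiData h P (conformalFactor U W) ρ t j
      = ((V ρ + ρ * w ρ : ℝ) : ℂ) ^ 4 * raySpin c E ρ Aj Bj Cj Dj
      + (w ρ : ℂ) * ((((V ρ + ρ * w ρ : ℝ) : ℂ) + V ρ) *
        (((V ρ + ρ * w ρ : ℝ) : ℂ) ^ 2 + (V ρ : ℂ) ^ 2) * raySpin c M ρ Aj Bj Cj Dj)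
      + (ρ : ℂ) * ρ * w ρ * ((((V ρ + ρ * w ρ : ℝ) : ℂ) + V ρ) *
          raySpin c s ρ Aj Bj Cj Dj) := by
    filter_upwards [f₁.phiData_eq (P := P) j, f₂.phiData_eq (P := P) j, self_mem_nhdsWithin]
      with ρ e1 e2 hρ
    have hρ' : (ρ : ℂ) ≠ 0 := by exact_mod_cast (ne_of_gt hρ)
    rw [e1, e2]
    have e3 := raySpin_add_mul (c := c) M E ρ ρ Aj Bj Cj Dj
    -- At a fixed ρ the factor ρ' may be frozen to the constant ρ, as required by `raySpin_add_mul`.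
    have e4 : raySpin c (fun i j ρ' => M i j ρ' + ρ' * E i j ρ') ρ
        = raySpin c (fun i j ρ' => M i j ρ' + ρ * E i j ρ') ρ := raySpin_congr fun _ _ => rfl
    change ((ρ⁻¹ : ℝ) : ℂ) * (_ * raySpin c _ ρ Aj Bj Cj Dj + _ * raySpin c s ρ Aj Bj Cj Dj)
      - ((ρ⁻¹ : ℝ) : ℂ) * (_ * raySpin c _ ρ Aj Bj Cj Dj + _ * raySpin c s ρ Aj Bj Cj Dj) = _
    rw [e4, e3]
    simp only [hw]
    push_cast
    field_simp
    ring
  refine ⟨_, fun p => h₁.sub_eq h₂ ?_ ?_ ((t1.1.add t2.1).add t3.1) hev p,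
    (t1.add (t2.mono (by omega))).add (t3.mono (by omega)), ?_⟩
  · exact ((SmoothPos.inv_rho.mul (SmoothPos.of_contDiffAt
      (smooth_phiProfile hc hd.static f₂ Aj Bj Cj Dj)))).congr (f₂.phiData_eq j)
  · exact ((SmoothPos.inv_rho.mul (SmoothPos.of_contDiffAt
      (smooth_phiProfile hc hd.static f₁ Aj Bj Cj Dj)))).congr (f₁.phiData_eq j)
  · rintro rfl
    have hA : Aj = 0 := rfl
    have hB : Bj = 0 := rfl
    have hC : Cj = 1 := rfl
    have hD : Dj = 1 := rfl
    -- Errors of order p₀ + 2 are made successively by freezing the frame at the origin (`q1`),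
    -- replacing E by -2 times the flat Hessian (`q2`), replacing V⁴ by 1 (`q3`), and inserting the
    -- radial formula (`q4`).
    have q1 := raySpin_sub_frozen_vanishesTo hc vE Aj Bj Cj Dj
    have q2 := raySpin_vanishesTo (c := fun A B i _ => frame0 t A B i)
      (fun _ _ _ => contDiffAt_const) vL Aj Bj Cj Dj
    have q3 : VanishesTo (p₀ + 2) (fun ρ : ℝ => (((V ρ + ρ * w ρ : ℝ) : ℂ) ^ 4 - 1) *
        raySpin c E ρ Aj Bj Cj Dj) := by
      have := (VanishesTo.of_apply_zero ((sV'.pow 4).sub contDiffAt_const)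
        (show ((V 0 + 0 * w 0 : ℝ) : ℂ) ^ 4 - 1 = 0 by simp [f₁.V_zero])).mul vS
      exact this.mono (by omega)
    have q4 := (hd.rayHess_radial t).ofReal.const_mul (-2)
    refine (((((q1.add q2).add q3).add q4).add (t2.mono (by omega))).add
      (t3.mono (by omega))).congr ?_
    have hev : ∀ᶠ ρ in 𝓝 (0 : ℝ), ∀ i k, rayHess (radial t) 1 Wb i k ρ
        = rayHess (radial t) 1 Wb k i ρ := by
      have hcc : Tendsto (fun ρ : ℝ => ρ • radial t) (𝓝 0) (𝓝 (0 : E3)) := by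
        have : Continuous fun ρ : ℝ => ρ • radial t := by fun_prop
        simpa using this.tendsto 0
      filter_upwards [hcc.eventually hd.ordGE.1.eventually_analyticAt] with ρ hρ i k
      simp only [rayHess, pd_pd_comm hρ i k, eq_comm (a := i) (b := k)]
      ring
    filter_upwards [hev] with ρ hρ
    have k1 := raySpin_frame0_radial t (M := rayHess (radial t) 1 Wb) hρ
    have k2 : raySpin (fun A B i _ => frame0 t A B i)
        (fun i j ρ => E i j ρ + 2 * rayHess (radial t) 1 Wb i j ρ) ρ Aj Bj Cj Dj = _ :=
      raySpin_add_mul E (rayHess (radial t) 1 Wb) ρ 2 Aj Bj Cj Dj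
    have k3 : raySpin (fun A B i _ => c A B i 0) E ρ
        = raySpin (fun A B i _ => frame0 t A B i) E ρ := by
      simp only [raySpin, c, rayFrame, frame_zero hP]
    rw [k2, k3, hA, hB, hC, hD, k1]
    simp only [hw]
    push_cast
    ring

/-- The weight ρ²/Ω is V², without a negative power of ρ, so the factor ρ in front of E is kept and
one order is gained over φ. The value at order zero is the trace-free part of M(0) = 2δ. -/
lemma Th_jet_eq (hd : IsStaticUpToOrder p₀ a h U W Wb) (hP : IsRadialTransport a h P) (t : SU2)
    (i j : Fin 3) {j₁ j₂ : ℕ → ℂ}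
    (h₁ : HasRhoJet (fun ρ => upsData h P (conformalFactor U (W + Wb)) ρ t (.Th i j)) j₁)
    (h₂ : HasRhoJet (fun ρ => upsData h P (conformalFactor U W) ρ t (.Th i j)) j₂) :
    (∀ p ≤ p₀ + 1, j₁ p = j₂ p) ∧ j₂ 0 = 0 := by
  obtain ⟨V, g, ε, M, E, f₁, f₂, vε, vE, vL, hM0⟩ := exists_rayFactors hd t
  have hc := contDiffAt_rayFrame hd hP t
  have s₁ := smooth_thProfile hc hd.static f₁ (fst i) (snd i) (fst j) (snd j)
    (hsp (fst i) (snd i) (fst j) (snd j))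
  have s₂ := smooth_thProfile hc hd.static f₂ (fst i) (snd i) (fst j) (snd j)
    (hsp (fst i) (snd i) (fst j) (snd j))
  have vw : VanishesTo (p₀ + 1) (fun ρ : ℝ => Wb (ρ • radial t)) := hd.ordGE.line _
  have sV := contDiffAt_ofReal f₁.V_smooth
  have sV' := contDiffAt_ofReal f₂.V_smooth
  have vS := raySpin_vanishesTo hc vE (fst i) (snd i) (fst j) (snd j)
  have sM := contDiffAt_raySpin hc f₁.M_smooth (fst i) (snd i) (fst j) (snd j)
  constructor
  · have t1 := ((VanishesTo.rho.ofReal.mul vS).mul_smooth (sV'.pow 2)).neg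
    have t2 := ((VanishesTo.rho.ofReal.mul vw.ofReal).mul_smooth ((sV'.add sV).mul sM)).neg
    have hD : VanishesTo (p₀ + 2) _ := (t1.mono (by omega)).add (t2.mono (by omega))
    refine fun p hp => h₁.eq_of_vanishesTo h₂ ((SmoothPos.of_contDiffAt s₂).congr (f₂.thData_eq i j))
      ((SmoothPos.of_contDiffAt s₁).congr (f₁.thData_eq i j)) hD ?_ (by omega)
    filter_upwards [f₁.thData_eq (P := P) i j, f₂.thData_eq (P := P) i j] with ρ e1 e2
    rw [e1, e2]
    have e3 := raySpin_add_mul (c := rayFrame P t) M E ρ ρ (fst i) (snd i) (fst j) (snd j)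
    have e4 : raySpin (rayFrame P t) (fun i j ρ' => M i j ρ' + ρ' * E i j ρ') ρ
        = raySpin (rayFrame P t) (fun i j ρ' => M i j ρ' + ρ * E i j ρ') ρ :=
      raySpin_congr fun _ _ => rfl
    rw [e4, e3]
    push_cast
    ring
  · rw [h₂.zero_eq s₁ (f₁.thData_eq i j)]
    have h1 := raySpin_frame0_delta t hM0 (fst i) (snd i) (fst j) (snd j)
    have h2 : raySpin (rayFrame P t) M 0 = raySpin (fun A B i _ => frame0 t A B i) M 0 := by
      simp only [raySpin, rayFrame, frame_zero hP]
    rw [h2, h1]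
    simp

lemma dForm_jet_eq (hd : IsStaticUpToOrder p₀ a h U W Wb) (hP : IsRadialTransport a h P) (t : SU2)
    (j : Fin 3) {j₁ j₂ : ℕ → ℂ}
    (h₁ : HasRhoJet (fun ρ => dForm P (conformalFactor U (W + Wb)) ρ t j) j₁)
    (h₂ : HasRhoJet (fun ρ => dForm P (conformalFactor U W) ρ t j) j₂) :
    (∀ p ≤ p₀ + 1, j₁ p = j₂ p) ∧ j₂ 0 = 0 := by
  obtain ⟨V, g, ε, M, E, f₁, f₂, vε, vE, vL, hM0⟩ := exists_rayFactors hd t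
  have hc := contDiffAt_rayFrame hd hP t
  have s₁ := smooth_dProfile hc f₁ (fst j) (snd j)
  have s₂ := smooth_dProfile hc f₂ (fst j) (snd j)
  constructor
  · have hD : VanishesTo (p₀ + 2) (fun ρ : ℝ => (ρ : ℂ) * ((ρ : ℂ) *
        ∑ i, (ε i ρ : ℂ) * rayFrame P t (fst j) (snd j) i ρ)) :=
      (VanishesTo.rho.ofReal.mul (VanishesTo.rho.ofReal.mul (VanishesTo.sum _ fun i _ =>
        (vε i).ofReal.mul_smooth (hc (fst j) (snd j) i)))).mono (by omega)
    refine fun p hp => h₁.eq_of_vanishesTo h₂ ((SmoothPos.of_contDiffAt s₂).congr (f₂.dForm_eq j))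
      ((SmoothPos.of_contDiffAt s₁).congr (f₁.dForm_eq j)) hD ?_ (by omega)
    filter_upwards [f₁.dForm_eq (P := P) j, f₂.dForm_eq (P := P) j] with ρ e1 e2
    rw [e1, e2, ← mul_sub, ← Finset.sum_sub_distrib]
    congr 1
    rw [Finset.mul_sum]
    refine Finset.sum_congr rfl fun i _ => ?_
    push_cast
    ring
  · rw [h₂.zero_eq s₁ (f₁.dForm_eq j)]
    simp

/-- V and g both change by ρ times functions of order p₀ + 1. The outer factor ρ of Θ would give one
more order, which is not needed. -/
lemma rayThetaCoeff_sub_vanishesTo (hd : IsStaticUpToOrder p₀ a h U W Wb) {t : SU2} {V : ℝ → ℝ}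
    {g ε : Fin 3 → ℝ → ℝ} {M M' : Fin 3 → Fin 3 → ℝ → ℝ} {Ω Ω' : E3 → ℝ} {w : ℝ → ℝ}
    (f₁ : IsRayFactor h t Ω V g M)
    (f₂ : IsRayFactor h t Ω' (fun ρ => V ρ + ρ * w ρ) (fun i ρ => g i ρ + ρ * ε i ρ) M')
    (vw : VanishesTo (p₀ + 1) w) (vε : ∀ i, VanishesTo (p₀ + 1) (ε i)) :
    VanishesTo (p₀ + 2) (fun ρ =>
      rayThetaCoeff h t (fun ρ => V ρ + ρ * w ρ) (fun i ρ => g i ρ + ρ * ε i ρ) ρ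
        - rayThetaCoeff h t V g ρ) ∧
    VanishesTo (p₀ + 2) (fun ρ => ρ * ((V ρ + ρ * w ρ) ^ 2)⁻¹ - ρ * (V ρ ^ 2)⁻¹) := by
  have hinv := analyticAt_matrix_inv hd.static.metric_analytic hd.static.metric_zero
  have dV : VanishesTo (p₀ + 2) (fun ρ => (V ρ + ρ * w ρ) - V ρ) :=
    ((VanishesTo.rho.mul vw).mono (by omega)).congr (Eventually.of_forall fun ρ => by ring)
  have dg : ∀ i, VanishesTo (p₀ + 2) (fun ρ => (g i ρ + ρ * ε i ρ) - g i ρ) := fun i =>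
    ((VanishesTo.rho.mul (vε i)).mono (by omega)).congr (Eventually.of_forall fun ρ => by ring)
  have dV2 : VanishesTo (p₀ + 2) (fun ρ => (V ρ + ρ * w ρ) ^ 2 - V ρ ^ 2) :=
    (dV.mul_sub_mul dV f₁.V_smooth f₂.V_smooth).congr (Eventually.of_forall fun ρ => by ring)
  have dq : VanishesTo (p₀ + 2) (fun ρ => rayNormSq h (radial t) (fun i ρ => g i ρ + ρ * ε i ρ) ρ
      - rayNormSq h (radial t) g ρ) := by
    refine (VanishesTo.sum Finset.univ fun i _ => VanishesTo.sum Finset.univ fun j _ =>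
      VanishesTo.smooth_mul (contDiffAt_line (hinv i j) (radial t))
        ((dg i).mul_sub_mul (dg j) (f₁.g_smooth i) (f₂.g_smooth j))).congr
      (Eventually.of_forall fun ρ => ?_)
    simp only [rayNormSq, ← Finset.sum_sub_distrib]
    exact Finset.sum_congr rfl fun i _ => Finset.sum_congr rfl fun j _ => by ring
  have sq := f₂.rayNormSq_smooth hd.static.metric_analytic hd.static.metric_zero
  constructor
  · refine (VanishesTo.smooth_mul (contDiffAt_id.div_const 4)
      (dV2.mul_sub_mul dq (f₁.V_smooth.pow 2) sq)).congr (Eventually.of_forall fun ρ => ?_)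
    simp only [rayThetaCoeff, id]
    ring
  · refine (VanishesTo.smooth_mul contDiffAt_id (dV2.inv_sub_inv (f₁.V_smooth.pow 2)
      (f₂.V_smooth.pow 2) ?_ ?_)).congr (Eventually.of_forall fun ρ => ?_)
    · simp [f₁.V_zero]
    · simp [f₁.V_zero]
    · simp only [id]; ring

/-- The vanishing at order zero matters as much as the agreement: it keeps φ of top order out of the
equations for υ. -/
lemma Theta_jet_eq (hd : IsStaticUpToOrder p₀ a h U W Wb) (t : SU2) (τ : ℝ) {j₁ j₂ : ℕ → ℂ}
    (h₁ : HasRhoJet (fun ρ => (Theta h (conformalFactor U (W + Wb)) τ ρ t : ℂ)) j₁)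
    (h₂ : HasRhoJet (fun ρ => (Theta h (conformalFactor U W) τ ρ t : ℂ)) j₂) :
    (∀ p ≤ p₀ + 1, j₁ p = j₂ p) ∧ j₂ 0 = 0 := by
  obtain ⟨V, g, ε, M, E, f₁, f₂, vε, vE, vL, hM0⟩ := exists_rayFactors hd t
  obtain ⟨v1, v2⟩ := rayThetaCoeff_sub_vanishesTo hd f₁ f₂ (hd.ordGE.line _) vε
  have hh := hd.static.metric_analytic
  have h0 := hd.static.metric_zero
  have s₁ := contDiffAt_ofReal ((smooth_invSq f₁).add
    ((smooth_rayThetaCoeff hd.static f₁).mul (contDiffAt_const (c := τ ^ 2))))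
  have s₂ := contDiffAt_ofReal ((smooth_invSq f₂).add
    ((smooth_rayThetaCoeff hd.static f₂).mul (contDiffAt_const (c := τ ^ 2))))
  have e₁ : ∀ᶠ ρ in 𝓝[>] (0 : ℝ), (Theta h (conformalFactor U W) τ ρ t : ℂ) = _ :=
    (f₁.Theta_eq hh h0).mono fun ρ hρ => congrArg Complex.ofReal (hρ τ)
  have e₂ : ∀ᶠ ρ in 𝓝[>] (0 : ℝ), (Theta h (conformalFactor U (W + Wb)) τ ρ t : ℂ) = _ :=
    (f₂.Theta_eq hh h0).mono fun ρ hρ => congrArg Complex.ofReal (hρ τ)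
  constructor
  · have hD := (v2.add (v1.mul_smooth (contDiffAt_const (c := τ ^ 2)))).ofReal
    refine fun p hp => h₁.eq_of_vanishesTo h₂ ((SmoothPos.of_contDiffAt s₂).congr e₂)
      ((SmoothPos.of_contDiffAt s₁).congr e₁) hD ?_ (by omega)
    filter_upwards [e₁, e₂] with ρ k1 k2
    rw [k1, k2]
    simp only [rayThetaCoeff]
    push_cast
    ring
  · rw [h₂.zero_eq s₁ e₁]
    simp [rayThetaCoeff]

lemma deriv_Theta_jet_eq (hd : IsStaticUpToOrder p₀ a h U W Wb) (t : SU2) (τ : ℝ) {j₁ j₂ : ℕ → ℂ}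
    (h₁ : HasRhoJet
      (fun ρ => (deriv (fun s => Theta h (conformalFactor U (W + Wb)) s ρ t) τ : ℂ)) j₁)
    (h₂ : HasRhoJet
      (fun ρ => (deriv (fun s => Theta h (conformalFactor U W) s ρ t) τ : ℂ)) j₂) :
    (∀ p ≤ p₀ + 1, j₁ p = j₂ p) ∧ j₂ 0 = 0 := by
  obtain ⟨V, g, ε, M, E, f₁, f₂, vε, vE, vL, hM0⟩ := exists_rayFactors hd t
  obtain ⟨v1, v2⟩ := rayThetaCoeff_sub_vanishesTo hd f₁ f₂ (hd.ordGE.line _) vε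
  have hh := hd.static.metric_analytic
  have h0 := hd.static.metric_zero
  have s₁ := contDiffAt_ofReal
    ((smooth_rayThetaCoeff hd.static f₁).mul (contDiffAt_const (c := 2 * τ)))
  have s₂ := contDiffAt_ofReal
    ((smooth_rayThetaCoeff hd.static f₂).mul (contDiffAt_const (c := 2 * τ)))
  have e₁ : ∀ᶠ ρ in 𝓝[>] (0 : ℝ),
      (deriv (fun s => Theta h (conformalFactor U W) s ρ t) τ : ℂ) = _ :=
    (f₁.deriv_Theta_eq hh h0).mono fun ρ hρ => hρ τ
  have e₂ : ∀ᶠ ρ in 𝓝[>] (0 : ℝ),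
      (deriv (fun s => Theta h (conformalFactor U (W + Wb)) s ρ t) τ : ℂ) = _ :=
    (f₂.deriv_Theta_eq hh h0).mono fun ρ hρ => hρ τ
  constructor
  · have hD := (v1.mul_smooth (contDiffAt_const (c := 2 * τ))).ofReal
    refine fun p hp => h₁.eq_of_vanishesTo h₂ ((SmoothPos.of_contDiffAt s₂).congr e₂)
      ((SmoothPos.of_contDiffAt s₁).congr e₁) hD ?_ (by omega)
    filter_upwards [e₁, e₂] with ρ k1 k2
    rw [k1, k2]
    simp only [rayThetaCoeff]
    push_cast
    ring
  · rw [h₂.zero_eq s₁ e₁]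
    simp [rayThetaCoeff]

end Compare

/-! ### Initial data of the transport equations -/

section Init

variable {p₀ : ℕ} {a : ℝ} {h : MetricField} {U W Wb : E3 → ℝ}
  {P : E3 → Matrix (Fin 3) (Fin 3) ℝ} {υ υs : ℕ → ℝ → SU2 → Ups} {φ φs : ℕ → ℝ → SU2 → Phi}

/-- Only Θ_{AB(CD)} involves Ω in the data for υ; the other components are jets of one and the same
function. -/
lemma init_ups_eq (hd : IsStaticUpToOrder p₀ a h U W Wb) (hP : IsRadialTransport a h P)
    (hsol : IsTransportSolution h P (conformalFactor U (W + Wb)) υ φ)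
    (hstatic : IsTransportSolution h P (conformalFactor U W) υs φs) {p : ℕ} (hp : p ≤ p₀ + 1)
    (t : SU2) : υ p 0 t = υs p 0 t := by
  funext k
  have h₁ := hsol.init_ups t k
  have h₂ := hstatic.init_ups t k
  cases k with
  | c μ j => fin_cases μ <;> exact HasRhoJet.unique h₁ h₂ p
  | xi i j => exact HasRhoJet.unique h₁ h₂ p
  | chi i j => exact HasRhoJet.unique h₁ h₂ p
  | f j => exact HasRhoJet.unique h₁ h₂ p
  | Th i j => exact (Th_jet_eq hd hP t i j h₁ h₂).1 p hp
  | trTh j => exact HasRhoJet.unique h₁ h₂ p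

lemma init_phi_eq (hd : IsStaticUpToOrder p₀ a h U W Wb) (hP : IsRadialTransport a h P)
    (hsol : IsTransportSolution h P (conformalFactor U (W + Wb)) υ φ)
    (hstatic : IsTransportSolution h P (conformalFactor U W) υs φs) {p : ℕ} (hp : p ≤ p₀)
    (t : SU2) : φ p 0 t = φs p 0 t := by
  funext j
  obtain ⟨D, h1, h2, -⟩ := phi_jet_sub hd hP t j (hsol.init_phi t j) (hstatic.init_phi t j)
  rw [← sub_eq_zero, h1 p, h2.2 p (by omega)]

/-- If φ₂ agreed to order p₀ + 1 on the ray, its leading term -(p₀ + 2)(p₀ + 3) Wb would vanish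
there, against the choice of the ray by polarisation. -/
lemma exists_init_phi_ne (hd : IsStaticUpToOrder p₀ a h U W Wb) (hP : IsRadialTransport a h P)
    (hsol : IsTransportSolution h P (conformalFactor U (W + Wb)) υ φ)
    (hstatic : IsTransportSolution h P (conformalFactor U W) υs φs)
    (hW : iteratedFDeriv ℝ (p₀ + 1) Wb 0 ≠ 0) :
    ∃ t, φ (p₀ + 1) 0 t - φs (p₀ + 1) 0 t ≠ 0 := by
  obtain ⟨e, he, hne⟩ := exists_iteratedFDeriv_diag_ne_zero hd.ordGE.1 (by omega : 0 < p₀ + 1) hW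
  obtain ⟨t, rfl⟩ := radial_surjective he
  refine ⟨t, fun h0 => hne ?_⟩
  obtain ⟨D, h1, h2, h3⟩ := phi_jet_sub hd hP t 2 (hsol.init_phi t 2) (hstatic.init_phi t 2)
  have h4 := h1 (p₀ + 1)
  have h5 : φ (p₀ + 1) 0 t 2 - φs (p₀ + 1) 0 t 2 = 0 := congrFun h0 2
  rw [h5] at h4
  have hD : VanishesTo (p₀ + 2) D := ⟨h2.1, fun j hj => by
    rcases Nat.lt_succ_iff_lt_or_eq.1 hj with hj | rfl
    · exact h2.2 j hj
    · exact h4.symm⟩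
  have h6 := ((h3 rfl).sub hD).const_mul ((((p₀ : ℂ) + 2) * (p₀ + 3))⁻¹)
  have hc : ((p₀ : ℂ) + 2) * (p₀ + 3) ≠ 0 := by
    have : ((p₀ + 2 : ℕ) : ℂ) * ((p₀ + 3 : ℕ) : ℂ) ≠ 0 :=
      mul_ne_zero (Nat.cast_ne_zero.2 (by omega)) (Nat.cast_ne_zero.2 (by omega))
    simpa using this
  have h7 : VanishesTo (p₀ + 2) (fun ρ : ℝ => ((Wb (ρ • radial t) : ℝ) : ℂ)) :=
    h6.congr (Eventually.of_forall fun ρ => by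
      beta_reduce
      rw [add_sub_cancel_left]
      push_cast
      rw [← mul_assoc, inv_mul_cancel₀ hc, one_mul])
  have h8 := h7.2 (p₀ + 1) (by omega)
  have hs := contDiffAt_line hd.ordGE.1 (radial t)
  have h9 : iteratedDeriv (p₀ + 1) (fun ρ : ℝ => ((Wb (ρ • radial t) : ℝ) : ℂ)) 0
      = ((iteratedDeriv (p₀ + 1) (fun ρ : ℝ => Wb (ρ • radial t)) 0 : ℝ) : ℂ) := by
    simp only [iteratedDeriv]
    change iteratedFDeriv ℝ (p₀ + 1) (Complex.ofRealCLM ∘ _) 0 _ = _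
    rw [Complex.ofRealCLM.iteratedFDeriv_comp_left hs (by exact_mod_cast le_top)]
    rfl
  rw [h9, iteratedDeriv_line hd.ordGE.1] at h8
  exact_mod_cast h8

/-- The initial values of order zero which enter the principal part of the equations. -/
lemma init_ups_zero (hd : IsStaticUpToOrder p₀ a h U W Wb) (hP : IsRadialTransport a h P)
    (hsol : IsTransportSolution h P (conformalFactor U (W + Wb)) υ φ)
    (hstatic : IsTransportSolution h P (conformalFactor U W) υs φs) (t : SU2) :
    (∀ j, υs 0 0 t (.c 0 j) = 0) ∧ (∀ j, υs 0 0 t (.c 1 j) = 0) ∧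
    (∀ j, υs 0 0 t (.c 2 j) = if j = 0 then (√2 : ℂ)⁻¹ else 0) ∧
    (∀ j, υs 0 0 t (.c 3 j) = if j = 2 then -(√2 : ℂ)⁻¹ else 0) ∧
    (∀ i j, υs 0 0 t (.chi i j) = 0) ∧ (∀ j, υs 0 0 t (.f j) = xsp (fst j) (snd j)) ∧
    (∀ i j, υs 0 0 t (.Th i j) = 0) ∧ (∀ j, υs 0 0 t (.trTh j) = 0) := by
  have hi := hstatic.init_ups t
  have hc := contDiffAt_frame hd.static.a_pos hP t
  refine ⟨fun j => ?_, fun j => ?_, fun j => ?_, fun j => ?_, fun i j => ?_, fun j => ?_,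
    fun i j => ?_, fun j => ?_⟩
  · exact (hi (.c 0 j)).zero_eq (G := fun _ => 0) contDiffAt_const
      (Eventually.of_forall fun ρ => rfl)
  · rw [(hi (.c 1 j)).zero_eq (G := fun ρ => (ρ : ℂ) * xsp (fst j) (snd j))
      ((contDiffAt_ofReal contDiffAt_id).mul contDiffAt_const) (Eventually.of_forall fun ρ => rfl)]
    simp
  · rw [(hi (.c 2 j)).zero_eq (G := fun ρ => cPlus P ρ t (fst j) (snd j))
      (contDiffAt_const.mul (ContDiffAt.sum fun i _ => (hc _ _ i).mul contDiffAt_const))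
      (Eventually.of_forall fun ρ => rfl)]
    simp only [cPlus, frame_zero hP, frame0_dot]
    fin_cases j <;> simp [hsp, eps, fst, snd]
    norm_num
  · rw [(hi (.c 3 j)).zero_eq (G := fun ρ => cMinus P ρ t (fst j) (snd j))
      (contDiffAt_const.mul (ContDiffAt.sum fun i _ => (hc _ _ i).mul contDiffAt_const))
      (Eventually.of_forall fun ρ => rfl)]
    simp only [cMinus, frame_zero hP, frame0_dot]
    fin_cases j <;> simp [hsp, eps, fst, snd]
    norm_num
  · exact (hi (.chi i j)).zero_eq (G := fun _ => 0) contDiffAt_const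
      (Eventually.of_forall fun ρ => rfl)
  · exact (hi (.f j)).zero_eq (G := fun _ => xsp (fst j) (snd j)) contDiffAt_const
      (Eventually.of_forall fun ρ => rfl)
  · exact (Th_jet_eq hd hP t i j (hsol.init_ups t _) (hi _)).2
  · exact (hi (.trTh j)).zero_eq (G := fun _ => 0) contDiffAt_const
      (Eventually.of_forall fun ρ => rfl)

end Init

/-! ### Uniqueness for the equations for `υ` -/

instance : Finite Idx :=
  Finite.of_surjective (fun q : Fin 6 × Fin 4 × Fin 3 × Fin 3 =>
    match q with
    | (0, μ, j, _) => Idx.c μ j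
    | (1, _, i, j) => Idx.xi i j
    | (2, _, i, j) => Idx.chi i j
    | (3, _, j, _) => Idx.f j
    | (4, _, i, j) => Idx.Th i j
    | (5, _, j, _) => Idx.trTh j) fun k => by
      cases k with
      | c μ j => exact ⟨(0, μ, j, 0), rfl⟩
      | xi i j => exact ⟨(1, 0, i, j), rfl⟩
      | chi i j => exact ⟨(2, 0, i, j), rfl⟩
      | f j => exact ⟨(3, 0, j, 0), rfl⟩
      | Th i j => exact ⟨(4, 0, i, j), rfl⟩
      | trTh j => exact ⟨(5, 0, j, 0), rfl⟩

instance : Fintype Idx := Fintype.ofFinite Idx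

lemma exists_bilinear_bound {X Y Z : Type*} [NormedAddCommGroup X] [NormedSpace ℂ X]
    [NormedAddCommGroup Y] [NormedSpace ℂ Y] [NormedAddCommGroup Z] [NormedSpace ℂ Z]
    [FiniteDimensional ℂ X] [FiniteDimensional ℂ Y] (B : X →ₗ[ℂ] Y →ₗ[ℂ] Z) :
    ∃ C, 0 ≤ C ∧ ∀ x y, ‖B x y‖ ≤ C * ‖x‖ * ‖y‖ := by
  let B' : X →L[ℂ] Y →L[ℂ] Z := LinearMap.toContinuousLinearMap
    ((LinearMap.toContinuousLinearMap : (Y →ₗ[ℂ] Z) ≃ₗ[ℂ] (Y →L[ℂ] Z)).toLinearMap ∘ₗ B)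
  exact ⟨‖B'‖, B'.opNorm_nonneg, fun x y => B'.le_opNorm₂ x y⟩

lemma exists_linear_bound {X Z : Type*} [NormedAddCommGroup X] [NormedSpace ℂ X]
    [NormedAddCommGroup Z] [NormedSpace ℂ Z] [FiniteDimensional ℂ X] (B : X →ₗ[ℂ] Z) :
    ∃ C, 0 ≤ C ∧ ∀ x, ‖B x‖ ≤ C * ‖x‖ :=
  ⟨‖LinearMap.toContinuousLinearMap B‖, norm_nonneg _,
    fun x => (LinearMap.toContinuousLinearMap B).le_opNorm x⟩

/-- `K` as a linear map. -/
def KLin : Ups →ₗ[ℂ] Ups where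
  toFun := K
  map_add' u v := by
    funext k
    rcases k with ⟨μ, j⟩ | _ | _ | _ | _ | _
    · fin_cases μ <;> simp [K]; ring
    all_goals simp [K]
    all_goals ring
  map_smul' c u := by
    funext k
    rcases k with ⟨μ, j⟩ | _ | _ | _ | _ | _
    · fin_cases μ <;> simp [K]
    all_goals simp [K]
    all_goals ring

/-- `Q` as a bilinear map. -/
def QLin : Ups →ₗ[ℂ] Ups →ₗ[ℂ] Ups :=
  LinearMap.mk₂ ℂ Q
    (fun u v w => by funext k; cases k <;> simp [Q, contract, chiF, Fin.sum_univ_two] <;> ring)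
    (fun c u v => by funext k; cases k <;> simp [Q, contract, chiF, Fin.sum_univ_two] <;> ring)
    (fun u v w => by funext k; cases k <;> simp [Q, contract, chiF, Fin.sum_univ_two] <;> ring)
    (fun c u v => by funext k; cases k <;> simp [Q, contract, chiF, Fin.sum_univ_two] <;> ring)

lemma K_sub (u v : Ups) : K (u - v) = K u - K v := KLin.map_sub u v

lemma Q_sub_left (u v w : Ups) : Q (u - v) w = Q u w - Q v w := QLin.map_sub₂ u v w

lemma Q_sub_right (u v w : Ups) : Q u (v - w) = Q u v - Q u w := (QLin u).map_sub v w

lemma gronwall_zero_forward {X : Type*} [NormedAddCommGroup X] [NormedSpace ℝ X] {δ δ' : ℝ → X}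
    {T C : ℝ} (hd : ∀ τ ∈ Icc 0 T, HasDerivAt δ (δ' τ) τ)
    (hb : ∀ τ ∈ Icc 0 T, ‖δ' τ‖ ≤ C * ‖δ τ‖) (h0 : δ 0 = 0) : ∀ τ ∈ Icc 0 T, δ τ = 0 := by
  intro τ hτ
  have := norm_le_gronwallBound_of_norm_deriv_right_le (f := δ) (f' := δ') (δ := 0) (K := C)
    (ε := 0) (a := 0) (b := T) (fun s hs => (hd s hs).continuousAt.continuousWithinAt)
    (fun s hs => (hd s ⟨hs.1, hs.2.le⟩).hasDerivWithinAt) (by simp [h0])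
    (fun s hs => by simpa using hb s ⟨hs.1, hs.2.le⟩) τ hτ
  rw [gronwallBound_ε0_δ0] at this
  exact norm_le_zero_iff.1 this

/-- Uniqueness for differential inequalities on `(-1, 1)`. -/
lemma gronwall_zero {X : Type*} [NormedAddCommGroup X] [NormedSpace ℝ X] {δ δ' : ℝ → X}
    (hd : ∀ τ ∈ Ioo (-1 : ℝ) 1, HasDerivAt δ (δ' τ) τ)
    (hb : ∀ T < 1, ∃ C, ∀ τ ∈ Icc (-T) T, ‖δ' τ‖ ≤ C * ‖δ τ‖) (h0 : δ 0 = 0) :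
    ∀ τ ∈ Ioo (-1 : ℝ) 1, δ τ = 0 := by
  intro τ hτ
  obtain ⟨C, hC⟩ := hb |τ| (abs_lt.2 hτ)
  have hI : ∀ s, |s| ≤ |τ| → s ∈ Ioo (-1 : ℝ) 1 := fun s hs =>
    abs_lt.1 (hs.trans_lt (abs_lt.2 hτ))
  rcases le_total 0 τ with h | h
  · rw [abs_of_nonneg h] at hC hI
    exact gronwall_zero_forward (δ' := δ') (T := τ) (C := C)
      (fun s hs => hd s (hI s (by rw [abs_of_nonneg hs.1]; exact hs.2)))
      (fun s hs => hC s ⟨by linarith [hs.1], hs.2⟩) h0 τ ⟨h, le_rfl⟩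
  · rw [abs_of_nonpos h] at hC hI
    have := gronwall_zero_forward (δ := fun s => δ (-s)) (δ' := fun s => -δ' (-s)) (T := -τ)
      (C := C) (fun s hs => by
        have h1 := hd (-s) (hI (-s) (by rw [abs_neg, abs_of_nonneg hs.1]; exact hs.2))
        have h2 := h1.scomp s (hasDerivAt_neg s)
        rwa [neg_one_smul] at h2)
      (fun s hs => by
        rw [norm_neg]
        exact hC (-s) ⟨by linarith [hs.2], by linarith [hs.1, hs.2]⟩) (by simpa using h0)
      (-τ) ⟨by linarith, le_rfl⟩
    simpa using this

lemma exists_bound_on_Icc {X : Type*} [NormedAddCommGroup X] {v : ℝ → X}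
    (hv : ContinuousOn v (Ioo (-1) 1)) {T : ℝ} (hT : T < 1) :
    ∃ C, 0 ≤ C ∧ ∀ τ ∈ Icc (-T) T, ‖v τ‖ ≤ C := by
  obtain ⟨C, hC⟩ := isCompact_Icc.exists_bound_of_continuousOn
    (hv.mono (fun s (hs : s ∈ Icc (-T) T) => ⟨by linarith [hs.1], by linarith [hs.2]⟩))
  exact ⟨max C 0, le_max_right _ _, fun τ hτ => (hC τ hτ).trans (le_max_left _ _)⟩

/-- Two coefficient functions are allowed because at order zero the difference of quadratic terms is
Q(υ, δ) + Q(δ, υs). They are only known to be continuous on the open interval, so Gronwall constants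
are taken on each [-T, T] with T < 1. -/
lemma ups_linear_unique {δ v w : ℝ → Ups}
    (hδ : ∀ τ ∈ Ioo (-1 : ℝ) 1, ∀ k, HasDerivAt (fun s => δ s k)
      (K (δ τ) k + (Q (v τ) (δ τ) k + Q (δ τ) (w τ) k)) τ)
    (hv : ContinuousOn v (Ioo (-1) 1)) (hw : ContinuousOn w (Ioo (-1) 1)) (h0 : δ 0 = 0) :
    ∀ τ ∈ Ioo (-1 : ℝ) 1, δ τ = 0 := by
  refine gronwall_zero (δ' := fun τ => K (δ τ) + (Q (v τ) (δ τ) + Q (δ τ) (w τ)))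
    (fun τ hτ => hasDerivAt_pi.2 fun k => hδ τ hτ k) (fun T hT => ?_) h0
  obtain ⟨a, ha, hK⟩ := exists_linear_bound KLin
  obtain ⟨b, hb, hQ⟩ := exists_bilinear_bound QLin
  obtain ⟨Cv, hCv, hv'⟩ := exists_bound_on_Icc hv hT
  obtain ⟨Cw, hCw, hw'⟩ := exists_bound_on_Icc hw hT
  refine ⟨a + b * Cv + b * Cw, fun τ hτ => ?_⟩
  have h1 := hK (δ τ)
  have h2 := hQ (v τ) (δ τ)
  have h3 := hQ (δ τ) (w τ)
  have h4 : b * ‖v τ‖ * ‖δ τ‖ ≤ b * Cv * ‖δ τ‖ := by gcongr; exact hv' τ hτ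
  have h5 : b * ‖δ τ‖ * ‖w τ‖ ≤ b * Cw * ‖δ τ‖ := by
    rw [mul_right_comm]; gcongr; exact hw' τ hτ
  calc ‖K (δ τ) + (Q (v τ) (δ τ) + Q (δ τ) (w τ))‖
      ≤ ‖K (δ τ)‖ + (‖Q (v τ) (δ τ)‖ + ‖Q (δ τ) (w τ)‖) :=
        (norm_add_le _ _).trans (by gcongr; exact norm_add_le _ _)
    _ ≤ a * ‖δ τ‖ + (b * Cv * ‖δ τ‖ + b * Cw * ‖δ τ‖) :=
        add_le_add h1 (add_le_add (h2.trans h4) (h3.trans h5))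
    _ = _ := by ring

/-! ### The equations for `υ` -/

/-- At ρ = 0 all coefficients of L vanish, which decouples υ of order p from φ of the same order. -/
lemma L_zero (φ : Phi) : L 0 0 0 φ = 0 := by
  funext k
  cases k <;> simp [L, dMu, contract]

section Evolution

variable {p₀ : ℕ} {a : ℝ} {h : MetricField} {U W Wb : E3 → ℝ}
  {P : E3 → Matrix (Fin 3) (Fin 3) ℝ} {υ υs : ℕ → ℝ → SU2 → Ups} {φ φs : ℕ → ℝ → SU2 → Phi}

lemma IsTransportSolution.continuousOn_ups {Ω : E3 → ℝ} (hsol : IsTransportSolution h P Ω υ φ)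
    (p : ℕ) (t : SU2) : ContinuousOn (fun τ => υ p τ t) (Ioo (-1) 1) := by
  obtain ⟨Th, dTh, d, -, -, h3⟩ := hsol.transport_ups
  exact continuousOn_pi.2 fun k τ hτ => (h3 p τ hτ t k).continuousAt.continuousWithinAt

/-- The difference in order p satisfies a linear homogeneous ODE for each fixed t: the source terms
contain lower orders of φ only, and in the quadratic terms υ of order p is multiplied by υ of order
zero. -/
lemma ups_eq_of_lower (hd : IsStaticUpToOrder p₀ a h U W Wb) (hP : IsRadialTransport a h P)
    (hsol : IsTransportSolution h P (conformalFactor U (W + Wb)) υ φ)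
    (hstatic : IsTransportSolution h P (conformalFactor U W) υs φs) {p : ℕ} (hp : p ≤ p₀ + 1)
    (hυ : ∀ j < p, ∀ τ ∈ Ioo (-1 : ℝ) 1, ∀ t, υ j τ t = υs j τ t)
    (hφ : ∀ j < p, ∀ τ ∈ Ioo (-1 : ℝ) 1, ∀ t, φ j τ t = φs j τ t) :
    ∀ τ ∈ Ioo (-1 : ℝ) 1, ∀ t, υ p τ t = υs p τ t := by
  intro τ₀ hτ₀ t
  obtain ⟨Th, dTh, d, h1, h2, h3⟩ := hsol.transport_ups
  obtain ⟨Ths, dThs, ds, k1, k2, k3⟩ := hstatic.transport_ups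
  have eTh : ∀ τ ∈ Ioo (-1 : ℝ) 1, (∀ j ≤ p₀ + 1, Th j τ t = Ths j τ t) ∧ Ths 0 τ t = 0 :=
    fun τ hτ => Theta_jet_eq hd t τ (h1 τ hτ t).1 (k1 τ hτ t).1
  have edTh : ∀ τ ∈ Ioo (-1 : ℝ) 1, (∀ j ≤ p₀ + 1, dTh j τ t = dThs j τ t) ∧ dThs 0 τ t = 0 :=
    fun τ hτ => deriv_Theta_jet_eq hd t τ (h1 τ hτ t).2 (k1 τ hτ t).2
  have ed : (∀ j ≤ p₀ + 1, d j t = ds j t) ∧ ds 0 t = 0 :=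
    ⟨fun j hj => funext fun i => (dForm_jet_eq hd hP t i (h2 t i) (k2 t i)).1 j hj,
      funext fun i => (dForm_jet_eq hd hP t i (h2 t i) (k2 t i)).2⟩
  rw [← sub_eq_zero]
  refine ups_linear_unique (δ := fun τ => υ p τ t - υs p τ t) (v := fun τ => υ 0 τ t)
    (w := fun τ => υs 0 τ t) (fun τ hτ k => ?_) (hsol.continuousOn_ups 0 t)
    (hstatic.continuousOn_ups 0 t) (by rw [init_ups_eq hd hP hsol hstatic hp t, sub_self]) τ₀ hτ₀
  refine ((h3 p τ hτ t k).sub (k3 p τ hτ t k)).congr_deriv ?_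
  have eL : ∀ j ≤ p, L (Th j τ t) (dTh j τ t) (d j t) (φ (p - j) τ t) k
      = L (Ths j τ t) (dThs j τ t) (ds j t) (φs (p - j) τ t) k := by
    intro j hj
    rw [(eTh τ hτ).1 j (hj.trans hp), (edTh τ hτ).1 j (hj.trans hp), ed.1 j (hj.trans hp)]
    rcases Nat.eq_zero_or_pos j with rfl | hj0
    · rw [(eTh τ hτ).2, (edTh τ hτ).2, ed.2, L_zero, L_zero]
    · rw [hφ (p - j) (by omega) τ hτ t]
  have hsum : ∀ j ∈ Finset.range (p + 1), (p.choose j : ℂ) * (Q (υ j τ t) (υ (p - j) τ t) k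
      + L (Th j τ t) (dTh j τ t) (d j t) (φ (p - j) τ t) k) - (p.choose j : ℂ) *
      (Q (υs j τ t) (υs (p - j) τ t) k + L (Ths j τ t) (dThs j τ t) (ds j t) (φs (p - j) τ t) k)
      = (p.choose j : ℂ) * (Q (υ j τ t) (υ (p - j) τ t) k - Q (υs j τ t) (υs (p - j) τ t) k) := by
    intro j hj
    rw [eL j (Nat.lt_succ_iff.1 (Finset.mem_range.1 hj))]
    ring
  have e1 : ∀ A B S S' : ℂ, (A + S) - (B + S') = (A - B) + (S - S') := fun A B S S' => by ring
  rw [e1, ← Finset.sum_sub_distrib, Finset.sum_congr rfl hsum, K_sub, Pi.sub_apply, Q_sub_left,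
    Q_sub_right, Pi.sub_apply, Pi.sub_apply]
  congr 1
  -- For p = 0 the single term telescopes. For p > 0 the terms j = 0 and j = p are distinct and
  -- carry the unknown; all terms in between cancel.
  rcases p with _ | q
  · simp
  · rw [Finset.sum_range_succ, Finset.sum_range_succ', Finset.sum_eq_zero]
    · simp only [Nat.choose_zero_right, Nat.choose_self, Nat.sub_self, Nat.sub_zero,
        hυ 0 (Nat.succ_pos q) τ hτ t]
      push_cast
      ring
    · intro j hj
      rw [Finset.mem_range] at hj
      rw [hυ (j + 1) (by omega) τ hτ t, hυ (q + 1 - (j + 1)) (by omega) τ hτ t, sub_self, mul_zero]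

/-- The frame coefficients on the cylinder. -/
lemma ups_zero_frame (hd : IsStaticUpToOrder p₀ a h U W Wb) (hP : IsRadialTransport a h P)
    (hsol : IsTransportSolution h P (conformalFactor U (W + Wb)) υ φ)
    (hstatic : IsTransportSolution h P (conformalFactor U W) υs φs)
    {τ : ℝ} (hτ : τ ∈ Ioo (-1 : ℝ) 1) (t : SU2) :
    (∀ j, υs 0 τ t (.c 0 j) = -τ * xsp (fst j) (snd j)) ∧ (∀ j, υs 0 τ t (.c 1 j) = 0) ∧
    (∀ j, υs 0 τ t (.c 2 j) = if j = 0 then (√2 : ℂ)⁻¹ else 0) ∧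
    (∀ j, υs 0 τ t (.c 3 j) = if j = 2 then -(√2 : ℂ)⁻¹ else 0) := by
  obtain ⟨i0, i1, i2, i3, i4, i5, i6, i7⟩ := init_ups_zero hd hP hsol hstatic t
  obtain ⟨Th, dTh, d, h1, h2, -⟩ := hsol.transport_ups
  obtain ⟨Ths, dThs, ds, k1, k2, k3⟩ := hstatic.transport_ups
  -- The explicit solution of order zero: χ and Θ_{ABCD} vanish and ξ, f, c^ρ, c^± keep their
  -- initial values, while ∂_τ c^τ = -f gives c^τ = -τx. All quadratic terms vanish with χ.
  let uc : ℝ → Ups := fun τ k => match k with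
    | .c μ j => if μ = 0 then -τ * xsp (fst j) (snd j) else υs 0 0 t (.c μ j)
    | .xi i j => υs 0 0 t (.xi i j)
    | .chi _ _ => 0
    | .f j => xsp (fst j) (snd j)
    | .Th _ _ => 0
    | .trTh _ => 0
  have hK : ∀ τ, Q (uc τ) (uc τ) = 0 := by
    intro τ
    funext k
    cases k <;> simp [Q, contract, chiF, uc]
  have huc : ∀ τ k, HasDerivAt (fun s => uc s k) (K (uc τ) k) τ := by
    intro τ k
    cases k with
    | c μ j =>
      by_cases hμ : μ = 0
      · subst hμ
        have h4 : HasDerivAt (fun s : ℝ => -(s : ℂ) * xsp (fst j) (snd j))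
            (-1 * xsp (fst j) (snd j)) τ := by
          have := ((hasDerivAt_id τ).ofReal_comp.neg).mul_const (xsp (fst j) (snd j))
          simpa using this
        have h5 : K (uc τ) (.c 0 j) = -1 * xsp (fst j) (snd j) := by simp [K, uc]
        rw [h5]
        simpa [uc] using h4
      · have h5 : K (uc τ) (.c μ j) = 0 := by
          fin_cases μ
          · exact absurd rfl hμ
          all_goals rfl
        rw [h5]
        simpa [uc, hμ] using hasDerivAt_const τ (υs 0 0 t (.c μ j))
    | _ =>
      simp only [K, uc, mul_zero, add_zero, neg_zero]
      exact hasDerivAt_const _ _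
  have huc0 : υs 0 0 t - uc 0 = 0 := by
    funext k
    cases k with
    | c μ j =>
      by_cases hμ : μ = 0
      · subst hμ; simp [uc, i0]
      · simp [uc, hμ]
    | _ => simp [uc, i4, i5, i6, i7]
  have hcont : ContinuousOn uc (Ioo (-1) 1) := continuousOn_pi.2 fun k τ _ =>
    (huc τ k).continuousAt.continuousWithinAt
  have key := ups_linear_unique (δ := fun τ => υs 0 τ t - uc τ) (v := fun τ => υs 0 τ t)
    (w := uc) (fun τ hτ k => by
      refine ((k3 0 τ hτ t k).sub (huc τ k)).congr_deriv ?_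
      have hL := L_zero (φs 0 τ t)
      have e1 := (Theta_jet_eq hd t τ (h1 τ hτ t).1 (k1 τ hτ t).1).2
      have e2 := (deriv_Theta_jet_eq hd t τ (h1 τ hτ t).2 (k1 τ hτ t).2).2
      have e3 : ds 0 t = 0 := funext fun i => (dForm_jet_eq hd hP t i (h2 t i) (k2 t i)).2
      rw [K_sub, Q_sub_left, Q_sub_right]
      simp [e1, e2, e3, hL, hK]
      ring) (hstatic.continuousOn_ups 0 t) hcont huc0 τ hτ
  have key' : υs 0 τ t = uc τ := sub_eq_zero.1 key
  rw [key']
  refine ⟨fun j => by simp [uc], fun j => ?_, fun j => ?_, fun j => ?_⟩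
  · simp [uc, i1]
  · rw [← i2]; simp [uc]
  · rw [← i3]; simp [uc]

end Evolution

/-! ### Topology of `SU(2)` and its chart -/

instance : IsTopologicalGroup SU2 where
  continuous_mul := by
    refine continuous_induced_rng.2 ?_
    exact (continuous_subtype_val.comp continuous_fst).matrix_mul
      (continuous_subtype_val.comp continuous_snd)
  continuous_inv := by
    refine continuous_induced_rng.2 ?_
    exact continuous_subtype_val.matrix_conjTranspose

lemma SU2.normSq_add (t : SU2) (j : Fin 2) : ‖t.1 0 j‖ ^ 2 + ‖t.1 1 j‖ ^ 2 = 1 := by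
  have h := SU2.det_eq t
  have key : (‖t.1 0 j‖ : ℂ) ^ 2 + (‖t.1 1 j‖ : ℂ) ^ 2 = 1 := by
    rw [← Complex.mul_conj', ← Complex.mul_conj']
    fin_cases j
    · simp only [Fin.zero_eta, SU2.conj_00, SU2.conj_10]; linear_combination h
    · simp only [Fin.mk_one, SU2.conj_01, SU2.conj_11]; linear_combination h
  exact_mod_cast key

/-- A closed subset of the matrices with entries of modulus at most 1. -/
instance : CompactSpace SU2 := by
  refine isCompact_iff_compactSpace.1 ?_
  have hcl : IsClosed ((Matrix.specialUnitaryGroup (Fin 2) ℂ : Submonoid _) :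
      Set (Matrix (Fin 2) (Fin 2) ℂ)) := by
    have : ((Matrix.specialUnitaryGroup (Fin 2) ℂ : Submonoid _) : Set (Matrix (Fin 2) (Fin 2) ℂ))
        = {A | A * star A = 1} ∩ {A | A.det = 1} := by
      ext A
      simp [Matrix.mem_specialUnitaryGroup_iff, Matrix.mem_unitaryGroup_iff]
    rw [this]
    exact (isClosed_eq (continuous_id.matrix_mul continuous_id.matrix_conjTranspose)
      continuous_const).inter (isClosed_eq continuous_id.matrix_det continuous_const)
  have hK : IsCompact (Set.univ.pi fun _ : Fin 2 => Set.univ.pi fun _ : Fin 2 =>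
      Metric.closedBall (0 : ℂ) 1) :=
    isCompact_univ_pi fun _ => isCompact_univ_pi fun _ => isCompact_closedBall _ _
  refine IsCompact.of_isClosed_subset hK hcl fun A hA => ?_
  have h := SU2.normSq_add ⟨A, hA⟩
  intro i _ j _
  have hj := h j
  change ‖A 0 j‖ ^ 2 + ‖A 1 j‖ ^ 2 = 1 at hj
  simp only [Metric.mem_closedBall, dist_zero_right]
  have := sq_nonneg ‖A 0 j‖
  have := sq_nonneg ‖A 1 j‖
  fin_cases i
  · exact abs_le_of_sq_le_sq' (by rw [one_pow]; change ‖A 0 j‖ ^ 2 ≤ 1; linarith) zero_le_one |>.2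
  · exact abs_le_of_sq_le_sq' (by rw [one_pow]; change ‖A 1 j‖ ^ 2 ≤ 1; linarith) zero_le_one |>.2

lemma SU2.ext_coe {s t : SU2} (h0 : s.1 0 0 = t.1 0 0) (h1 : s.1 1 0 = t.1 1 0) : s = t := by
  have e0 : s.1 1 1 = t.1 1 1 := by rw [← SU2.conj_00, ← SU2.conj_00, h0]
  have e1 : s.1 0 1 = t.1 0 1 := by
    rw [← neg_inj, ← SU2.conj_10, ← SU2.conj_10, h1]
  ext i j
  fin_cases i <;> fin_cases j <;> assumption

/-- An element of `SU(2)` in the domain of the chart is recognised by its ray. -/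
lemma eq_chart {g : SU2} {c : ℝ} {v : Fin 3 → ℝ} (hc : 0 < c)
    (h0 : g.1 0 0 = c * (1 + Complex.I * v 2 / 2))
    (h1 : g.1 1 0 = c * ((Complex.I * v 0 + v 1) / 2)) : g = chart v := by
  have hn := SU2.normSq_add g 0
  have n0 : ‖g.1 0 0‖ ^ 2 = c ^ 2 * (1 + (v 2) ^ 2 / 4) := by
    rw [h0, Complex.sq_norm, Complex.normSq_apply]; simp; ring
  have n1 : ‖g.1 1 0‖ ^ 2 = c ^ 2 * ((v 0) ^ 2 / 4 + (v 1) ^ 2 / 4) := by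
    rw [h1, Complex.sq_norm, Complex.normSq_apply]; simp; ring
  have hc2 : (√(1 + (v 0 ^ 2 + v 1 ^ 2 + v 2 ^ 2) / 4))⁻¹ = c := by
    rw [← Real.sqrt_inv, Real.sqrt_eq_iff_mul_self_eq_of_pos hc]
    rw [n0, n1] at hn
    have : c * c * (1 + (v 0 ^ 2 + v 1 ^ 2 + v 2 ^ 2) / 4) = 1 := by linarith
    exact eq_inv_of_mul_eq_one_left this
  refine SU2.ext_coe ?_ ?_
  · rw [h0]; simp [chart, onePlus, hc2]
  · rw [h1]; simp [chart, onePlus, hc2]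

lemma chart_zero : chart 0 = 1 :=
  (eq_chart (c := 1) one_pos (by simp) (by simp)).symm

/-- The product of `SU(2)` in the chart. -/
def chartMul (v w : Fin 3 → ℝ) : Fin 3 → ℝ :=
  (1 - (v 0 * w 0 + v 1 * w 1 + v 2 * w 2) / 4)⁻¹ •
    ![v 0 + w 0 + (v 1 * w 2 - v 2 * w 1) / 2, v 1 + w 1 + (v 2 * w 0 - v 0 * w 2) / 2,
      v 2 + w 2 + (v 0 * w 1 - v 1 * w 0) / 2]

/-- Multiplication of unit quaternions in central projection. The hypothesis says that the product
has positive real part, hence stays in the open hemisphere covered by the chart. -/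
lemma chart_mul {v w : Fin 3 → ℝ} (h : 0 < 1 - (v 0 * w 0 + v 1 * w 1 + v 2 * w 2) / 4) :
    chart v * chart w = chart (chartMul v w) := by
  set d : ℝ := 1 - (v 0 * w 0 + v 1 * w 1 + v 2 * w 2) / 4 with hd
  have hd0 : (d : ℂ) ≠ 0 := by exact_mod_cast h.ne'
  have hdc : (d : ℂ) = 1 - (v 0 * w 0 + v 1 * w 1 + v 2 * w 2) / 4 := by rw [hd]; push_cast; ring
  have pv : 0 < (√(1 + (v 0 ^ 2 + v 1 ^ 2 + v 2 ^ 2) / 4))⁻¹ := by positivity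
  have pw : 0 < (√(1 + (w 0 ^ 2 + w 1 ^ 2 + w 2 ^ 2) / 4))⁻¹ := by positivity
  refine eq_chart (mul_pos (mul_pos pv pw) h) ?_ ?_
  · simp only [chart, onePlus, Submonoid.coe_mul, Matrix.mul_apply, Fin.sum_univ_two,
      Matrix.smul_apply, smul_eq_mul, chartMul, ← hd, Pi.smul_apply]
    generalize (√(1 + (v 0 ^ 2 + v 1 ^ 2 + v 2 ^ 2) / 4))⁻¹ = α
    generalize (√(1 + (w 0 ^ 2 + w 1 ^ 2 + w 2 ^ 2) / 4))⁻¹ = β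
    simp
    field_simp
    rw [hdc]
    linear_combination α * β * (v 2 * w 2 + v 0 * w 0 : ℂ) * Complex.I_sq
  · simp only [chart, onePlus, Submonoid.coe_mul, Matrix.mul_apply, Fin.sum_univ_two,
      Matrix.smul_apply, smul_eq_mul, chartMul, ← hd, Pi.smul_apply]
    generalize (√(1 + (v 0 ^ 2 + v 1 ^ 2 + v 2 ^ 2) / 4))⁻¹ = α
    generalize (√(1 + (w 0 ^ 2 + w 1 ^ 2 + w 2 ^ 2) / 4))⁻¹ = β
    simp
    field_simp
    linear_combination α * β * (v 0 * w 2 - v 2 * w 0 : ℂ) * Complex.I_sq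

/-- The inverse of the chart, on `Re t₀₀ > 0`. -/
def chartInv (t : SU2) : Fin 3 → ℝ :=
  (t.1 0 0).re⁻¹ • ![2 * (t.1 1 0).im, 2 * (t.1 1 0).re, 2 * (t.1 0 0).im]

lemma chart_chartInv {t : SU2} (h : 0 < (t.1 0 0).re) : chart (chartInv t) = t := by
  have h' : (((t.1 0 0).re : ℝ) : ℂ) ≠ 0 := by exact_mod_cast h.ne'
  refine (eq_chart h ?_ ?_).symm
  · simp [chartInv]
    field_simp
    conv_lhs => rw [← Complex.re_add_im (t.1 0 0)]
    ring
  · simp [chartInv]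
    field_simp
    conv_lhs => rw [← Complex.re_add_im (t.1 1 0)]
    ring

lemma continuous_coe_apply (i j : Fin 2) : Continuous fun t : SU2 => t.1 i j :=
  continuous_subtype_val.matrix_elem i j

lemma continuousAt_chartInv_one : ContinuousAt chartInv 1 := by
  have h0 := (continuous_coe_apply 0 0)
  have h1 := (continuous_coe_apply 1 0)
  unfold chartInv
  refine ContinuousAt.smul (ContinuousAt.inv₀ (Complex.continuous_re.comp h0).continuousAt
    (by simp)) (Continuous.continuousAt ?_)
  refine continuous_pi fun i => ?_
  have c1 := Complex.continuous_re.comp h0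
  have c2 := Complex.continuous_im.comp h0
  have c3 := Complex.continuous_re.comp h1
  have c4 := Complex.continuous_im.comp h1
  fin_cases i <;> simp <;> fun_prop

lemma chartInv_one : chartInv 1 = 0 := by
  ext i; fin_cases i <;> simp [chartInv]

/-- `SmoothOnCylinder` tests functions only in translated charts. Continuity descends to the group
because the chart has a right inverse near 1 that is continuous there. -/
lemma continuousAt_of_chart {X Y : Type*} [TopologicalSpace X] [TopologicalSpace Y]
    {F : X → SU2 → Y} {x : X} {t : SU2}
    (h : ContinuousAt (fun q : X × (Fin 3 → ℝ) => F q.1 (t * chart q.2)) (x, 0)) :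
    ContinuousAt (fun q : X × SU2 => F q.1 q.2) (x, t) := by
  have hm : ContinuousAt (fun q : X × SU2 => t⁻¹ * q.2) (x, t) := by fun_prop
  have hm1 : t⁻¹ * t = 1 := inv_mul_cancel t
  have hI : ContinuousAt (fun q : X × SU2 => chartInv (t⁻¹ * q.2)) (x, t) :=
    ContinuousAt.comp (g := chartInv) (by simpa [hm1] using continuousAt_chartInv_one) hm
  have h2 : ContinuousAt (fun q : X × SU2 => F q.1 (t * chart (chartInv (t⁻¹ * q.2)))) (x, t) := by
    refine ContinuousAt.comp (g := fun q : X × (Fin 3 → ℝ) => F q.1 (t * chart q.2))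
      (f := fun q : X × SU2 => (q.1, chartInv (t⁻¹ * q.2))) ?_ (continuousAt_fst.prodMk hI)
    simpa [hm1, chartInv_one] using h
  refine h2.congr ?_
  have hre : ContinuousAt (fun q : X × SU2 => ((t⁻¹ * q.2).1 0 0).re) (x, t) :=
    ContinuousAt.comp (g := fun s : SU2 => (s.1 0 0).re)
      (Complex.continuous_re.comp (continuous_coe_apply 0 0)).continuousAt hm
  have hpos : ∀ᶠ q : X × SU2 in 𝓝 (x, t), 0 < ((t⁻¹ * q.2).1 0 0).re :=
    hre.eventually (lt_mem_nhds (by simp [hm1]))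
  filter_upwards [hpos] with q hq
  rw [chart_chartInv hq, mul_inv_cancel_left]

/-! ### Smooth functions on the cylinder -/

namespace SmoothOnCylinder

variable {F G : ℝ → SU2 → ℂ}

lemma add (hF : SmoothOnCylinder F) (hG : SmoothOnCylinder G) :
    SmoothOnCylinder fun τ t => F τ t + G τ t := fun t => (hF t).add (hG t)

lemma sub (hF : SmoothOnCylinder F) (hG : SmoothOnCylinder G) :
    SmoothOnCylinder fun τ t => F τ t - G τ t := fun t => (hF t).sub (hG t)

lemma mul (hF : SmoothOnCylinder F) (hG : SmoothOnCylinder G) :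
    SmoothOnCylinder fun τ t => F τ t * G τ t := fun t => (hF t).mul (hG t)

lemma conj (hF : SmoothOnCylinder F) :
    SmoothOnCylinder fun τ t => (starRingEnd ℂ) (F τ t) := fun t =>
  Complex.conjCLE.contDiff.comp_contDiffOn (hF t)

lemma of_real {f : ℝ → ℝ} (hf : ContDiff ℝ ∞ f) : SmoothOnCylinder fun τ _ => (f τ : ℂ) := fun _ =>
  (Complex.ofRealCLM.contDiff.comp (hf.comp contDiff_fst)).contDiffOn

lemma contDiffAt (hF : SmoothOnCylinder F) {τ : ℝ} (hτ : τ ∈ Ioo (-1 : ℝ) 1) (t : SU2)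
    (v : Fin 3 → ℝ) :
    ContDiffAt ℝ ∞ (fun q : ℝ × (Fin 3 → ℝ) => F q.1 (t * chart q.2)) (τ, v) :=
  (hF t).contDiffAt (prod_mem_nhds (Ioo_mem_nhds hτ.1 hτ.2) univ_mem)

lemma continuousOn (hF : SmoothOnCylinder F) :
    ContinuousOn (fun q : ℝ × SU2 => F q.1 q.2) (Ioo (-1) 1 ×ˢ univ) := fun q hq =>
  (continuousAt_of_chart (hF.contDiffAt hq.1 q.2 0).continuousAt).continuousWithinAt

lemma continuous (hF : SmoothOnCylinder F) {τ : ℝ} (hτ : τ ∈ Ioo (-1 : ℝ) 1) :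
    Continuous (F τ) :=
  hF.continuousOn.comp_continuous (continuous_const.prodMk continuous_id) fun _ => ⟨hτ, trivial⟩

lemma hasDerivAt_chart (hF : SmoothOnCylinder F) {τ : ℝ} (hτ : τ ∈ Ioo (-1 : ℝ) 1) (t : SU2)
    (v : Fin 3 → ℝ) : HasDerivAt (fun s => F s (t * chart v))
      (fderiv ℝ (fun q : ℝ × (Fin 3 → ℝ) => F q.1 (t * chart q.2)) (τ, v) (1, 0)) τ := by
  have h := ((hF.contDiffAt hτ t v).differentiableAt (by simp)).hasFDerivAt
  exact HasFDerivAt.comp_hasDerivAt (f := fun s : ℝ => (s, v)) τ h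
    ((hasDerivAt_id τ).prodMk (hasDerivAt_const τ v))

lemma hasDerivAt (hF : SmoothOnCylinder F) {τ : ℝ} (hτ : τ ∈ Ioo (-1 : ℝ) 1) (t : SU2) :
    HasDerivAt (fun s => F s t) (_root_.deriv (fun s => F s t) τ) τ := by
  have h := hF.hasDerivAt_chart hτ t 0
  simp only [chart_zero, mul_one] at h
  exact h.differentiableAt.hasDerivAt

lemma fderiv_apply (hF : SmoothOnCylinder F) (t : SU2) {w : (Fin 3 → ℝ) → ℝ × (Fin 3 → ℝ)}
    (hw : ContDiff ℝ ∞ w) : ContDiffOn ℝ ∞ (fun q : ℝ × (Fin 3 → ℝ) =>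
      fderiv ℝ (fun q : ℝ × (Fin 3 → ℝ) => F q.1 (t * chart q.2)) q (w q.2))
    (Ioo (-1) 1 ×ˢ univ) :=
  ((hF t).fderiv_of_isOpen (isOpen_Ioo.prod isOpen_univ) le_rfl).clm_apply
    (hw.comp contDiff_snd).contDiffOn

lemma deriv (hF : SmoothOnCylinder F) :
    SmoothOnCylinder fun τ t => _root_.deriv (fun s => F s t) τ := fun t =>
  (hF.fderiv_apply t contDiff_const).congr fun q hq => (hF.hasDerivAt_chart hq.1 t q.2).deriv

end SmoothOnCylinder

/-- The left-invariant vector fields in the chart. -/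
def chartField (k : Fin 3) (v : Fin 3 → ℝ) : Fin 3 → ℝ :=
  let u : Fin 3 → ℝ := Pi.single k 1
  fun i => (v 0 * u 0 + v 1 * u 1 + v 2 * u 2) / 4 * v i + ![u 0 + (v 1 * u 2 - v 2 * u 1) / 2,
    u 1 + (v 2 * u 0 - v 0 * u 2) / 2, u 2 + (v 0 * u 1 - v 1 * u 0) / 2] i

lemma contDiff_chartField (k : Fin 3) : ContDiff ℝ ∞ (chartField k) := by
  refine contDiff_pi.2 fun i => ?_
  unfold chartField
  fin_cases i <;> simp <;> fun_prop

lemma hasDerivAt_inv_mul (a b c : ℝ) :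
    HasDerivAt (fun s : ℝ => (1 - s * a)⁻¹ * (c + s * b)) (a * c + b) 0 := by
  have h1 : HasDerivAt (fun s : ℝ => 1 - s * a) (-(1 * a)) 0 :=
    ((hasDerivAt_id (0 : ℝ)).mul_const a).const_sub 1
  have h2 : HasDerivAt (fun s : ℝ => c + s * b) (1 * b) 0 :=
    ((hasDerivAt_id (0 : ℝ)).mul_const b).const_add c
  refine ((h1.inv (by simp)).mul h2).congr_deriv ?_
  simp

lemma hasDerivAt_chartMul (k : Fin 3) (v : Fin 3 → ℝ) :
    HasDerivAt (fun s => chartMul v (Pi.single k s)) (chartField k v) 0 := by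
  refine hasDerivAt_pi.2 fun i => ?_
  have hs : ∀ s : ℝ, (Pi.single k s : Fin 3 → ℝ) = s • Pi.single k 1 := fun s => by
    rw [← Pi.single_smul, smul_eq_mul, mul_one]
  generalize hu : (Pi.single k 1 : Fin 3 → ℝ) = u at hs
  have h := hasDerivAt_inv_mul ((v 0 * u 0 + v 1 * u 1 + v 2 * u 2) / 4)
    (![u 0 + (v 1 * u 2 - v 2 * u 1) / 2, u 1 + (v 2 * u 0 - v 0 * u 2) / 2,
      u 2 + (v 0 * u 1 - v 1 * u 0) / 2] i) (v i)
  refine (h.congr_of_eventuallyEq (Eventually.of_forall fun s => ?_)).congr_deriv ?_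
  · simp only [chartMul, hs, Pi.smul_apply, smul_eq_mul]
    congr 1
    · ring
    · fin_cases i <;> simp <;> ring
  · simp only [chartField, hu]

lemma chartMul_zero (v : Fin 3 → ℝ) : chartMul v 0 = v := by
  ext i; fin_cases i <;> simp [chartMul]

namespace SmoothOnCylinder

variable {F G : ℝ → SU2 → ℂ}

/-- For small s the product of chart elements lies again in the chart, at `chartMul v (Pi.single k
s)`, so the left-invariant field is the coordinate field `chartField`. Its smoothness makes
left-invariant derivatives smooth on the cylinder again. -/
lemma hasDerivAt_leftInv_chart (hF : SmoothOnCylinder F) {τ : ℝ} (hτ : τ ∈ Ioo (-1 : ℝ) 1)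
    (k : Fin 3) (t : SU2) (v : Fin 3 → ℝ) :
    HasDerivAt (fun s : ℝ => F τ (t * chart v * chart (Pi.single k s)))
      (fderiv ℝ (fun q : ℝ × (Fin 3 → ℝ) => F q.1 (t * chart q.2)) (τ, v) (0, chartField k v))
      0 := by
  have h := ((hF.contDiffAt hτ t v).differentiableAt (by simp)).hasFDerivAt
  have h0 : chartMul v (Pi.single k 0) = v := by rw [Pi.single_zero, chartMul_zero]
  have h1 := HasFDerivAt.comp_hasDerivAt (f := fun s : ℝ => (τ, chartMul v (Pi.single k s))) 0
    (by simpa only [h0] using h) ((hasDerivAt_const (0 : ℝ) τ).prodMk (hasDerivAt_chartMul k v))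
  refine h1.congr_of_eventuallyEq ?_
  have hc : Continuous fun s : ℝ => 1 - (v 0 * (Pi.single k s : Fin 3 → ℝ) 0
      + v 1 * (Pi.single k s : Fin 3 → ℝ) 1 + v 2 * (Pi.single k s : Fin 3 → ℝ) 2) / 4 := by
    have hs : Continuous fun s : ℝ => (Pi.single k s : Fin 3 → ℝ) := by
      refine continuous_pi fun i => ?_
      by_cases hi : i = k
      · subst hi; simpa using continuous_id'
      · simpa [hi] using continuous_const
    have h' := fun i => (continuous_apply i).comp hs
    have e0 := h' 0
    have e1 := h' 1
    have e2 := h' 2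
    simp only [Function.comp_def] at e0 e1 e2
    fun_prop
  filter_upwards [hc.continuousAt.eventually (lt_mem_nhds (a := 0) (by simp))] with s hs
  simp only [Function.comp_apply]
  rw [mul_assoc, chart_mul hs]

lemma leftInv (hF : SmoothOnCylinder F) (k : Fin 3) :
    SmoothOnCylinder fun τ t => SpatialInfinity.leftInv k (F τ) t := fun t =>
  (hF.fderiv_apply t (contDiff_const.prodMk (contDiff_chartField k))).congr fun q hq =>
    (hF.hasDerivAt_leftInv_chart hq.1 k t q.2).deriv

lemma hasDerivAt_leftInv (hF : SmoothOnCylinder F) {τ : ℝ} (hτ : τ ∈ Ioo (-1 : ℝ) 1)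
    (k : Fin 3) (t : SU2) : HasDerivAt (fun s : ℝ => F τ (t * chart (Pi.single k s)))
      (SpatialInfinity.leftInv k (F τ) t) 0 := by
  have h := hF.hasDerivAt_leftInv_chart hτ k t 0
  simp only [chart_zero, mul_one] at h
  exact h.differentiableAt.hasDerivAt

/-- The derivative along a coordinate line of the chart away from its origin. -/
lemma hasDerivAt_translate (hF : SmoothOnCylinder F) {τ : ℝ} (hτ : τ ∈ Ioo (-1 : ℝ) 1)
    (k : Fin 3) (t : SU2) (r : ℝ) : HasDerivAt (fun s : ℝ => F τ (t * chart (Pi.single k s)))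
      (((1 + r ^ 2 / 4)⁻¹ : ℝ) •
        SpatialInfinity.leftInv k (F τ) (t * chart (Pi.single k r))) r := by
  -- On a one-parameter subgroup the chart composes as (r + m)/(1 - rm/4), like tangents of half
  -- angles. The parameter m of the factor leading from r to s is (s - r)/(1 + sr/4).
  have hm : HasDerivAt (fun s : ℝ => (s - r) / (1 + s * r / 4)) (1 + r ^ 2 / 4)⁻¹ r := by
    have h1 : HasDerivAt (fun s : ℝ => s - r) 1 r := (hasDerivAt_id r).sub_const r
    have h2 : HasDerivAt (fun s : ℝ => 1 + s * r / 4) (1 * r / 4) r :=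
      (((hasDerivAt_id r).mul_const r).div_const 4).const_add 1
    have h3 : 1 + r * r / 4 ≠ 0 := by nlinarith [mul_self_nonneg r]
    refine (h1.div h2 h3).congr_deriv ?_
    have h4 : 1 + r ^ 2 / 4 ≠ 0 := by positivity
    field_simp
    ring
  have h := hF.hasDerivAt_leftInv hτ k (t * chart (Pi.single k r))
  have h0 : (r - r) / (1 + r * r / 4) = 0 := by simp
  rw [← h0] at h
  refine (h.scomp r hm).congr_of_eventuallyEq ?_
  have c1 : ContinuousAt (fun s : ℝ => 1 + s * r / 4) r := by fun_prop
  have c2 : ContinuousAt (fun s : ℝ => 1 - r * ((s - r) / (1 + s * r / 4)) / 4) r := by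
    have := hm.continuousAt
    fun_prop
  filter_upwards [c1.eventually (lt_mem_nhds (a := 0) (by nlinarith [mul_self_nonneg r])),
    c2.eventually (lt_mem_nhds (a := 0) (by simp))] with s hs hs2
  simp only [Function.comp_apply, mul_assoc]
  set m := (s - r) / (1 + s * r / 4)
  have hsum : (Pi.single k r : Fin 3 → ℝ) 0 * (Pi.single k m : Fin 3 → ℝ) 0
      + (Pi.single k r : Fin 3 → ℝ) 1 * (Pi.single k m : Fin 3 → ℝ) 1
      + (Pi.single k r : Fin 3 → ℝ) 2 * (Pi.single k m : Fin 3 → ℝ) 2 = r * m := by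
    fin_cases k <;> simp
  rw [chart_mul (by rw [hsum]; exact hs2)]
  congr 3
  have hval : (1 - r * m / 4)⁻¹ * (r + m) = s := by
    have hmD : m * (1 + s * r / 4) = s - r := div_mul_cancel₀ _ hs.ne'
    rw [inv_mul_eq_div, div_eq_iff hs2.ne']
    linear_combination hmD
  rw [chartMul, hsum]
  fin_cases k <;> ext i <;> fin_cases i <;> simp [hval]

end SmoothOnCylinder

/-! ### Integration over `SU(2)` -/

open MeasureTheory

instance : MeasurableSpace SU2 := borel SU2

instance : BorelSpace SU2 := ⟨rfl⟩

/-- A measure on `SU(2)` which is invariant under right translations. -/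
def rightHaar : Measure SU2 := (Measure.haar : Measure SU2).inv

instance : IsFiniteMeasure rightHaar := by unfold rightHaar Measure.inv; infer_instance

instance : rightHaar.IsMulRightInvariant := by unfold rightHaar; infer_instance

instance : rightHaar.IsOpenPosMeasure := by
  unfold rightHaar; infer_instance

lemma integrable_rightHaar {X : Type*} [NormedAddCommGroup X]
    [SecondCountableTopology X] {f : SU2 → X} (hf : Continuous f) :
    Integrable f rightHaar := by
  obtain ⟨C, hC⟩ := isCompact_univ.exists_bound_of_continuousOn hf.continuousOn
  exact Integrable.of_bound hf.aestronglyMeasurable C (Eventually.of_forall fun t => hC t trivial)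

lemma SmoothOnCylinder.exists_bound {F : ℝ → SU2 → ℂ} (hF : SmoothOnCylinder F) {T : ℝ}
    (hT : T < 1) : ∃ C, 0 ≤ C ∧ ∀ τ ∈ Icc (-T) T, ∀ t, ‖F τ t‖ ≤ C := by
  have hK : IsCompact (Icc (-T) T ×ˢ (univ : Set SU2)) := isCompact_Icc.prod isCompact_univ
  obtain ⟨C, hC⟩ := hK.exists_bound_of_continuousOn (hF.continuousOn.mono
    (prod_mono_left (Icc_subset_Ioo (by linarith) hT)))
  exact ⟨max C 0, le_max_right _ _, fun τ hτ t => (hC (τ, t) ⟨hτ, trivial⟩).trans (le_max_left _ _)⟩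

lemma SmoothOnCylinder.hasDerivAt_integral {F : ℝ → SU2 → ℂ} (hF : SmoothOnCylinder F) {τ : ℝ}
    (hτ : τ ∈ Ioo (-1 : ℝ) 1) : HasDerivAt (fun s => ∫ t, F s t ∂rightHaar)
      (∫ t, _root_.deriv (fun s => F s t) τ ∂rightHaar) τ := by
  obtain ⟨T, hT, hT1⟩ := exists_between (abs_lt.2 hτ)
  obtain ⟨C, -, hC⟩ := hF.deriv.exists_bound hT1
  have hT' := abs_lt.1 hT
  refine (hasDerivAt_integral_of_dominated_loc_of_deriv_le (bound := fun _ => C)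
    (F' := fun r t => _root_.deriv (fun s => F s t) r)
    (Icc_mem_nhds hT'.1 hT'.2) ?_ (integrable_rightHaar (hF.continuous hτ))
    (hF.deriv.continuous hτ).aestronglyMeasurable (Eventually.of_forall fun t s hs => hC s hs t)
    (integrable_const C) (Eventually.of_forall fun t s hs =>
      hF.hasDerivAt (Icc_subset_Ioo (by linarith) hT1 hs) t)).2
  filter_upwards [Ioo_mem_nhds hτ.1 hτ.2] with s hs
  exact (hF.continuous hs).aestronglyMeasurable

/-- Left-invariant fields generate right translations, under which the integral is constant;
differentiation at s = 0 gives the claim. For dominated convergence the derivative is needed at all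
s: `SmoothOnCylinder.hasDerivAt_translate` bounds it by the supremum of the left-invariant
derivative, as its factor is at most 1. -/
lemma SmoothOnCylinder.integral_leftInv {F : ℝ → SU2 → ℂ} (hF : SmoothOnCylinder F) {τ : ℝ}
    (hτ : τ ∈ Ioo (-1 : ℝ) 1) (k : Fin 3) :
    ∫ t, SpatialInfinity.leftInv k (F τ) t ∂rightHaar = 0 := by
  have hcl := (hF.leftInv k).continuous hτ
  have hcF := hF.continuous hτ
  have hcl0 : Continuous fun t => SpatialInfinity.leftInv k (F τ) (t * chart (Pi.single k 0)) :=
    hcl.comp (continuous_mul_const _)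
  obtain ⟨C, hC⟩ := isCompact_univ.exists_bound_of_continuousOn hcl.continuousOn
  have h := (hasDerivAt_integral_of_dominated_loc_of_deriv_le (μ := rightHaar)
    (bound := fun _ => C) (x₀ := (0 : ℝ)) (s := univ)
    (F := fun s t => F τ (t * chart (Pi.single k s)))
    (F' := fun r t => (((1 + r ^ 2 / 4)⁻¹ : ℝ) •
        SpatialInfinity.leftInv k (F τ) (t * chart (Pi.single k r)))) univ_mem
    (Eventually.of_forall fun s => (hcF.comp (continuous_mul_const _)).aestronglyMeasurable)
    (integrable_rightHaar (hcF.comp (continuous_mul_const _)))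
    (Continuous.aestronglyMeasurable (by fun_prop))
    (Eventually.of_forall fun t r _ => by
      rw [norm_smul, Real.norm_of_nonneg (by positivity)]
      refine (mul_le_of_le_one_left (norm_nonneg _) ?_).trans (hC _ trivial)
      exact inv_le_one_of_one_le₀ (by nlinarith [sq_nonneg r]))
    (integrable_const C)
    (Eventually.of_forall fun t r _ => hF.hasDerivAt_translate hτ k t r)).2
  have hconst : (fun s : ℝ => ∫ t, F τ (t * chart (Pi.single k s)) ∂rightHaar)
      = fun _ => ∫ t, F τ t ∂rightHaar :=
    funext fun s => integral_mul_right_eq_self (F τ) _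
  rw [hconst] at h
  have h0 := h.unique (hasDerivAt_const 0 _)
  simpa [chart_zero] using h0

lemma SmoothOnCylinder.Xplus {F : ℝ → SU2 → ℂ} (hF : SmoothOnCylinder F) :
    SmoothOnCylinder fun τ t => SpatialInfinity.Xplus (F τ) t := fun t =>
  ((hF.leftInv 1 t).add (contDiffOn_const.mul (hF.leftInv 0 t))).neg

lemma SmoothOnCylinder.Xminus {F : ℝ → SU2 → ℂ} (hF : SmoothOnCylinder F) :
    SmoothOnCylinder fun τ t => SpatialInfinity.Xminus (F τ) t := fun t =>
  ((hF.leftInv 1 t).sub (contDiffOn_const.mul (hF.leftInv 0 t))).neg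

lemma SmoothOnCylinder.integral_Xplus {F : ℝ → SU2 → ℂ} (hF : SmoothOnCylinder F) {τ : ℝ}
    (hτ : τ ∈ Ioo (-1 : ℝ) 1) : ∫ t, SpatialInfinity.Xplus (F τ) t ∂rightHaar = 0 := by
  unfold SpatialInfinity.Xplus
  rw [integral_neg, integral_add (integrable_rightHaar ((hF.leftInv 1).continuous hτ))
    ((integrable_rightHaar ((hF.leftInv 0).continuous hτ)).const_mul _), integral_const_mul,
    hF.integral_leftInv hτ, hF.integral_leftInv hτ]
  simp

lemma SmoothOnCylinder.integral_Xminus {F : ℝ → SU2 → ℂ} (hF : SmoothOnCylinder F) {τ : ℝ}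
    (hτ : τ ∈ Ioo (-1 : ℝ) 1) : ∫ t, SpatialInfinity.Xminus (F τ) t ∂rightHaar = 0 := by
  unfold SpatialInfinity.Xminus
  rw [integral_neg, integral_sub (integrable_rightHaar ((hF.leftInv 1).continuous hτ))
    ((integrable_rightHaar ((hF.leftInv 0).continuous hτ)).const_mul _), integral_const_mul,
    hF.integral_leftInv hτ, hF.integral_leftInv hτ]
  simp

lemma SmoothOnCylinder.leftInv_mul {F G : ℝ → SU2 → ℂ} (hF : SmoothOnCylinder F)
    (hG : SmoothOnCylinder G) {τ : ℝ} (hτ : τ ∈ Ioo (-1 : ℝ) 1) (k : Fin 3) (t : SU2) :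
    SpatialInfinity.leftInv k (fun s => F τ s * G τ s) t
      = SpatialInfinity.leftInv k (F τ) t * G τ t + F τ t * SpatialInfinity.leftInv k (G τ) t := by
  have h := ((hF.hasDerivAt_leftInv hτ k t).mul (hG.hasDerivAt_leftInv hτ k t)).deriv
  simp only [Pi.single_zero, chart_zero, mul_one] at h
  exact h

lemma SmoothOnCylinder.leftInv_conj {F : ℝ → SU2 → ℂ} (hF : SmoothOnCylinder F) {τ : ℝ}
    (hτ : τ ∈ Ioo (-1 : ℝ) 1) (k : Fin 3) (t : SU2) :
    SpatialInfinity.leftInv k (fun s => (starRingEnd ℂ) (F τ s)) t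
      = (starRingEnd ℂ) (SpatialInfinity.leftInv k (F τ) t) :=
  (hF.hasDerivAt_leftInv hτ k t).star.deriv

lemma SmoothOnCylinder.leftInv_sub {F G : ℝ → SU2 → ℂ} (hF : SmoothOnCylinder F)
    (hG : SmoothOnCylinder G) {τ : ℝ} (hτ : τ ∈ Ioo (-1 : ℝ) 1) (k : Fin 3) (t : SU2) :
    SpatialInfinity.leftInv k (fun s => F τ s - G τ s) t
      = SpatialInfinity.leftInv k (F τ) t - SpatialInfinity.leftInv k (G τ) t :=
  ((hF.hasDerivAt_leftInv hτ k t).sub (hG.hasDerivAt_leftInv hτ k t)).deriv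

/-- Conjugation interchanges X₊ and X₋, so after integration the adjoint of X₊ is -X₋. -/
lemma SmoothOnCylinder.Xplus_conj_mul {F G : ℝ → SU2 → ℂ} (hF : SmoothOnCylinder F)
    (hG : SmoothOnCylinder G) {τ : ℝ} (hτ : τ ∈ Ioo (-1 : ℝ) 1) (t : SU2) :
    SpatialInfinity.Xplus (fun s => (starRingEnd ℂ) (F τ s) * G τ s) t
      = (starRingEnd ℂ) (SpatialInfinity.Xminus (F τ) t) * G τ t
        + (starRingEnd ℂ) (F τ t) * SpatialInfinity.Xplus (G τ) t := by
  simp only [SpatialInfinity.Xplus, SpatialInfinity.Xminus, hF.conj.leftInv_mul hG hτ,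
    hF.leftInv_conj hτ, map_neg, map_sub, map_mul, Complex.conj_I]
  ring

lemma SmoothOnCylinder.Xminus_conj_mul {F G : ℝ → SU2 → ℂ} (hF : SmoothOnCylinder F)
    (hG : SmoothOnCylinder G) {τ : ℝ} (hτ : τ ∈ Ioo (-1 : ℝ) 1) (t : SU2) :
    SpatialInfinity.Xminus (fun s => (starRingEnd ℂ) (F τ s) * G τ s) t
      = (starRingEnd ℂ) (SpatialInfinity.Xplus (F τ) t) * G τ t
        + (starRingEnd ℂ) (F τ t) * SpatialInfinity.Xminus (G τ) t := by
  simp only [SpatialInfinity.Xplus, SpatialInfinity.Xminus, hF.conj.leftInv_mul hG hτ,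
    hF.leftInv_conj hτ, map_neg, map_add, map_mul, Complex.conj_I]
  ring

/-! ### The Bianchi equations on the cylinder -/

lemma divPhi_add_left (u v : Ups) (dφ : Fin 4 → Phi) (φ : Phi) (E B C D : Fin 2) :
    divPhi (u + v) dφ φ E B C D = divPhi u dφ φ E B C D + divPhi v dφ φ E B C D := by
  simp only [divPhi, Gam, ← Finset.sum_add_distrib, ← mul_add, Pi.add_apply]
  refine Finset.sum_congr rfl fun A _ => Finset.sum_congr rfl fun P _ => ?_
  simp only [Fin.sum_univ_two, Fin.sum_univ_four]
  ring

lemma divPhi_smul_left (c : ℂ) (u : Ups) (dφ : Fin 4 → Phi) (φ : Phi) (E B C D : Fin 2) :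
    divPhi (c • u) dφ φ E B C D = c * divPhi u dφ φ E B C D := by
  simp only [divPhi, Gam, Finset.mul_sum, Pi.smul_apply, smul_eq_mul]
  refine Finset.sum_congr rfl fun A _ => Finset.sum_congr rfl fun P _ => ?_
  simp only [Fin.sum_univ_two, Fin.sum_univ_four]
  ring

lemma divPhi_add_right (u : Ups) (dφ dψ : Fin 4 → Phi) (φ ψ : Phi) (E B C D : Fin 2) :
    divPhi u (dφ + dψ) (φ + ψ) E B C D = divPhi u dφ φ E B C D + divPhi u dψ ψ E B C D := by
  simp only [divPhi, ← Finset.sum_add_distrib, ← mul_add, Pi.add_apply]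
  refine Finset.sum_congr rfl fun A _ => Finset.sum_congr rfl fun P _ => ?_
  simp only [Fin.sum_univ_two, Fin.sum_univ_four]
  ring

lemma divPhi_smul_right (c : ℂ) (u : Ups) (dφ : Fin 4 → Phi) (φ : Phi) (E B C D : Fin 2) :
    divPhi u (c • dφ) (c • φ) E B C D = c * divPhi u dφ φ E B C D := by
  simp only [divPhi, Finset.mul_sum, Pi.smul_apply, smul_eq_mul]
  refine Finset.sum_congr rfl fun A _ => Finset.sum_congr rfl fun P _ => ?_
  simp only [Fin.sum_univ_two, Fin.sum_univ_four]
  ring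

/-- The Bianchi operator as a bilinear map. -/
def bianchiLin : Ups →ₗ[ℂ] ((Fin 4 → Phi) × Phi) →ₗ[ℂ] Phi :=
  LinearMap.mk₂ ℂ (fun u d => bianchi u d.1 d.2)
    (fun u v d => by
      funext k
      fin_cases k <;> simp [bianchi, divPhi_add_left] <;> ring)
    (fun c u d => by
      funext k
      fin_cases k <;> simp [bianchi, divPhi_smul_left] <;> ring)
    (fun u d d' => by
      funext k
      fin_cases k <;> simp [bianchi, divPhi_add_right] <;> ring)
    (fun c u d => by
      funext k
      fin_cases k <;> simp [bianchi, divPhi_smul_right] <;> ring)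

/-- Setting the undifferentiated φ to zero removes the connection terms and leaves the principal
part; the ρ-derivative drops out with c^ρ. -/
lemma bianchi_cylinder {u : Ups} {τ : ℝ} (h0 : ∀ j, u (.c 0 j) = -τ * xsp (fst j) (snd j))
    (h1 : ∀ j, u (.c 1 j) = 0) (h2 : ∀ j, u (.c 2 j) = if j = 0 then (√2 : ℂ)⁻¹ else 0)
    (h3 : ∀ j, u (.c 3 j) = if j = 2 then -(√2 : ℂ)⁻¹ else 0) (dφ : Fin 4 → Phi) :
    bianchi u dφ 0 = (√2 : ℂ) • ![τ * dφ 0 0 + dφ 2 1, (1 / 2) * (dφ 3 0 + dφ 2 2),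
      (1 / 2) * (dφ 3 1 + dφ 2 3), (1 / 2) * (dφ 3 2 + dφ 2 4), -τ * dφ 0 4 + dφ 3 3] := by
  have hs : (√2 : ℂ)⁻¹ = (1 / 2) * √2 := by
    refine inv_eq_of_mul_eq_one_right ?_
    linear_combination (1 / 2) * sqrt_two_sq
  funext k
  fin_cases k <;>
    simp [bianchi, divPhi, Fin.sum_univ_two, Fin.sum_univ_four, h0, h1, h2, h3, eps, pr, quad, xsp,
      fst, snd, hs] <;> ring

/-! ### The energy estimate -/

open MeasureTheory

/-- The energy density of the Bianchi equations on the cylinder. -/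
def energyDensity (ψ : ℝ → SU2 → Phi) (τ : ℝ) (t : SU2) : ℂ :=
  ((1 + τ : ℝ) : ℂ) * ((starRingEnd ℂ) (ψ τ t 0) * ψ τ t 0)
    + ((2 : ℝ) : ℂ) * ((starRingEnd ℂ) (ψ τ t 1) * ψ τ t 1
      + (starRingEnd ℂ) (ψ τ t 2) * ψ τ t 2 + (starRingEnd ℂ) (ψ τ t 3) * ψ τ t 3)
    + ((1 - τ : ℝ) : ℂ) * ((starRingEnd ℂ) (ψ τ t 4) * ψ τ t 4)

lemma energyDensity_eq (ψ : ℝ → SU2 → Phi) (τ : ℝ) (t : SU2) :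
    energyDensity ψ τ t = (((1 + τ) * ‖ψ τ t 0‖ ^ 2 + 2 * (‖ψ τ t 1‖ ^ 2 + ‖ψ τ t 2‖ ^ 2
      + ‖ψ τ t 3‖ ^ 2) + (1 - τ) * ‖ψ τ t 4‖ ^ 2 : ℝ) : ℂ) := by
  simp only [energyDensity, Complex.conj_mul']
  push_cast
  ring

/-- On [-T, T] the weights 1 + τ, 2 and 1 - τ are all at least 1 - T. Coercivity degenerates at τ =
±1, which is why all estimates are made for T < 1. -/
lemma norm_sq_le_energyDensity (ψ : ℝ → SU2 → Phi) {T τ : ℝ} (hT : T < 1)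
    (hτ : τ ∈ Icc (-T) T) (t : SU2) : (1 - T) * ‖ψ τ t‖ ^ 2 ≤ (energyDensity ψ τ t).re := by
  rw [energyDensity_eq, Complex.ofReal_re]
  have hT1 : 0 ≤ 1 - T := by linarith
  have n := fun j => sq_nonneg ‖ψ τ t j‖
  have hT2 : -1 ≤ T := by have := hτ.1.trans hτ.2; linarith
  set S := ‖ψ τ t 0‖ ^ 2 + ‖ψ τ t 1‖ ^ 2 + ‖ψ τ t 2‖ ^ 2 + ‖ψ τ t 3‖ ^ 2 + ‖ψ τ t 4‖ ^ 2 with hS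
  have hS0 : 0 ≤ S := by have := n 0; have := n 1; have := n 2; have := n 3; have := n 4; linarith
  have h1 : ‖ψ τ t‖ ≤ √S := by
    refine (pi_norm_le_iff_of_nonneg (Real.sqrt_nonneg _)).2 fun j => Real.le_sqrt_of_sq_le ?_
    have := n 0; have := n 1; have := n 2; have := n 3; have := n 4
    fin_cases j <;> simp only [Fin.zero_eta, Fin.mk_one, Fin.reduceFinMk] <;> linarith
  have h2 : ‖ψ τ t‖ ^ 2 ≤ S := by
    have := pow_le_pow_left₀ (norm_nonneg _) h1 2
    rwa [Real.sq_sqrt hS0] at this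
  refine (mul_le_mul_of_nonneg_left h2 hT1).trans ?_
  nlinarith [mul_nonneg (by linarith [hτ.1] : 0 ≤ τ + T) (n 0),
    mul_nonneg (by linarith [hτ.2] : 0 ≤ T - τ) (n 4), mul_nonneg (by linarith : 0 ≤ 1 + T) (n 1),
    mul_nonneg (by linarith : 0 ≤ 1 + T) (n 2), mul_nonneg (by linarith : 0 ≤ 1 + T) (n 3)]

lemma smooth_energyDensity {ψ : ℝ → SU2 → Phi} (hψ : ∀ j, SmoothOnCylinder fun τ t => ψ τ t j) :
    SmoothOnCylinder (energyDensity ψ) := by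
  have h := fun j => (hψ j).conj.mul (hψ j)
  exact (((SmoothOnCylinder.of_real (contDiff_const.add contDiff_id)).mul (h 0)).add
    ((SmoothOnCylinder.of_real contDiff_const).mul (((h 1).add (h 2)).add (h 3)))).add
    ((SmoothOnCylinder.of_real (contDiff_const.sub contDiff_id)).mul (h 4))

lemma hasDerivAt_energyDensity {ψ : ℝ → SU2 → Phi} {D : Phi} {τ : ℝ} {t : SU2}
    (hD : ∀ j, HasDerivAt (fun s => ψ s t j) (D j) τ) :
    HasDerivAt (fun s => energyDensity ψ s t)
      ((starRingEnd ℂ) (ψ τ t 0) * ψ τ t 0 - (starRingEnd ℂ) (ψ τ t 4) * ψ τ t 4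
        + ((starRingEnd ℂ) ((1 + τ) * D 0) * ψ τ t 0 + (starRingEnd ℂ) (ψ τ t 0) * ((1 + τ) * D 0))
        + 2 * ((starRingEnd ℂ) (D 1) * ψ τ t 1 + (starRingEnd ℂ) (ψ τ t 1) * D 1)
        + 2 * ((starRingEnd ℂ) (D 2) * ψ τ t 2 + (starRingEnd ℂ) (ψ τ t 2) * D 2)
        + 2 * ((starRingEnd ℂ) (D 3) * ψ τ t 3 + (starRingEnd ℂ) (ψ τ t 3) * D 3)
        + ((starRingEnd ℂ) ((1 - τ) * D 4) * ψ τ t 4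
          + (starRingEnd ℂ) (ψ τ t 4) * ((1 - τ) * D 4))) τ := by
  have h : ∀ j, HasDerivAt (fun s => (starRingEnd ℂ) (ψ s t j) * ψ s t j)
      ((starRingEnd ℂ) (D j) * ψ τ t j + (starRingEnd ℂ) (ψ τ t j) * D j) τ :=
    fun j => (hD j).star.mul (hD j)
  have a0 : HasDerivAt (fun s : ℝ => ((1 + s : ℝ) : ℂ)) ((1 : ℝ) : ℂ) τ :=
    ((hasDerivAt_id τ).const_add 1).ofReal_comp
  have a4 : HasDerivAt (fun s : ℝ => ((1 - s : ℝ) : ℂ)) ((-1 : ℝ) : ℂ) τ :=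
    ((hasDerivAt_id τ).const_sub 1).ofReal_comp
  refine (((a0.mul (h 0)).add ((((h 1).add (h 2)).add (h 3)).const_mul ((2 : ℝ) : ℂ))).add
    (a4.mul (h 4))).congr_deriv ?_
  simp only [map_mul, map_add, map_sub, map_one, Complex.conj_ofReal]
  push_cast
  ring

/-- Uniqueness for symmetric hyperbolic systems on the cylinder with the principal part of the
Bianchi equations. -/
lemma eq_zero_of_bianchi {ψ N : ℝ → SU2 → Phi} (hψ : ∀ j, SmoothOnCylinder fun τ t => ψ τ t j)
    (h0 : ∀ t, ψ 0 t = 0)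
    (e0 : ∀ τ ∈ Ioo (-1 : ℝ) 1, ∀ t, (1 + τ) * deriv (fun s => ψ s t 0) τ
      + Xplus (fun s => ψ τ s 1) t = N τ t 0)
    (e1 : ∀ τ ∈ Ioo (-1 : ℝ) 1, ∀ t, deriv (fun s => ψ s t 1) τ
      + (1 / 2) * (Xminus (fun s => ψ τ s 0) t + Xplus (fun s => ψ τ s 2) t) = N τ t 1)
    (e2 : ∀ τ ∈ Ioo (-1 : ℝ) 1, ∀ t, deriv (fun s => ψ s t 2) τ
      + (1 / 2) * (Xminus (fun s => ψ τ s 1) t + Xplus (fun s => ψ τ s 3) t) = N τ t 2)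
    (e3 : ∀ τ ∈ Ioo (-1 : ℝ) 1, ∀ t, deriv (fun s => ψ s t 3) τ
      + (1 / 2) * (Xminus (fun s => ψ τ s 2) t + Xplus (fun s => ψ τ s 4) t) = N τ t 3)
    (e4 : ∀ τ ∈ Ioo (-1 : ℝ) 1, ∀ t, (1 - τ) * deriv (fun s => ψ s t 4) τ
      + Xminus (fun s => ψ τ s 3) t = N τ t 4)
    (hN : ∀ T < 1, ∃ C, 0 ≤ C ∧ ∀ τ ∈ Icc (-T) T, ∀ t, ‖N τ t‖ ≤ C * ‖ψ τ t‖) :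
    ∀ τ ∈ Ioo (-1 : ℝ) 1, ∀ t, ψ τ t = 0 := by
  have he := smooth_energyDensity hψ
  have gp : ∀ j : Fin 4, SmoothOnCylinder fun τ t =>
      (starRingEnd ℂ) (ψ τ t j.castSucc) * ψ τ t j.succ := fun j => (hψ _).conj.mul (hψ _)
  have gm : ∀ j : Fin 4, SmoothOnCylinder fun τ t =>
      (starRingEnd ℂ) (ψ τ t j.succ) * ψ τ t j.castSucc := fun j => (hψ _).conj.mul (hψ _)
  -- With weights 1, 2, 2, 2, 1 the system is symmetric, and the X₊, X₋ terms in the energy identity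
  -- add up to this total divergence, whose integral is zero.
  let div : ℝ → SU2 → ℂ := fun τ t => ∑ j : Fin 4,
    (Xplus (fun s => (starRingEnd ℂ) (ψ τ s j.castSucc) * ψ τ s j.succ) t
      + Xminus (fun s => (starRingEnd ℂ) (ψ τ s j.succ) * ψ τ s j.castSucc) t)
  have hint : ∀ τ ∈ Ioo (-1 : ℝ) 1, ∀ j : Fin 4, Integrable (fun t =>
      Xplus (fun s => (starRingEnd ℂ) (ψ τ s j.castSucc) * ψ τ s j.succ) t
      + Xminus (fun s => (starRingEnd ℂ) (ψ τ s j.succ) * ψ τ s j.castSucc) t) rightHaar :=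
    fun τ hτ j => (integrable_rightHaar ((gp j).Xplus.continuous hτ)).add
      (integrable_rightHaar ((gm j).Xminus.continuous hτ))
  have hdiv : ∀ τ ∈ Ioo (-1 : ℝ) 1, ∫ t, div τ t ∂rightHaar = 0 := fun τ hτ => by
    rw [integral_finsetSum _ fun j _ => hint τ hτ j]
    refine Finset.sum_eq_zero fun j _ => ?_
    rw [integral_add (integrable_rightHaar ((gp j).Xplus.continuous hτ))
      (integrable_rightHaar ((gm j).Xminus.continuous hτ)), (gp j).integral_Xplus hτ,
      (gm j).integral_Xminus hτ, add_zero]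
  have hR : ∀ τ ∈ Ioo (-1 : ℝ) 1, ∀ t, deriv (fun s => energyDensity ψ s t) τ + div τ t
      = (starRingEnd ℂ) (ψ τ t 0) * ψ τ t 0 - (starRingEnd ℂ) (ψ τ t 4) * ψ τ t 4
        + ((starRingEnd ℂ) (N τ t 0) * ψ τ t 0 + (starRingEnd ℂ) (ψ τ t 0) * N τ t 0)
        + 2 * ((starRingEnd ℂ) (N τ t 1) * ψ τ t 1 + (starRingEnd ℂ) (ψ τ t 1) * N τ t 1)
        + 2 * ((starRingEnd ℂ) (N τ t 2) * ψ τ t 2 + (starRingEnd ℂ) (ψ τ t 2) * N τ t 2)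
        + 2 * ((starRingEnd ℂ) (N τ t 3) * ψ τ t 3 + (starRingEnd ℂ) (ψ τ t 3) * N τ t 3)
        + ((starRingEnd ℂ) (N τ t 4) * ψ τ t 4 + (starRingEnd ℂ) (ψ τ t 4) * N τ t 4) := by
    intro τ hτ t
    rw [(hasDerivAt_energyDensity fun j => (hψ j).hasDerivAt hτ t).deriv, ← e0 τ hτ t,
      ← e1 τ hτ t, ← e2 τ hτ t, ← e3 τ hτ t, ← e4 τ hτ t]
    simp only [div, Fin.sum_univ_four, (hψ _).Xplus_conj_mul (hψ _) hτ,
      (hψ _).Xminus_conj_mul (hψ _) hτ, map_add, map_mul, map_div₀, map_one, Complex.conj_ofNat]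
    simp only [Fin.castSucc_zero, Fin.castSucc_one, Fin.succ_zero_eq_one, Fin.succ_one_eq_two,
      Fin.reduceCastSucc, Fin.reduceSucc]
    ring
  have hbound : ∀ T < 1, ∃ C, 0 ≤ C ∧ ∀ τ ∈ Icc (-T) T, ∀ t,
      ‖deriv (fun s => energyDensity ψ s t) τ + div τ t‖ ≤ C * (energyDensity ψ τ t).re := by
    intro T hT
    obtain ⟨C, hC0, hC⟩ := hN T hT
    -- The τ-derivative of the weights contributes 2, the sources contribute 2C + 3·4C + 2C, and
    -- 1/(1 - T) is the coercivity constant.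
    refine ⟨(2 + 16 * C) / (1 - T), by have : 0 < 1 - T := by linarith
                                       positivity, fun τ hτ t => ?_⟩
    have hTpos : 0 < 1 - T := by linarith
    rw [hR τ (Icc_subset_Ioo (by linarith) hT hτ) t]
    have hp : ∀ j, ‖ψ τ t j‖ ≤ ‖ψ τ t‖ := norm_le_pi_norm (ψ τ t)
    have hn : ∀ j, ‖N τ t j‖ ≤ C * ‖ψ τ t‖ := fun j => (norm_le_pi_norm _ j).trans (hC τ hτ t)
    have b1 : ∀ j, ‖(starRingEnd ℂ) (ψ τ t j) * ψ τ t j‖ ≤ ‖ψ τ t‖ ^ 2 := fun j => by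
      rw [norm_mul, RCLike.norm_conj, sq]
      exact mul_le_mul (hp j) (hp j) (norm_nonneg _) (norm_nonneg _)
    have b2 : ∀ j, ‖(starRingEnd ℂ) (N τ t j) * ψ τ t j + (starRingEnd ℂ) (ψ τ t j) * N τ t j‖
        ≤ 2 * C * ‖ψ τ t‖ ^ 2 := fun j => by
      refine (norm_add_le _ _).trans ?_
      rw [norm_mul, norm_mul, RCLike.norm_conj, RCLike.norm_conj]
      have := mul_le_mul (hn j) (hp j) (norm_nonneg _) (by positivity)
      linarith
    have b3 : ∀ j, ‖2 * ((starRingEnd ℂ) (N τ t j) * ψ τ t j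
        + (starRingEnd ℂ) (ψ τ t j) * N τ t j)‖ ≤ 4 * C * ‖ψ τ t‖ ^ 2 := fun j => by
      rw [norm_mul, RCLike.norm_ofNat]
      linarith [b2 j]
    refine (norm_add_le_of_le (norm_add_le_of_le (norm_add_le_of_le (norm_add_le_of_le
      (norm_add_le_of_le (norm_sub_le_of_le (b1 0) (b1 4)) (b2 0)) (b3 1)) (b3 2)) (b3 3))
      (b2 4)).trans ?_
    rw [div_mul_eq_mul_div, le_div_iff₀ hTpos]
    have := mul_le_mul_of_nonneg_left (norm_sq_le_energyDensity ψ hT hτ t)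
      (by positivity : 0 ≤ 2 + 16 * C)
    linarith
  have hE : ∀ τ ∈ Ioo (-1 : ℝ) 1, ∫ t, energyDensity ψ τ t ∂rightHaar = 0 := by
    refine gronwall_zero (fun τ hτ => he.hasDerivAt_integral hτ) (fun T hT => ?_) ?_
    · obtain ⟨C, hC0, hC⟩ := hbound T hT
      refine ⟨C, fun τ hτ => ?_⟩
      have hτ' : τ ∈ Ioo (-1 : ℝ) 1 := Icc_subset_Ioo (by linarith) hT hτ
      have hie := integrable_rightHaar (he.continuous hτ')
      have hide := integrable_rightHaar (he.deriv.continuous hτ')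
      have hidiv : Integrable (div τ) rightHaar := integrable_finsetSum _ fun j _ => hint τ hτ' j
      calc ‖∫ t, deriv (fun s => energyDensity ψ s t) τ ∂rightHaar‖
          = ‖∫ t, (deriv (fun s => energyDensity ψ s t) τ + div τ t) ∂rightHaar‖ := by
            rw [integral_add hide hidiv, hdiv τ hτ', add_zero]
        _ ≤ ∫ t, C * (energyDensity ψ τ t).re ∂rightHaar :=
            norm_integral_le_of_norm_le (hie.re.const_mul C)
              (Eventually.of_forall fun t => hC τ hτ t)
        _ = C * (∫ t, energyDensity ψ τ t ∂rightHaar).re := by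
            rw [integral_const_mul]
            congr 1
            exact integral_re hie
        _ ≤ C * ‖∫ t, energyDensity ψ τ t ∂rightHaar‖ :=
            mul_le_mul_of_nonneg_left (Complex.re_le_norm _) hC0
    · simp [energyDensity, h0]
  intro τ hτ t
  obtain ⟨T, hT, hT1⟩ := exists_between (abs_lt.2 hτ)
  have hmem : τ ∈ Icc (-T) T := Ioo_subset_Icc_self (abs_lt.1 hT)
  have hT0 : 0 < 1 - T := by linarith
  have hcont := he.continuous hτ
  have hnonneg : ∀ s, 0 ≤ (energyDensity ψ τ s).re := fun s =>
    (by positivity : 0 ≤ (1 - T) * ‖ψ τ s‖ ^ 2).trans (norm_sq_le_energyDensity ψ hT1 hmem s)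
  have hre : ∫ s, (energyDensity ψ τ s).re ∂rightHaar = 0 := by
    have h1 : ∫ s, (energyDensity ψ τ s).re ∂rightHaar = (∫ s, energyDensity ψ τ s ∂rightHaar).re :=
      integral_re (integrable_rightHaar hcont)
    rw [h1, hE τ hτ, Complex.zero_re]
  -- A continuous nonnegative function with zero integral vanishes everywhere, since nonempty open
  -- sets have positive measure.
  have hzero : (fun s => (energyDensity ψ τ s).re) = 0 := by
    have hc : Continuous fun s => (energyDensity ψ τ s).re := Complex.continuous_re.comp hcont
    exact (hc.ae_eq_iff_eq (μ := rightHaar) continuous_const).1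
      ((integral_eq_zero_iff_of_nonneg hnonneg (integrable_rightHaar hc)).1 hre)
  have h1 := norm_sq_le_energyDensity ψ hT1 hmem t
  rw [congrFun hzero t, Pi.zero_apply] at h1
  have h2 : ‖ψ τ t‖ ^ 2 ≤ 0 := by nlinarith [sq_nonneg ‖ψ τ t‖]
  exact norm_eq_zero.1 (pow_eq_zero_iff two_ne_zero |>.1 (le_antisymm h2 (sq_nonneg _)))

/-! ### The equations for `φ` -/

section Comparison

variable {p₀ : ℕ} {a : ℝ} {h : MetricField} {U W Wb : E3 → ℝ}
  {P : E3 → Matrix (Fin 3) (Fin 3) ℝ} {υ υs : ℕ → ℝ → SU2 → Ups} {φ φs : ℕ → ℝ → SU2 → Phi}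

lemma IsTransportSolution.exists_bound_ups {Ω : E3 → ℝ} (hsol : IsTransportSolution h P Ω υ φ)
    (p : ℕ) {T : ℝ} (hT : T < 1) : ∃ C, 0 ≤ C ∧ ∀ τ ∈ Icc (-T) T, ∀ t, ‖υ p τ t‖ ≤ C := by
  choose C hC0 hC using fun k => (hsol.smooth_ups p k).exists_bound hT
  refine ⟨∑ k, C k, Finset.sum_nonneg fun k _ => hC0 k, fun τ hτ t =>
    (pi_norm_le_iff_of_nonneg (Finset.sum_nonneg fun k _ => hC0 k)).2 fun k => ?_⟩
  exact (hC k τ hτ t).trans (Finset.single_le_sum (fun k _ => hC0 k) (Finset.mem_univ k))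

/-- The derivatives of the difference of two solutions, without the `ρ`-derivative. -/
def tangentialDeriv (ψ : ℝ → SU2 → Phi) (τ : ℝ) (t : SU2) : Fin 4 → Phi :=
  ![fun j => deriv (fun s => ψ s t j) τ, 0, fun j => Xplus (fun s => ψ τ s j) t,
    fun j => Xminus (fun s => ψ τ s j) t]

/-- The ρ-derivative is split off because it is the unknown of the next order. -/
lemma dPhi_sub {Ω Ωs : E3 → ℝ} (hsol : IsTransportSolution h P Ω υ φ)
    (hstatic : IsTransportSolution h P Ωs υs φs) (p : ℕ) {τ : ℝ} (hτ : τ ∈ Ioo (-1 : ℝ) 1)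
    (t : SU2) : dPhi φ p τ t - dPhi φs p τ t =
      tangentialDeriv (fun τ t => φ p τ t - φs p τ t) τ t
        + ![0, φ (p + 1) τ t - φs (p + 1) τ t, 0, 0] := by
  have hF := hsol.smooth_phi p
  have hG := hstatic.smooth_phi p
  funext μ j
  have e0 : deriv (fun s => φ p s t j - φs p s t j) τ
      = deriv (fun s => φ p s t j) τ - deriv (fun s => φs p s t j) τ :=
    (((hF j).hasDerivAt hτ t).sub ((hG j).hasDerivAt hτ t)).deriv
  have e1 := fun k => (hF j).leftInv_sub (hG j) hτ k t
  fin_cases μ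
  · simp [dPhi, tangentialDeriv, e0]
  · simp [dPhi, tangentialDeriv]
  · simp [dPhi, tangentialDeriv, Xplus, e1]; ring
  · simp [dPhi, tangentialDeriv, Xminus, e1]; ring

lemma tangentialDeriv_eq_zero {ψ : ℝ → SU2 → Phi} (hψ : ∀ τ ∈ Ioo (-1 : ℝ) 1, ∀ t, ψ τ t = 0)
    {τ : ℝ} (hτ : τ ∈ Ioo (-1 : ℝ) 1) (t : SU2) : tangentialDeriv ψ τ t = 0 := by
  have e0 : ∀ j, deriv (fun s => ψ s t j) τ = 0 := fun j => by
    have : (fun s => ψ s t j) =ᶠ[𝓝 τ] fun _ => 0 := by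
      filter_upwards [Ioo_mem_nhds hτ.1 hτ.2] with s hs
      rw [hψ s hs t, Pi.zero_apply]
    rw [this.deriv_eq, deriv_const]
  funext μ j
  fin_cases μ
  · simp [tangentialDeriv, e0]
  · simp [tangentialDeriv]
  · simp [tangentialDeriv, Xplus, leftInv, hψ τ hτ]
  · simp [tangentialDeriv, Xminus, leftInv, hψ τ hτ]

/-- The transport equation for the difference of two solutions which agree in lower order. -/
lemma transport_phi_sub {Ω Ωs : E3 → ℝ} (hsol : IsTransportSolution h P Ω υ φ)
    (hstatic : IsTransportSolution h P Ωs υs φs) {p : ℕ}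
    (hυ : ∀ j ≤ p, ∀ τ ∈ Ioo (-1 : ℝ) 1, ∀ t, υ j τ t = υs j τ t)
    (hφ : ∀ j < p, ∀ τ ∈ Ioo (-1 : ℝ) 1, ∀ t, φ j τ t = φs j τ t)
    (hρ : ∀ τ ∈ Ioo (-1 : ℝ) 1, ∀ t j, υs 0 τ t (.c 1 j) = 0)
    {τ : ℝ} (hτ : τ ∈ Ioo (-1 : ℝ) 1) (t : SU2) :
    (√2 : ℂ) • (fun k => deriv (fun s => φ p s t k - φs p s t k) τ)
      + bianchi (υs 0 τ t) (tangentialDeriv (fun τ t => φ p τ t - φs p τ t) τ t)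
          (φ p τ t - φs p τ t)
      + (p : ℂ) • bianchi (υs 1 τ t) ![0, φ p τ t - φs p τ t, 0, 0] 0 = 0 := by
  set δ : ℕ → Phi := fun q => φ q τ t - φs q τ t with hδ
  have hlow : ∀ q < p, tangentialDeriv (fun τ t => φ q τ t - φs q τ t) τ t = 0 := fun q hq =>
    tangentialDeriv_eq_zero (fun s hs r => sub_eq_zero.2 (hφ q hq s hs r)) hτ t
  have hlow' : ∀ q < p, δ q = 0 := fun q hq => sub_eq_zero.2 (hφ q hq τ hτ t)
  have hterm : ∀ j ≤ p, bianchiLin (υ j τ t) (dPhi φ (p - j) τ t, φ (p - j) τ t)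
      - bianchiLin (υs j τ t) (dPhi φs (p - j) τ t, φs (p - j) τ t)
      = bianchi (υs j τ t) (tangentialDeriv (fun τ t => φ (p - j) τ t - φs (p - j) τ t) τ t
          + ![0, δ (p - j + 1), 0, 0]) (δ (p - j)) := by
    intro j hj
    rw [hυ j hj τ hτ t, ← map_sub, Prod.mk_sub_mk, dPhi_sub hsol hstatic (p - j) hτ t]
    rfl
  have hvec : (![0, 0, 0, 0] : Fin 4 → Phi) = 0 := by
    funext μ; fin_cases μ <;> rfl
  have hz : ∀ u, bianchi u 0 0 = 0 := fun u => (bianchiLin u).map_zero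
  -- The coefficient c^ρ of order zero vanishes, so φ of order p + 1 does not enter.
  have h00 : bianchi (υs 0 τ t) (tangentialDeriv (fun τ t => φ p τ t - φs p τ t) τ t
      + ![0, δ (p + 1), 0, 0]) (δ p)
      = bianchi (υs 0 τ t) (tangentialDeriv (fun τ t => φ p τ t - φs p τ t) τ t) (δ p) := by
    simp [bianchi, divPhi, Fin.sum_univ_four, hρ τ hτ t]
  have hsum : ∑ j ∈ Finset.range (p + 1), (p.choose j : ℂ) •
      (bianchiLin (υ j τ t) (dPhi φ (p - j) τ t, φ (p - j) τ t)
        - bianchiLin (υs j τ t) (dPhi φs (p - j) τ t, φs (p - j) τ t))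
      = bianchi (υs 0 τ t) (tangentialDeriv (fun τ t => φ p τ t - φs p τ t) τ t) (δ p)
        + (p : ℂ) • bianchi (υs 1 τ t) ![0, δ p, 0, 0] 0 := by
    -- Besides j = 0 only j = 1 survives, where ∂_ρ raises order p - 1 to p; for j ≥ 2 every
    -- φ-difference is of lower order and vanishes.
    rcases p with _ | q
    · rw [zero_add, Finset.sum_range_one, hterm 0 le_rfl, Nat.choose_self, Nat.cast_one, one_smul,
        Nat.cast_zero, zero_smul, add_zero]
      exact h00
    · rw [Finset.sum_range_succ', Finset.sum_range_succ', Finset.sum_eq_zero, zero_add, add_comm]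
      · congr 1
        · rw [hterm 0 (Nat.zero_le _), Nat.choose_zero_right, Nat.cast_one, one_smul]
          exact h00
        · rw [hterm (0 + 1) (by omega)]
          simp only [zero_add, Nat.choose_one_right, Nat.add_sub_cancel, hlow q (Nat.lt_succ_self q),
            hlow' q (Nat.lt_succ_self q)]
      · intro j hj
        rw [Finset.mem_range] at hj
        rw [hterm (j + 1 + 1) (by omega), hlow _ (by omega), hlow' _ (by omega), hlow' _ (by omega),
          hvec, add_zero, hz, smul_zero]
  rw [add_assoc, ← hsum]
  funext k
  have e1 := hsol.transport_phi p τ hτ t k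
  have e2 := hstatic.transport_phi p τ hτ t k
  have e0 : deriv (fun s => φ p s t k - φs p s t k) τ
      = deriv (fun s => φ p s t k) τ - deriv (fun s => φs p s t k) τ :=
    (((hsol.smooth_phi p k).hasDerivAt hτ t).sub ((hstatic.smooth_phi p k).hasDerivAt hτ t)).deriv
  have e3 : (∑ j ∈ Finset.range (p + 1), (p.choose j : ℂ) •
      (bianchiLin (υ j τ t) (dPhi φ (p - j) τ t, φ (p - j) τ t)
        - bianchiLin (υs j τ t) (dPhi φs (p - j) τ t, φs (p - j) τ t))) k
      = ∑ j ∈ Finset.range (p + 1), (p.choose j : ℂ) *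
          bianchi (υ j τ t) (dPhi φ (p - j) τ t) (φ (p - j) τ t) k
        - ∑ j ∈ Finset.range (p + 1), (p.choose j : ℂ) *
          bianchi (υs j τ t) (dPhi φs (p - j) τ t) (φs (p - j) τ t) k := by
    rw [Finset.sum_apply, ← Finset.sum_sub_distrib]
    refine Finset.sum_congr rfl fun j _ => ?_
    rw [← mul_sub]
    rfl
  rw [Pi.add_apply, e3, Pi.smul_apply, smul_eq_mul, e0, Pi.zero_apply]
  linear_combination e1 - e2

/-- The unknown of order p solves the cylinder system with a source linear in itself and with
coefficients built from υ of orders 0 and 1, bounded on compact τ-intervals. Unlike for υ, the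
agreement is limited to p ≤ p₀ by the initial data. -/
lemma phi_eq_of_lower (hd : IsStaticUpToOrder p₀ a h U W Wb) (hP : IsRadialTransport a h P)
    (hsol : IsTransportSolution h P (conformalFactor U (W + Wb)) υ φ)
    (hstatic : IsTransportSolution h P (conformalFactor U W) υs φs) {p : ℕ} (hp : p ≤ p₀)
    (hυ : ∀ j ≤ p, ∀ τ ∈ Ioo (-1 : ℝ) 1, ∀ t, υ j τ t = υs j τ t)
    (hφ : ∀ j < p, ∀ τ ∈ Ioo (-1 : ℝ) 1, ∀ t, φ j τ t = φs j τ t) :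
    ∀ τ ∈ Ioo (-1 : ℝ) 1, ∀ t, φ p τ t = φs p τ t := by
  let ψ : ℝ → SU2 → Phi := fun τ t => φ p τ t - φs p τ t
  -- The terms without derivatives: the connection of order zero, and p times the coefficient of ∂_ρ
  -- in order one.
  let N : ℝ → SU2 → Phi := fun τ t => -(√2 : ℂ)⁻¹ •
    (bianchi (υs 0 τ t) 0 (ψ τ t) + (p : ℂ) • bianchi (υs 1 τ t) ![0, ψ τ t, 0, 0] 0)
  have hfr := fun τ (hτ : τ ∈ Ioo (-1 : ℝ) 1) t => ups_zero_frame hd hP hsol hstatic hτ t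
  have key : ∀ τ ∈ Ioo (-1 : ℝ) 1, ∀ t, (fun k => deriv (fun s => ψ s t k) τ)
      + ![τ * deriv (fun s => ψ s t 0) τ + Xplus (fun s => ψ τ s 1) t,
        (1 / 2) * (Xminus (fun s => ψ τ s 0) t + Xplus (fun s => ψ τ s 2) t),
        (1 / 2) * (Xminus (fun s => ψ τ s 1) t + Xplus (fun s => ψ τ s 3) t),
        (1 / 2) * (Xminus (fun s => ψ τ s 2) t + Xplus (fun s => ψ τ s 4) t),
        -τ * deriv (fun s => ψ s t 4) τ + Xminus (fun s => ψ τ s 3) t] = N τ t := by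
    intro τ hτ t
    have h1 := transport_phi_sub hsol hstatic hυ hφ (fun τ hτ t => (hfr τ hτ t).2.1) hτ t
    obtain ⟨f0, f1, f2, f3⟩ := hfr τ hτ t
    have hsplit : bianchi (υs 0 τ t) (tangentialDeriv ψ τ t) (ψ τ t)
        = bianchi (υs 0 τ t) (tangentialDeriv ψ τ t) 0 + bianchi (υs 0 τ t) 0 (ψ τ t) := by
      have := (bianchiLin (υs 0 τ t)).map_add (tangentialDeriv ψ τ t, 0) (0, ψ τ t)
      rw [Prod.mk_add_mk, add_zero, zero_add] at this
      exact this
    change (√2 : ℂ) • (fun k => deriv (fun s => ψ s t k) τ)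
      + bianchi (υs 0 τ t) (tangentialDeriv ψ τ t) (ψ τ t)
      + (p : ℂ) • bianchi (υs 1 τ t) ![0, ψ τ t, 0, 0] 0 = 0 at h1
    rw [hsplit, bianchi_cylinder f0 f1 f2 f3, ← add_assoc, ← smul_add, add_assoc] at h1
    have h2 := congrArg (fun z : Phi => (√2 : ℂ)⁻¹ • z) (eq_neg_of_add_eq_zero_left h1)
    simp only [inv_smul_smul₀ sqrt_two_ne, smul_neg, ← neg_smul] at h2
    exact h2
  have hzero := eq_zero_of_bianchi (ψ := ψ) (N := N)
    (fun j => (hsol.smooth_phi p j).sub (hstatic.smooth_phi p j))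
    (fun t => sub_eq_zero.2 (init_phi_eq hd hP hsol hstatic hp t))
    (fun τ hτ t => by rw [← key τ hτ t]; simp; ring)
    (fun τ hτ t => by rw [← key τ hτ t]; simp)
    (fun τ hτ t => by rw [← key τ hτ t]; simp)
    (fun τ hτ t => by rw [← key τ hτ t]; simp)
    (fun τ hτ t => by rw [← key τ hτ t]; simp; ring) ?_
  · exact fun τ hτ t => sub_eq_zero.1 (hzero τ hτ t)
  · intro T hT
    obtain ⟨B, hB0, hB⟩ := exists_bilinear_bound bianchiLin
    obtain ⟨C0, h00, hC0⟩ := hstatic.exists_bound_ups 0 hT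
    obtain ⟨C1, h10, hC1⟩ := hstatic.exists_bound_ups 1 hT
    refine ⟨‖-(√2 : ℂ)⁻¹‖ * (B * C0 + p * (B * C1)), by positivity, fun τ hτ t => ?_⟩
    rw [norm_smul, mul_assoc]
    refine mul_le_mul_of_nonneg_left ((norm_add_le _ _).trans ?_) (norm_nonneg _)
    have b0 : ‖bianchi (υs 0 τ t) 0 (ψ τ t)‖ ≤ B * C0 * ‖ψ τ t‖ := by
      refine (hB (υs 0 τ t) (0, ψ τ t)).trans ?_
      rw [Prod.norm_mk, norm_zero, max_eq_right (norm_nonneg _)]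
      gcongr
      exact hC0 τ hτ t
    have b1 : ‖bianchi (υs 1 τ t) ![0, ψ τ t, 0, 0] 0‖ ≤ B * C1 * ‖ψ τ t‖ := by
      refine (hB (υs 1 τ t) (![0, ψ τ t, 0, 0], 0)).trans ?_
      rw [Prod.norm_mk, norm_zero, max_eq_left (norm_nonneg _)]
      have hv : ‖(![0, ψ τ t, 0, 0] : Fin 4 → Phi)‖ ≤ ‖ψ τ t‖ :=
        (pi_norm_le_iff_of_nonneg (norm_nonneg _)).2 fun μ => by fin_cases μ <;> simp
      gcongr
      exact hC1 τ hτ t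
    rw [norm_smul, Complex.norm_natCast, add_mul, mul_assoc (p : ℝ)]
    gcongr

/-- Agreement of the two developments, by induction on the order. -/
lemma ups_phi_eq (hd : IsStaticUpToOrder p₀ a h U W Wb) (hP : IsRadialTransport a h P)
    (hsol : IsTransportSolution h P (conformalFactor U (W + Wb)) υ φ)
    (hstatic : IsTransportSolution h P (conformalFactor U W) υs φs) (p : ℕ) :
    (p ≤ p₀ + 1 → ∀ τ ∈ Ioo (-1 : ℝ) 1, ∀ t, υ p τ t = υs p τ t) ∧
    (p ≤ p₀ → ∀ τ ∈ Ioo (-1 : ℝ) 1, ∀ t, φ p τ t = φs p τ t) := by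
  induction p using Nat.strong_induction_on with
  | _ p ih =>
    -- The equation for υ of order p needs φ only below p, so it comes first; the equation for φ of
    -- order p then uses it. At p = p₀ + 1 only this half applies.
    have hυ : p ≤ p₀ + 1 → ∀ τ ∈ Ioo (-1 : ℝ) 1, ∀ t, υ p τ t = υs p τ t := fun hp =>
      ups_eq_of_lower hd hP hsol hstatic hp (fun j hj => (ih j hj).1 (by omega))
        (fun j hj => (ih j hj).2 (by omega))
    refine ⟨hυ, fun hp => phi_eq_of_lower hd hP hsol hstatic hp (fun j hj => ?_)
      (fun j hj => (ih j hj).2 (by omega))⟩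
    rcases hj.lt_or_eq with hj | rfl
    · exact (ih j hj).1 (by omega)
    · exact hυ (by omega)

end Comparison

end SpatialInfinity

end

theorem mainTheorem5 (p₀ : ℕ) (a : ℝ) (h : SpatialInfinity.MetricField)
    (U W Wb : SpatialInfinity.E3 → ℝ)
    (hdata : SpatialInfinity.IsStaticUpToOrder p₀ a h U W Wb)
    (P : SpatialInfinity.E3 → Matrix (Fin 3) (Fin 3) ℝ)
    (hP : SpatialInfinity.IsRadialTransport a h P)
    (υ υs : ℕ → ℝ → SpatialInfinity.SU2 → SpatialInfinity.Ups)
    (φ φs : ℕ → ℝ → SpatialInfinity.SU2 → SpatialInfinity.Phi)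
    (hsol : SpatialInfinity.IsTransportSolution h P
      (SpatialInfinity.conformalFactor U (W + Wb)) υ φ)
    (hstatic : SpatialInfinity.IsTransportSolution h P
      (SpatialInfinity.conformalFactor U W) υs φs) :
    (∀ p ≤ p₀ + 1, ∀ τ ∈ Set.Ioo (-1 : ℝ) 1, ∀ t, υ p τ t - υs p τ t = 0) ∧
    (∀ p ≤ p₀, ∀ τ ∈ Set.Ioo (-1 : ℝ) 1, ∀ t, φ p τ t - φs p τ t = 0) ∧
    (iteratedFDeriv ℝ (p₀ + 1) Wb 0 ≠ 0 → ∃ t, φ (p₀ + 1) 0 t - φs (p₀ + 1) 0 t ≠ 0) := by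
  have key := SpatialInfinity.ups_phi_eq hdata hP hsol hstatic
  exact ⟨fun p hp τ hτ t => sub_eq_zero.2 ((key p).1 hp τ hτ t),
    fun p hp τ hτ t => sub_eq_zero.2 ((key p).2 hp τ hτ t),
    SpatialInfinity.exists_init_phi_ne hdata hP hsol hstatic⟩
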